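/- Let $n\ge 1$, $p>2$ and $0<\lambda\le\Lambda$. Write $B_\rho(x_0)$ for the open Euclidean ball in $\mathbb R^n$ and, for $\rho,\theta>0$, put \[ (x_0,t_0)+Q^-_\rho(\theta)=B_\rho(x_0)\times(t_0-\theta\rho^p,\,t_0],\qquad (x_0,t_0)+Q^+_\rho(\theta)=B_\rho(x_0)\times[t_0,\,t_0+\theta\rho^p). \] Then there exist constants $c_1>0$, $C>1$ and $c_2\ge c_1$, depending only on $n,p,\lambda,\Lambda$, such that the following holds. Let $U\subset\mathbb R^n$ be open, $T>0$ and $U_T=U\times(0,T]$. Let $F=F(M,\xi,x,t)$ be a real-valued function of a symmetric $n\times n$ matrix $M$, a vector $\xi\in\mathbb R^n$ and a point $(x,t)\in U_T$ such that $F(0,\xi,x,t)=0$ and \[ \lambda|\xi|^{p-2}\,\mathrm{Tr}(N)\le F(M+N,\xi,x,t)-F(M,\xi,x,t)\le\Lambda|\xi|^{p-2}\,\mathrm{Tr}(N) \] for all $\xi\in\mathbb R^n$, $(x,t)\in U_T$, all symmetric $M$ and all symmetric positive semidefinite $N$. Let $u\in C(U_T)$ be a nonnegative viscosity solution of $\partial_t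 u-F(D^2u,Du,x,t)=0$ in $U_T$. That is, at every $(\hat x,\hat t)\in U_T$ and for every $\varphi\in C^2(U_T)$ with $\varphi(\hat x,\hat t)=u(\hat x,\hat t)$: if $\varphi\le u$ on $U_T\cap\{t\le\hat t\}$, then $\partial_t\varphi-F(D^2\varphi,D\varphi,\hat x,\hat t)\ge 0$ at $(\hat x,\hat t)$; and if $\varphi\ge u$ on $U_T\cap\{t\le\hat t\}$, then $\partial_t\varphi-F(D^2\varphi,D\varphi,\hat x,\hat t)\le 0$ at $(\hat x,\hat t)$. Here $D,D^2$ are the gradient and Hessian in $x$, and at $\hat t=T$ the time derivative is one-sided. Let $(x_0,t_0)\in U_T$ with $u(x_0,t_0)>0$, and let $\rho>0$. (Backward part.) Let $\theta_1=\left(\frac{c_1}{u(x_0,t_0)}\right)^{p-2}$. If $(x_0,t_0)+Q^-_{4\rho}(\theta_1)\subset U_T$, then \[ \sup_{Q^-}u\le C\,u(x_0,t_0),\qquad Q^-=(x_0,\,t_0-\theta_1\rho^p)+Q^-_\rho(\theta_1). \] (Forward part.) Let $\theta_2=\left(\frac{c_2}{u(x_0,t_0)}\right)^{p-2}$. If $(x_0,\,t_0+2\theta_2\rho^p)+Q^-_{4\rho}(\theta_2)\subset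 U_T$, then \[ \inf_{Q^+}u\ge\frac1C\,u(x_0,t_0),\qquad Q^+=(x_0,\,t_0+\theta_2\rho^p)+Q^+_\rho(\theta_2). \] -/

import Mathlib

open Set

noncomputable section

namespace DegenerateParabolic

/-- The space `ℝⁿ` with its Euclidean norm. -/
abbrev Space (n : ℕ) : Type := EuclideanSpace ℝ (Fin n)

/-- The cylindrical domain `U × (T₁, T₂]`. -/
def cylDomain {n : ℕ} (U : Set (Space n)) (T₁ T₂ : ℝ) : Set (Space n × ℝ) :=
  U ×ˢ Ioc T₁ T₂

/-- The cylinder `(x₀, t₀) + Q_ρ⁻(θ) = B_ρ(x₀) × (t₀ - θ ρ^p, t₀]`. -/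
def cylMinus {n : ℕ} (p : ℝ) (x₀ : Space n) (t₀ ρ θ : ℝ) : Set (Space n × ℝ) :=
  Metric.ball x₀ ρ ×ˢ Ioc (t₀ - θ * ρ ^ p) t₀

/-- The cylinder `(x₀, t₀) + Q_ρ⁺(θ) = B_ρ(x₀) × [t₀, t₀ + θ ρ^p)`. -/
def cylPlus {n : ℕ} (p : ℝ) (x₀ : Space n) (t₀ ρ θ : ℝ) : Set (Space n × ℝ) :=
  Metric.ball x₀ ρ ×ˢ Ico t₀ (t₀ + θ * ρ ^ p)

/-- An operator `F(M, ξ, x, t)`. Only its values at symmetric matrices `M` matter below. -/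
abbrev Operator (n : ℕ) : Type :=
  Matrix (Fin n) (Fin n) ℝ → Space n → Space n → ℝ → ℝ

/-- The structure condition on `F` over a space-time domain `Ω`:
`λ |ξ|^(p-2) Tr N ≤ F(M+N, ξ, x, t) - F(M, ξ, x, t) ≤ Λ |ξ|^(p-2) Tr N` for all symmetric `M` and
all symmetric `N ≥ 0`, and `F(0, ξ, x, t) = 0`. -/
structure IsDegenerateElliptic {n : ℕ} (p lam Lam : ℝ) (Ω : Set (Space n × ℝ))
    (F : Operator n) : Prop where
  lower : ∀ z ∈ Ω, ∀ (ξ : Space n) (M N : Matrix (Fin n) (Fin n) ℝ), M.IsSymm → N.PosSemidef →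
    lam * ‖ξ‖ ^ (p - 2) * N.trace ≤ F (M + N) ξ z.1 z.2 - F M ξ z.1 z.2
  upper : ∀ z ∈ Ω, ∀ (ξ : Space n) (M N : Matrix (Fin n) (Fin n) ℝ), M.IsSymm → N.PosSemidef →
    F (M + N) ξ z.1 z.2 - F M ξ z.1 z.2 ≤ Lam * ‖ξ‖ ^ (p - 2) * N.trace
  zero : ∀ z ∈ Ω, ∀ ξ : Space n, F 0 ξ z.1 z.2 = 0

/-- The gradient `Dφ(x, t)` in the space variable. -/
def spaceGrad {n : ℕ} (φ : Space n × ℝ → ℝ) (x : Space n) (t : ℝ) : Space n :=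
  gradient (fun y => φ (y, t)) x

/-- The Hessian matrix `D²φ(x, t)` in the space variable. -/
def spaceHess {n : ℕ} (φ : Space n × ℝ → ℝ) (x : Space n) (t : ℝ) :
    Matrix (Fin n) (Fin n) ℝ :=
  Matrix.of fun i j => fderiv ℝ (fderiv ℝ (fun y => φ (y, t))) x
    (EuclideanSpace.single i 1) (EuclideanSpace.single j 1)

/-- The time derivative `∂ₜφ(x, t)` of a function on `U × (T₁, T₂]`: two-sided for `t < T₂` and
one-sided at the final time `t = T₂`. -/
def timeDeriv {n : ℕ} (T₁ T₂ : ℝ) (φ : Space n × ℝ → ℝ) (x : Space n) (t : ℝ) : ℝ :=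
  derivWithin (fun s => φ (x, s)) (Ioc T₁ T₂) t

/-- `φ` touches `u` from below at `z₀`, where only the times up to that of `z₀` count. -/
def TouchesBelow {n : ℕ} (Ω : Set (Space n × ℝ)) (φ u : Space n × ℝ → ℝ)
    (z₀ : Space n × ℝ) : Prop :=
  (∀ z ∈ Ω, z.2 ≤ z₀.2 → φ z ≤ u z) ∧ φ z₀ = u z₀

/-- `φ` touches `u` from above at `z₀`, where only the times up to that of `z₀` count. -/
def TouchesAbove {n : ℕ} (Ω : Set (Space n × ℝ)) (φ u : Space n × ℝ → ℝ)
    (z₀ : Space n × ℝ) : Prop :=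
  (∀ z ∈ Ω, z.2 ≤ z₀.2 → u z ≤ φ z) ∧ φ z₀ = u z₀

/-- Viscosity supersolutions of `∂ₜu - F(D²u, Du, x, t) = 0` in `U × (T₁, T₂]`. -/
def IsViscositySupersolution {n : ℕ} (F : Operator n) (U : Set (Space n)) (T₁ T₂ : ℝ)
    (u : Space n × ℝ → ℝ) : Prop :=
  LowerSemicontinuousOn u (cylDomain U T₁ T₂) ∧
  ∀ φ : Space n × ℝ → ℝ, ContDiffOn ℝ 2 φ (cylDomain U T₁ T₂) →
    ∀ x₀ t₀, (x₀, t₀) ∈ cylDomain U T₁ T₂ → TouchesBelow (cylDomain U T₁ T₂) φ u (x₀, t₀) →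
      0 ≤ timeDeriv T₁ T₂ φ x₀ t₀ - F (spaceHess φ x₀ t₀) (spaceGrad φ x₀ t₀) x₀ t₀

/-- Viscosity subsolutions of `∂ₜu - F(D²u, Du, x, t) = 0` in `U × (T₁, T₂]`. -/
def IsViscositySubsolution {n : ℕ} (F : Operator n) (U : Set (Space n)) (T₁ T₂ : ℝ)
    (u : Space n × ℝ → ℝ) : Prop :=
  UpperSemicontinuousOn u (cylDomain U T₁ T₂) ∧
  ∀ φ : Space n × ℝ → ℝ, ContDiffOn ℝ 2 φ (cylDomain U T₁ T₂) →
    ∀ x₀ t₀, (x₀, t₀) ∈ cylDomain U T₁ T₂ → TouchesAbove (cylDomain U T₁ T₂) φ u (x₀, t₀) →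
      timeDeriv T₁ T₂ φ x₀ t₀ - F (spaceHess φ x₀ t₀) (spaceGrad φ x₀ t₀) x₀ t₀ ≤ 0

/-- Viscosity solutions of `∂ₜu - F(D²u, Du, x, t) = 0` in `U × (T₁, T₂]`. -/
def IsViscositySolution {n : ℕ} (F : Operator n) (U : Set (Space n)) (T₁ T₂ : ℝ)
    (u : Space n × ℝ → ℝ) : Prop :=
  ContinuousOn u (cylDomain U T₁ T₂) ∧
  IsViscositySupersolution F U T₁ T₂ u ∧ IsViscositySubsolution F U T₁ T₂ u

end DegenerateParabolic

end

noncomputable section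

namespace DegenerateParabolic

open Filter Topology
open scoped RealInnerProductSpace Manifold ContDiff

/-! The equation is used only through one-sided inequalities. On a Hessian of the form rank one
minus a multiple of the identity, ellipticity bounds `F` from both sides. Hence `u` and every `c -
u` satisfy the same supersolution inequality `SuperAt`, with `N = Lam * n`. This class is invariant
under `u ↦ u / k` combined with the intrinsic scaling `(r, k^(2-p) r^p)` of space and time
(`SuperAt.rescale`), which is the origin of the waiting times `(c / u(x₀, t₀))^(p-2) ρ^p`.

Three facts about nonnegative supersolutions carry the argument. First, comparison with a
Barenblatt-type subsolution spreads a bound `u ≥ k` from a ball of radius `r` to balls of radius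
comparable to `r X^β`, at the price of a factor `X^(-a)`, where `X` is one plus the elapsed time in
intrinsic units (`exists_spreading`).

Second, if `u` is small at one point, it is bounded on a fixed fraction of the preceding cylinder
(`exists_measure_estimate`). Cusps `s + 3t - 8‖x - y‖^q` with `q = p/(p-1)` are raised until they
touch `u` from below. With this exponent cusps erode at bounded speed (`exists_erosion`), so for
each vertex the contact times fill a set of positive length. At a fixed time, two contact points
much closer than their vertices would place `u` above a strong convex kink which it nearly touches,
contradicting the equation (`kink_bound`). So vertices are Lipschitz functions of contact points
(`exists_contact_lipschitz`), and Fubini bounds the measure of the contact set from below. No second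
derivatives of `u` and no regularization of `u` are needed.

Third, a growing ink spots argument with time delay (`volume_le_of_ink_spots`) combines the first
two facts: largeness on a set of positive measure yields a lower bound on a small ball at some time
(`exists_measure_to_point`).

For a solution that is large at the origin, maximizing `v` times a power of the distance to the
boundary selects a point where `v = m` is nearly maximal at its own scale `r` and at least of order
`r^(-γ)`. The measure estimate for `1.1 m - v` makes `v` large on a fraction of a cylinder, hence on
a ball (`exists_large_ball`). The exponent `γ = a/β` is the one for which spreading from this ball
reaches unit size with a bound independent of `r` (`exists_spreading_large`). This is the forward
inequality. The backward inequality follows from it by continuity: if `u` were too large at an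
earlier point, it would take the value `C u(x₀, t₀)` somewhere on a parabolic path, and the forward
inequality from there would contradict the value at `(x₀, t₀)`. -/

/-- `u` is a supersolution at `z`, tested with quadratic polynomials whose Hessian is a rank-one
matrix minus a multiple of the identity. -/
def SuperAt {n : ℕ} (p lam N : ℝ) (u : Space n × ℝ → ℝ) (z : Space n × ℝ) : Prop :=
  ∀ (τ : ℝ) (g w : Space n) (A : ℝ), 0 ≤ A →
    (∀ᶠ y in 𝓝 z, y.2 ≤ z.2 →
      u z + τ * (y.2 - z.2) + ⟪g, y.1 - z.1⟫ + (⟪w, y.1 - z.1⟫ ^ 2 - A * ‖y.1 - z.1‖ ^ 2) / 2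
        ≤ u y) →
    ‖g‖ ^ (p - 2) * (lam * ‖w‖ ^ 2 - N * A) ≤ τ

/-- Continuous nonnegative supersolutions on `Q`. -/
structure PosSuper {n : ℕ} (p lam N : ℝ) (Q : Set (Space n × ℝ)) (u : Space n × ℝ → ℝ) : Prop where
  cont : ContinuousOn u Q
  nonneg : ∀ z ∈ Q, 0 ≤ u z
  super : ∀ z ∈ Q, SuperAt p lam N u z

lemma PosSuper.mono {n : ℕ} {p lam N : ℝ} {Q Q' : Set (Space n × ℝ)} {u : Space n × ℝ → ℝ}
    (h : PosSuper p lam N Q u) (hQ : Q' ⊆ Q) : PosSuper p lam N Q' u :=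
  ⟨h.cont.mono hQ, fun z hz => h.nonneg z (hQ hz), fun z hz => h.super z (hQ hz)⟩

lemma two_le_infty : (2 : WithTop ℕ∞) ≤ ∞ := by
  rw [show (2 : WithTop ℕ∞) = ((2 : ℕ∞) : WithTop ℕ∞) from rfl]
  exact WithTop.coe_le_coe.2 le_top

/-! ### Derivatives of the quadratic test polynomials. -/

section Quadratic

variable {n : ℕ}

/-- The quadratic test polynomial centred at `z`. -/
def quadPoly (z : Space n × ℝ) (c τ κ : ℝ) (g w : Space n) (A : ℝ) (y : Space n × ℝ) : ℝ :=
  c + τ * (y.2 - z.2) + ⟪g, y.1 - z.1⟫ + κ * (⟪w, y.1 - z.1⟫ ^ 2 - A * ‖y.1 - z.1‖ ^ 2) / 2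

lemma contDiff_quadPoly (z : Space n × ℝ) (c τ κ : ℝ) (g w : Space n) (A : ℝ) :
    ContDiff ℝ ∞ (quadPoly z c τ κ g w A) := by
  unfold quadPoly
  have h1 : ContDiff ℝ ∞ (fun y : Space n × ℝ => y.1 - z.1) := contDiff_fst.sub contDiff_const
  have h2 : ContDiff ℝ ∞ (fun y : Space n × ℝ => ⟪g, y.1 - z.1⟫) := contDiff_const.inner ℝ h1
  have h3 : ContDiff ℝ ∞ (fun y : Space n × ℝ => ⟪w, y.1 - z.1⟫) := contDiff_const.inner ℝ h1
  have h4 : ContDiff ℝ ∞ (fun y : Space n × ℝ => ‖y.1 - z.1‖ ^ 2) := h1.norm_sq ℝ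
  have h5 : ContDiff ℝ ∞ (fun y : Space n × ℝ => y.2 - z.2) := contDiff_snd.sub contDiff_const
  exact ((contDiff_const.add (contDiff_const.mul h5)).add h2).add
    ((contDiff_const.mul ((h3.pow 2).sub (contDiff_const.mul h4))).div_const _)

lemma timeDeriv_of_eventuallyEq_quadPoly {T₁ T₂ : ℝ} {φ : Space n × ℝ → ℝ} {z : Space n × ℝ}
    {c τ κ : ℝ} {g w : Space n} {A : ℝ} (hz : z.2 ∈ Ioc T₁ T₂)
    (h : φ =ᶠ[𝓝 z] quadPoly z c τ κ g w A) : timeDeriv T₁ T₂ φ z.1 z.2 = τ := by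
  have hc : Tendsto (fun s : ℝ => (z.1, s)) (𝓝 z.2) (𝓝 z) :=
    (Continuous.prodMk_right z.1).tendsto z.2
  have h1 : (fun s => φ (z.1, s)) =ᶠ[𝓝 z.2] fun s => c + τ * (s - z.2) := by
    filter_upwards [hc.eventually h] with s hs
    simp [hs, quadPoly]
  have h2 : HasDerivAt (fun s : ℝ => c + τ * (s - z.2)) τ z.2 := by
    simpa using (((hasDerivAt_id z.2).sub_const z.2).const_mul τ).const_add c
  have h3 : HasDerivAt (fun s => φ (z.1, s)) τ z.2 := h2.congr_of_eventuallyEq h1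
  exact h3.hasDerivWithinAt.derivWithin ((uniqueDiffOn_Ioc T₁ T₂) z.2 hz)

lemma hasFDerivAt_quadPoly_space (z : Space n × ℝ) (c τ κ : ℝ) (g w : Space n) (A : ℝ)
    (x : Space n) :
    HasFDerivAt (fun y => quadPoly z c τ κ g w A (y, z.2))
      (innerSL ℝ g + κ • (⟪w, x - z.1⟫ • innerSL ℝ w - A • innerSL ℝ (x - z.1))) x := by
  have h1 : HasFDerivAt (fun y : Space n => y - z.1) (ContinuousLinearMap.id ℝ _) x :=
    (hasFDerivAt_id x).sub_const z.1
  have h2 : HasFDerivAt (fun y : Space n => ⟪g, y - z.1⟫) (innerSL ℝ g) x := by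
    exact ((innerSL ℝ g).hasFDerivAt.comp x h1).congr_fderiv (ContinuousLinearMap.comp_id _)
  have h3 : HasFDerivAt (fun y : Space n => ⟪w, y - z.1⟫) (innerSL ℝ w) x := by
    exact ((innerSL ℝ w).hasFDerivAt.comp x h1).congr_fderiv (ContinuousLinearMap.comp_id _)
  have h4 := h1.norm_sq
  have h5 := (h2.const_add c).add
    ((((h3.pow 2).sub (h4.const_mul A)).const_mul κ).mul_const (1 / 2 : ℝ))
  have h6 : (fun y => quadPoly z c τ κ g w A (y, z.2)) = fun y : Space n =>
      c + ⟪g, y - z.1⟫ + κ * (⟪w, y - z.1⟫ ^ 2 - A * ‖y - z.1‖ ^ 2) * (1 / 2) := by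
    funext y
    simp only [quadPoly]
    ring
  rw [h6]
  refine h5.congr_fderiv ?_
  ext v
  simp
  ring

lemma spaceGrad_of_eventuallyEq_quadPoly {φ : Space n × ℝ → ℝ} {z : Space n × ℝ}
    {c τ κ : ℝ} {g w : Space n} {A : ℝ} (h : φ =ᶠ[𝓝 z] quadPoly z c τ κ g w A) :
    spaceGrad φ z.1 z.2 = g := by
  have hc : Tendsto (fun x : Space n => (x, z.2)) (𝓝 z.1) (𝓝 z) :=
    (Continuous.prodMk_left z.2).tendsto z.1
  have h1 : (fun x => φ (x, z.2)) =ᶠ[𝓝 z.1] fun x => quadPoly z c τ κ g w A (x, z.2) :=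
    hc.eventually h
  have h2 := (hasFDerivAt_quadPoly_space z c τ κ g w A z.1).congr_of_eventuallyEq h1
  unfold spaceGrad
  have h3 : HasGradientAt (fun x => φ (x, z.2)) g z.1 := by
    rw [hasGradientAt_iff_hasFDerivAt]
    refine h2.congr_fderiv ?_
    ext v
    simp
  exact h3.gradient

lemma spaceHess_of_eventuallyEq_quadPoly {φ : Space n × ℝ → ℝ} {z : Space n × ℝ}
    {c τ κ : ℝ} {g w : Space n} {A : ℝ} (h : φ =ᶠ[𝓝 z] quadPoly z c τ κ g w A) :
    spaceHess φ z.1 z.2 = κ • (Matrix.vecMulVec w w - A • (1 : Matrix (Fin n) (Fin n) ℝ)) := by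
  have hc : Tendsto (fun x : Space n => (x, z.2)) (𝓝 z.1) (𝓝 z) :=
    (Continuous.prodMk_left z.2).tendsto z.1
  have h1 : (fun x => φ (x, z.2)) =ᶠ[𝓝 z.1] fun x => quadPoly z c τ κ g w A (x, z.2) :=
    hc.eventually h
  have h2 : fderiv ℝ (fun x => φ (x, z.2)) =ᶠ[𝓝 z.1] fun x =>
      innerSL ℝ g + κ • (⟪w, x - z.1⟫ • innerSL ℝ w - A • innerSL ℝ (x - z.1)) := by
    filter_upwards [h1.fderiv (𝕜 := ℝ)] with x hx
    rw [hx, (hasFDerivAt_quadPoly_space z c τ κ g w A x).fderiv]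
  have hid : HasFDerivAt (fun y : Space n => y - z.1) (ContinuousLinearMap.id ℝ _) z.1 :=
    (hasFDerivAt_id z.1).sub_const z.1
  have h3 : HasFDerivAt (fun y : Space n => ⟪w, y - z.1⟫) (innerSL ℝ w) z.1 := by
    exact ((innerSL ℝ w).hasFDerivAt.comp z.1 hid).congr_fderiv (ContinuousLinearMap.comp_id _)
  have h4 : HasFDerivAt (fun y : Space n => innerSL ℝ (y - z.1)) (innerSL ℝ : Space n →L[ℝ] _)
      z.1 := by
    exact ((innerSL ℝ : Space n →L[ℝ] _).hasFDerivAt.comp z.1 hid).congr_fderiv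
      (ContinuousLinearMap.comp_id _)
  have h5 := ((((h3.smul_const (innerSL ℝ w)).sub (h4.const_smul A)).const_smul κ).const_add
    (innerSL ℝ g)).congr_of_eventuallyEq h2
  ext i j
  simp only [spaceHess, Matrix.of_apply]
  rw [h5.fderiv]
  have h6 : (innerSL ℝ : Space n →L[ℝ] _) (EuclideanSpace.single i 1) (EuclideanSpace.single j 1)
      = (1 : Matrix (Fin n) (Fin n) ℝ) i j := by
    rw [innerSL_apply_apply, EuclideanSpace.inner_single_left, Matrix.one_apply]
    simp [PiLp.single_apply]
  simp [Matrix.vecMulVec_apply, EuclideanSpace.inner_single_right, h6]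

end Quadratic

/-! ### Ellipticity bounds on rank-one perturbations of multiples of the identity. -/

section Structure

variable {n : ℕ} {p lam Lam : ℝ} {Ω : Set (Space n × ℝ)} {F : Operator n}

lemma trace_vecMulVec_self (w : Space n) :
    (Matrix.vecMulVec w w : Matrix (Fin n) (Fin n) ℝ).trace = ‖w‖ ^ 2 := by
  rw [EuclideanSpace.real_norm_sq_eq]
  simp [Matrix.trace, Matrix.vecMulVec_apply, sq]

lemma posSemidef_vecMulVec (w : Space n) :
    (Matrix.vecMulVec w w : Matrix (Fin n) (Fin n) ℝ).PosSemidef := by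
  simpa using Matrix.posSemidef_vecMulVec_self_star (R := ℝ) (w : Fin n → ℝ)

lemma posSemidef_smul_one {A : ℝ} (hA : 0 ≤ A) :
    (A • (1 : Matrix (Fin n) (Fin n) ℝ)).PosSemidef :=
  Matrix.PosSemidef.one.smul hA

lemma isSymm_smul_one (A : ℝ) : (A • (1 : Matrix (Fin n) (Fin n) ℝ)).IsSymm := by
  simp [Matrix.IsSymm]

lemma isSymm_vecMulVec (w : Space n) :
    (Matrix.vecMulVec w w : Matrix (Fin n) (Fin n) ℝ).IsSymm := by
  ext i j
  simp [Matrix.vecMulVec_apply, mul_comm]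

/-- The summand `w wᵀ` gains at least `lam` times its trace over the value at `-A • 1`. That value
is bounded below because adding `A • 1` leads back to `F 0 = 0`; the trace of the identity produces
the factor `n`. -/
lemma IsDegenerateElliptic.le_rankOne (hF : IsDegenerateElliptic p lam Lam Ω F)
    {z : Space n × ℝ} (hz : z ∈ Ω) (ξ w : Space n) {A : ℝ} (hA : 0 ≤ A) :
    ‖ξ‖ ^ (p - 2) * (lam * ‖w‖ ^ 2 - Lam * n * A) ≤
      F (Matrix.vecMulVec w w - A • (1 : Matrix (Fin n) (Fin n) ℝ)) ξ z.1 z.2 := by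
  have h1 := hF.lower z hz ξ (-(A • (1 : Matrix (Fin n) (Fin n) ℝ))) (Matrix.vecMulVec w w)
    (isSymm_smul_one A).neg (posSemidef_vecMulVec w)
  have h2 := hF.upper z hz ξ (-(A • (1 : Matrix (Fin n) (Fin n) ℝ))) (A • 1)
    (isSymm_smul_one A).neg (posSemidef_smul_one hA)
  rw [neg_add_cancel, hF.zero z hz] at h2
  rw [trace_vecMulVec_self, neg_add_eq_sub] at h1
  simp only [Matrix.trace_smul, Matrix.trace_one, Fintype.card_fin, smul_eq_mul] at h2
  linarith

/-- This mirror image of `le_rankOne` does not need `F` to be odd: adding `w wᵀ` to the negated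
matrix leaves `A • 1`. It is the reason why `c - u` belongs to the same class as `u`. -/
lemma IsDegenerateElliptic.rankOne_le (hF : IsDegenerateElliptic p lam Lam Ω F)
    {z : Space n × ℝ} (hz : z ∈ Ω) (ξ w : Space n) {A : ℝ} (hA : 0 ≤ A) :
    F (-(Matrix.vecMulVec w w - A • (1 : Matrix (Fin n) (Fin n) ℝ))) ξ z.1 z.2 ≤
      -(‖ξ‖ ^ (p - 2) * (lam * ‖w‖ ^ 2 - Lam * n * A)) := by
  have h1 := hF.lower z hz ξ (-(Matrix.vecMulVec w w - A • (1 : Matrix (Fin n) (Fin n) ℝ)))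
    (Matrix.vecMulVec w w) ((isSymm_vecMulVec w).sub (isSymm_smul_one A)).neg
    (posSemidef_vecMulVec w)
  have h2 := hF.upper z hz ξ 0 (A • 1) Matrix.isSymm_zero (posSemidef_smul_one hA)
  rw [zero_add, hF.zero z hz] at h2
  have h3 : -(Matrix.vecMulVec w w - A • (1 : Matrix (Fin n) (Fin n) ℝ)) + Matrix.vecMulVec w w
      = A • 1 := by abel
  rw [trace_vecMulVec_self, h3] at h1
  simp only [Matrix.trace_smul, Matrix.trace_one, Fintype.card_fin, smul_eq_mul] at h2
  linarith

end Structure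

/-! ### From viscosity solutions to `SuperAt`. -/

section Viscosity

variable {n : ℕ} {p lam Lam : ℝ} {U : Set (Space n)} {T₁ T₂ : ℝ} {F : Operator n}
  {u : Space n × ℝ → ℝ}

lemma isOpen_prod_Ioi (hU : IsOpen U) : IsOpen (U ×ˢ Ioi T₁) := hU.prod isOpen_Ioi

/-- Local property up to time `z.2` holds on a small closed ball contained in `U × (T₁, ∞)`. -/
lemma exists_closedBall_of_eventually (hU : IsOpen U) {z : Space n × ℝ}
    (hz : z ∈ cylDomain U T₁ T₂) {P : Space n × ℝ → Prop} (h : ∀ᶠ y in 𝓝 z, P y) :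
    ∃ r > 0, Metric.closedBall z r ⊆ U ×ˢ Ioi T₁ ∧ ∀ y ∈ Metric.closedBall z r, P y := by
  have h1 : U ×ˢ Ioi T₁ ∈ 𝓝 z := (isOpen_prod_Ioi hU).mem_nhds ⟨hz.1, hz.2.1⟩
  obtain ⟨r, hr, hrs⟩ := Metric.nhds_basis_closedBall.mem_iff.1 (inter_mem h1 h)
  exact ⟨r, hr, fun y hy => (hrs hy).1, fun y hy => (hrs hy).2⟩

/-- A bump function glues the local quadratic polynomial to the constant `-1`, which lies below `u`
everywhere since `u ≥ 0`. The result is an admissible global test function with the same jet at `z`.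
-/
lemma IsViscositySupersolution.superAt (hU : IsOpen U)
    (hF : IsDegenerateElliptic p lam Lam (cylDomain U T₁ T₂) F)
    (hu : IsViscositySupersolution F U T₁ T₂ u) (hpos : ∀ z ∈ cylDomain U T₁ T₂, 0 ≤ u z)
    {z : Space n × ℝ} (hz : z ∈ cylDomain U T₁ T₂) : SuperAt p lam (Lam * n) u z := by
  intro τ g w A hA hloc
  obtain ⟨r, hr, -, hrP⟩ := exists_closedBall_of_eventually hU hz hloc
  let f : ContDiffBump z := ⟨r / 2, r, by positivity, by linarith⟩
  let φ : Space n × ℝ → ℝ := fun y => f y * quadPoly z (u z) τ 1 g w A y + (1 - f y) * (-1)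
  have hφ : ContDiff ℝ ∞ φ :=
    (f.contDiff.mul (contDiff_quadPoly z (u z) τ 1 g w A)).add
      ((contDiff_const.sub f.contDiff).mul contDiff_const)
  have heq : φ =ᶠ[𝓝 z] quadPoly z (u z) τ 1 g w A := by
    filter_upwards [f.eventuallyEq_one] with y hy
    simp only [φ, hy, Pi.one_apply]
    ring
  have htouch : TouchesBelow (cylDomain U T₁ T₂) φ u (z.1, z.2) := by
    refine ⟨fun y hy hyt => ?_, ?_⟩
    · have h0 : 0 ≤ f y := f.nonneg
      have h1 : f y ≤ 1 := f.le_one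
      by_cases hyr : y ∈ Metric.closedBall z r
      · have h2 : quadPoly z (u z) τ 1 g w A y ≤ u y := by
          simpa [quadPoly] using hrP y hyr hyt
        have h3 : -1 ≤ u y := by linarith [hpos y hy]
        have := mul_le_mul_of_nonneg_left h2 h0
        have := mul_le_mul_of_nonneg_left h3 (sub_nonneg.2 h1)
        simp only [φ]
        linarith
      · have h2 : f y = 0 := f.zero_of_le_dist (by
          simpa [f] using (not_le.1 (fun h => hyr (Metric.mem_closedBall.2 h))).le)
        simp only [φ, h2]
        linarith [hpos y hy]
    · rw [show ((z.1, z.2) : Space n × ℝ) = z from rfl, heq.self_of_nhds]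
      simp [quadPoly]
  have h := hu.2 φ ((hφ.of_le two_le_infty).contDiffOn) z.1 z.2 hz htouch
  rw [timeDeriv_of_eventuallyEq_quadPoly hz.2 heq, spaceGrad_of_eventuallyEq_quadPoly heq,
    spaceHess_of_eventuallyEq_quadPoly heq, one_smul] at h
  linarith [hF.le_rankOne hz g w hA]

/-- A continuous function on `U × (T₁, T₂]` has a smooth majorant. -/
lemma exists_smooth_majorant (hU : IsOpen U) (hu : ContinuousOn u (cylDomain U T₁ T₂)) :
    ∃ G : Space n × ℝ → ℝ, ContDiffOn ℝ 2 G (cylDomain U T₁ T₂) ∧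
      ∀ z ∈ cylDomain U T₁ T₂, u z ≤ G z := by
  by_cases hT : T₁ < T₂
  swap
  · have : cylDomain U T₁ T₂ = ∅ := by simp [cylDomain, Ioc_eq_empty hT]
    exact ⟨0, by simp [this], by simp [this]⟩
  let O : TopologicalSpace.Opens (Space n × ℝ) := ⟨U ×ˢ Ioi T₁, isOpen_prod_Ioi hU⟩
  -- Freezing the time at `T₂` extends `u` continuously to the open set `U × (T₁, ∞)`, where a
  -- smooth majorant can be glued from local constants.
  let v : O → ℝ := fun z => u (z.1.1, min z.1.2 T₂)
  have hv : Continuous v := by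
    refine hu.comp_continuous (by fun_prop) fun z => ⟨z.2.1, lt_min z.2.2 hT, min_le_right _ _⟩
  have : SigmaCompactSpace O := by
    have : LocallyCompactSpace O := O.isOpen.locallyCompactSpace
    infer_instance
  obtain ⟨g, hg⟩ := exists_contMDiffMap_forall_mem_convex_of_local_const
    (I := 𝓘(ℝ, Space n × ℝ)) (M := O) (n := 2) (t := fun z => Ici (v z))
    (fun z => convex_Ici _) (fun z => ⟨v z + 1, by
      filter_upwards [hv.continuousAt.eventually_lt_const (lt_add_one (v z))] with y hy
      exact hy.le⟩)
  classical
  let G : Space n × ℝ → ℝ := fun z => if h : z ∈ O then g ⟨z, h⟩ else 0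
  have hGg : (fun x : O => G x) = g := by
    funext x
    simp [G]
  refine ⟨G, fun z hz => ?_, fun z hz => ?_⟩
  · have hzO : z ∈ O := ⟨hz.1, hz.2.1⟩
    have h1 : ContMDiffAt 𝓘(ℝ, Space n × ℝ) 𝓘(ℝ, ℝ) 2 (fun x : O => G x) ⟨z, hzO⟩ := by
      rw [hGg]
      exact g.contMDiff _
    exact (contMDiffAt_iff_contDiffAt.1 (contMDiffAt_subtype_iff.1 h1)).contDiffWithinAt
  · have hzO : z ∈ O := ⟨hz.1, hz.2.1⟩
    have h1 := hg ⟨z, hzO⟩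
    simp only [mem_Ici, v, min_eq_left hz.2.2] at h1
    simpa [G, hzO] using h1

/-- The gluing of `superAt` now needs a `C²` function above `u` on the whole domain. Since `u` need
not be bounded, `exists_smooth_majorant` replaces the constant. -/
lemma IsViscositySubsolution.superAt_const_sub (hU : IsOpen U)
    (hF : IsDegenerateElliptic p lam Lam (cylDomain U T₁ T₂) F)
    (hc : ContinuousOn u (cylDomain U T₁ T₂))
    (hu : IsViscositySubsolution F U T₁ T₂ u) (c : ℝ)
    {z : Space n × ℝ} (hz : z ∈ cylDomain U T₁ T₂) :
    SuperAt p lam (Lam * n) (fun y => c - u y) z := by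
  intro τ g w A hA hloc
  obtain ⟨G, hG, hGu⟩ := exists_smooth_majorant hU hc
  obtain ⟨r, hr, -, hrP⟩ := exists_closedBall_of_eventually hU hz hloc
  let f : ContDiffBump z := ⟨r / 2, r, by positivity, by linarith⟩
  let Q := quadPoly z (u z) (-τ) (-1) (-g) w A
  let φ : Space n × ℝ → ℝ := fun y => f y * Q y + (1 - f y) * G y
  have hf2 : ContDiff ℝ 2 f := f.contDiff
  have hφ : ContDiffOn ℝ 2 φ (cylDomain U T₁ T₂) :=
    ((hf2.mul ((contDiff_quadPoly z (u z) (-τ) (-1) (-g) w A).of_le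
      two_le_infty)).contDiffOn).add
      (((contDiff_const.sub hf2).contDiffOn).mul hG)
  have heq : φ =ᶠ[𝓝 z] Q := by
    filter_upwards [f.eventuallyEq_one] with y hy
    simp only [φ, hy, Pi.one_apply]
    ring
  have htouch : TouchesAbove (cylDomain U T₁ T₂) φ u (z.1, z.2) := by
    refine ⟨fun y hy hyt => ?_, ?_⟩
    · have h0 : 0 ≤ f y := f.nonneg
      have h1 : f y ≤ 1 := f.le_one
      by_cases hyr : y ∈ Metric.closedBall z r
      · have h2 : u y ≤ Q y := by
          have := hrP y hyr hyt
          simp only [Q, quadPoly, inner_neg_left]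
          linarith
        have := mul_le_mul_of_nonneg_left h2 h0
        have := mul_le_mul_of_nonneg_left (hGu y hy) (sub_nonneg.2 h1)
        simp only [φ]
        linarith
      · have h2 : f y = 0 := f.zero_of_le_dist (by
          simpa [f] using (not_le.1 (fun h => hyr (Metric.mem_closedBall.2 h))).le)
        simp only [φ, h2]
        linarith [hGu y hy]
    · rw [show ((z.1, z.2) : Space n × ℝ) = z from rfl, heq.self_of_nhds]
      simp [Q, quadPoly]
  have h := hu.2 φ hφ z.1 z.2 hz htouch
  rw [timeDeriv_of_eventuallyEq_quadPoly hz.2 heq, spaceGrad_of_eventuallyEq_quadPoly heq,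
    spaceHess_of_eventuallyEq_quadPoly heq, neg_one_smul] at h
  have h' := hF.rankOne_le hz (-g) w hA
  rw [norm_neg] at h'
  linarith

end Viscosity

end DegenerateParabolic

end

noncomputable section

namespace DegenerateParabolic

open Filter Topology Asymptotics
open scoped RealInnerProductSpace

/-! ### Lower Taylor expansions and comparison with strict barriers. -/

section Jets

variable {n : ℕ} {p lam N : ℝ} {u : Space n × ℝ → ℝ} {z : Space n × ℝ}

/-- The supersolution inequality also holds for second order lower Taylor expansions. -/
lemma SuperAt.le_of_approx (h : SuperAt p lam N u z) {τ : ℝ} {g w : Space n} {A : ℝ} (hA : 0 ≤ A)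
    (hloc : ∀ ε > 0, ∀ᶠ y in 𝓝 z, y.2 ≤ z.2 →
      u z + τ * (y.2 - z.2) + ⟪g, y.1 - z.1⟫ + (⟪w, y.1 - z.1⟫ ^ 2 - A * ‖y.1 - z.1‖ ^ 2) / 2
        - ε * (‖y.1 - z.1‖ ^ 2 + |y.2 - z.2|) ≤ u y) :
    ‖g‖ ^ (p - 2) * (lam * ‖w‖ ^ 2 - N * A) ≤ τ := by
  -- For times up to `z.2` the error term is itself of the admissible form: it raises `A` by `2ε`
  -- and `τ` by `ε`.
  have key : ∀ ε > 0, ‖g‖ ^ (p - 2) * (lam * ‖w‖ ^ 2 - N * (A + 2 * ε)) ≤ τ + ε := by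
    intro ε hε
    refine h (τ + ε) g w (A + 2 * ε) (by positivity) ?_
    filter_upwards [hloc ε hε] with y hy hyt
    have h1 := hy hyt
    rw [abs_of_nonpos (by linarith)] at h1
    linarith
  have hlim : Tendsto (fun ε : ℝ => τ + ε - ‖g‖ ^ (p - 2) * (lam * ‖w‖ ^ 2 - N * (A + 2 * ε)))
      (𝓝[>] 0) (𝓝 (τ + 0 - ‖g‖ ^ (p - 2) * (lam * ‖w‖ ^ 2 - N * (A + 2 * 0)))) := by
    refine Tendsto.mono_left (Continuous.tendsto ?_ 0) nhdsWithin_le_nhds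
    fun_prop
  have := ge_of_tendsto hlim (by
    filter_upwards [self_mem_nhdsWithin] with ε hε
    exact sub_nonneg.2 (key ε hε))
  simp only [add_zero, mul_zero] at this
  linarith

/-- Comparison with a strict subsolution. -/
lemma le_of_strict_barrier {x₀ : Space n} {R t₁ t₂ : ℝ} {B : Space n × ℝ → ℝ}
    (hu : ContinuousOn u (Metric.closedBall x₀ R ×ˢ Icc t₁ t₂))
    (hs : ∀ z ∈ Metric.closedBall x₀ R ×ˢ Icc t₁ t₂, SuperAt p lam N u z)
    (hB : ContinuousOn B (Metric.closedBall x₀ R ×ˢ Icc t₁ t₂))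
    (hbar : ∀ z ∈ Metric.closedBall x₀ R ×ˢ Icc t₁ t₂, u z < B z →
      z.1 ∈ Metric.ball x₀ R ∧ t₁ < z.2 ∧ ∃ (τ : ℝ) (g w : Space n) (A : ℝ), 0 ≤ A ∧
        (∀ ε > 0, ∀ᶠ y in 𝓝 z, y.2 ≤ z.2 →
          B z + τ * (y.2 - z.2) + ⟪g, y.1 - z.1⟫
            + (⟪w, y.1 - z.1⟫ ^ 2 - A * ‖y.1 - z.1‖ ^ 2) / 2
            - ε * (‖y.1 - z.1‖ ^ 2 + |y.2 - z.2|) ≤ B y) ∧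
        τ < ‖g‖ ^ (p - 2) * (lam * ‖w‖ ^ 2 - N * A)) :
    ∀ z ∈ Metric.closedBall x₀ R ×ˢ Icc t₁ t₂, B z ≤ u z := by
  intro z₀ hz₀
  have hK : IsCompact (Metric.closedBall x₀ R ×ˢ Icc t₁ t₂) :=
    (isCompact_closedBall x₀ R).prod isCompact_Icc
  -- At a negative minimum a translate of `B` touches `u` from below. By `hbar` this is not on the
  -- lateral or initial boundary; the final time is harmless because only earlier times are tested.
  obtain ⟨z, hz, hmin⟩ := hK.exists_isMinOn ⟨z₀, hz₀⟩ (hu.sub hB)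
  by_contra hcon
  have hneg : u z < B z := by
    have := hmin hz₀
    simp only [mem_ofPred_eq, Pi.sub_apply] at this
    linarith
  obtain ⟨hzb, hzt, τ, g, w, A, hA, hjet, hlt⟩ := hbar z hz hneg
  refine absurd ((hs z hz).le_of_approx hA fun ε hε => ?_) (not_le.2 hlt)
  have hnb : Metric.ball x₀ R ×ˢ Ioi t₁ ∈ 𝓝 z :=
    (Metric.isOpen_ball.prod isOpen_Ioi).mem_nhds ⟨hzb, hzt⟩
  filter_upwards [hjet ε hε, hnb] with y hy hyn hyt
  have h1 : y ∈ Metric.closedBall x₀ R ×ˢ Icc t₁ t₂ :=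
    ⟨Metric.ball_subset_closedBall hyn.1, le_of_lt hyn.2, hyt.trans hz.2.2⟩
  have h2 := hmin h1
  simp only [mem_ofPred_eq, Pi.sub_apply] at h2
  linarith [hy hyt]

end Jets

/-! ### Invariance under intrinsic scaling. -/

section Scaling

variable {n : ℕ} {p lam N : ℝ} {u : Space n × ℝ → ℝ}

/-- The affine map `(x, t) ↦ (x₀ + r x, t₀ + θ t)`. -/
def scaleMap (x₀ : Space n) (t₀ r θ : ℝ) (z : Space n × ℝ) : Space n × ℝ :=
  (x₀ + r • z.1, t₀ + θ * z.2)

lemma continuous_scaleMap (x₀ : Space n) (t₀ r θ : ℝ) : Continuous (scaleMap x₀ t₀ r θ) := by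
  unfold scaleMap
  fun_prop

/-- Undoing the scaling multiplies gradients by `k / r`, Hessians by `k / r²` and time derivatives
by `k / θ`. The choice of `θ` is the one for which both sides of the inequality acquire the same
factor. Since `w` enters squared, it is multiplied by `√k / r`. -/
lemma SuperAt.rescale {x₀ : Space n} {t₀ r θ k : ℝ} (hr : 0 < r) (hk : 0 < k)
    (hθ : θ = k ^ (2 - p) * r ^ p) {z : Space n × ℝ}
    (h : SuperAt p lam N u (scaleMap x₀ t₀ r θ z)) :
    SuperAt p lam N (fun y => u (scaleMap x₀ t₀ r θ y) / k) z := by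
  intro τ g w A hA hloc
  have hθ0 : 0 < θ := by rw [hθ]; positivity
  let inv : Space n × ℝ → Space n × ℝ := fun y => (r⁻¹ • (y.1 - x₀), θ⁻¹ * (y.2 - t₀))
  have hinv : Continuous inv := by fun_prop
  have hi1 : ∀ y, scaleMap x₀ t₀ r θ (inv y) = y := by
    intro y
    ext1
    · simp [scaleMap, inv, smul_smul, hr.ne']
    · simp [scaleMap, inv, hθ0.ne']
  have hi2 : inv (scaleMap x₀ t₀ r θ z) = z := by
    ext1
    · simp [scaleMap, inv, smul_smul, hr.ne']
    · simp [scaleMap, inv, hθ0.ne']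
  have htd : Tendsto inv (𝓝 (scaleMap x₀ t₀ r θ z)) (𝓝 z) := by
    simpa [hi2] using hinv.tendsto (scaleMap x₀ t₀ r θ z)
  have key := h (k / θ * τ) ((k / r) • g) ((√k / r) • w) (k / r ^ 2 * A) (by positivity) ?_
  · have h1 : ‖(k / r) • g‖ ^ (p - 2) = k ^ (p - 2) / r ^ (p - 2) * ‖g‖ ^ (p - 2) := by
      rw [norm_smul, Real.norm_of_nonneg (by positivity),
        Real.mul_rpow (by positivity) (norm_nonneg _), Real.div_rpow hk.le hr.le]
    have h2 : ‖(√k / r) • w‖ ^ 2 = k / r ^ 2 * ‖w‖ ^ 2 := by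
      rw [norm_smul, Real.norm_of_nonneg (by positivity), mul_pow, div_pow, Real.sq_sqrt hk.le]
    rw [h1, h2] at key
    have h3 : k / θ = k ^ (p - 2) / r ^ (p - 2) * (k / r ^ 2) := by
      rw [hθ, show 2 - p = -(p - 2) by ring, Real.rpow_neg hk.le,
        show r ^ p = r ^ (p - 2) * r ^ 2 by
          rw [← Real.rpow_natCast r 2, ← Real.rpow_add hr]; norm_num]
      field_simp
    have h4 : 0 < k / θ := by positivity
    have h5 : k / θ * (‖g‖ ^ (p - 2) * (lam * ‖w‖ ^ 2 - N * A)) ≤ k / θ * τ := by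
      calc _ = k ^ (p - 2) / r ^ (p - 2) * ‖g‖ ^ (p - 2) *
            (lam * (k / r ^ 2 * ‖w‖ ^ 2) - N * (k / r ^ 2 * A)) := by rw [h3]; ring
        _ ≤ _ := key
    exact le_of_mul_le_mul_left h5 h4
  · filter_upwards [htd.eventually hloc] with y hy hyt
    have h1 : (inv y).2 ≤ z.2 := by
      rw [← hi2]
      exact mul_le_mul_of_nonneg_left (sub_le_sub_right hyt _) (by positivity)
    have h2 := hy h1
    simp only [hi1] at h2
    have e1 : (inv y).1 - z.1 = r⁻¹ • (y.1 - (scaleMap x₀ t₀ r θ z).1) := by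
      conv_lhs => rw [← hi2]
      simp only [inv, ← smul_sub]
      congr 1
      abel
    have e2 : (inv y).2 - z.2 = θ⁻¹ * (y.2 - (scaleMap x₀ t₀ r θ z).2) := by
      conv_lhs => rw [← hi2]
      simp only [inv]
      ring
    rw [e1, e2] at h2
    have h3 := mul_le_mul_of_nonneg_left h2 hk.le
    rw [mul_div_cancel₀ _ hk.ne'] at h3
    refine le_trans (le_of_eq ?_) h3
    simp only [inner_smul_left, inner_smul_right, norm_smul, mul_pow, norm_inv,
      Real.norm_of_nonneg hr.le, div_pow, Real.sq_sqrt hk.le, RCLike.conj_to_real]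
    field_simp

lemma PosSuper.rescale {Q : Set (Space n × ℝ)} (h : PosSuper p lam N Q u) {x₀ : Space n}
    {t₀ r θ k : ℝ} (hr : 0 < r) (hk : 0 < k) (hθ : θ = k ^ (2 - p) * r ^ p)
    {Q' : Set (Space n × ℝ)} (hQ : ∀ z ∈ Q', scaleMap x₀ t₀ r θ z ∈ Q) :
    PosSuper p lam N Q' (fun y => u (scaleMap x₀ t₀ r θ y) / k) where
  cont := (h.cont.comp (continuous_scaleMap x₀ t₀ r θ).continuousOn hQ).div_const k
  nonneg z hz := div_nonneg (h.nonneg _ (hQ z hz)) hk.le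
  super z hz := SuperAt.rescale hr hk hθ (h.super _ (hQ z hz))

end Scaling

/-! ### Barenblatt barriers and the spreading of positivity. -/

section Barenblatt

variable {n : ℕ}

lemma rpow_taylor_two {c : ℝ} (hc : 0 < c) (m : ℝ) :
    (fun y : ℝ => y ^ m - (c ^ m + m * c ^ (m - 1) * (y - c)
      + m * (m - 1) * c ^ (m - 2) * (y - c) ^ 2 / 2)) =o[𝓝 c] fun y => (y - c) ^ 2 := by
  have hd : ∀ y ∈ Ioi (0 : ℝ), HasDerivWithinAt (fun y : ℝ => y ^ m - (c ^ m
      + m * c ^ (m - 1) * (y - c) + m * (m - 1) * c ^ (m - 2) * (y - c) ^ 2 / 2))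
      (m * y ^ (m - 1) - (m * c ^ (m - 1) + m * (m - 1) * c ^ (m - 2) * (y - c))) (Ioi 0) y := by
    intro y hy
    have h1 := Real.hasDerivAt_rpow_const (p := m) (Or.inl (ne_of_gt hy))
    have h2 : HasDerivAt (fun y : ℝ => y - c) 1 y := (hasDerivAt_id y).sub_const c
    have h3 := h1.sub (((h2.const_mul (m * c ^ (m - 1))).const_add (c ^ m)).add
      (((h2.pow 2).const_mul (m * (m - 1) * c ^ (m - 2))).div_const 2))
    refine (h3.congr_deriv ?_).hasDerivWithinAt
    simp
    ring
  have h0 : (fun y : ℝ => m * y ^ (m - 1)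
      - (m * c ^ (m - 1) + m * (m - 1) * c ^ (m - 2) * (y - c))) =o[𝓝[Ioi 0] c]
      fun y => (y - c) ^ 1 := by
    have h1 := ((Real.hasDerivAt_rpow_const (p := m - 1) (Or.inl hc.ne')).const_mul m).isLittleO
    refine (h1.mono nhdsWithin_le_nhds).congr (fun y => ?_) (fun y => by simp)
    rw [show m - 1 - 1 = m - 2 by ring]
    simp only [smul_eq_mul]
    ring
  have h2 := Convex.isLittleO_pow_succ_real (convex_Ioi (0 : ℝ)) (mem_Ioi.2 hc) hd h0
  rw [nhdsWithin_eq_nhds.2 (Ioi_mem_nhds hc)] at h2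
  refine h2.congr (fun y => ?_) (fun y => ?_)
  · simp
  · norm_num

/-- Second order expansion of a power of `κ(t) - ρ(t) |x|²`. -/
lemma isLittleO_barenblatt {κ ρ : ℝ → ℝ} {κ' ρ' : ℝ} {z : Space n × ℝ}
    (hκ : HasDerivAt κ κ' z.2) (hρ : HasDerivAt ρ ρ' z.2)
    (hpos : 0 < κ z.2 - ρ z.2 * ‖z.1‖ ^ 2) (m : ℝ) :
    (fun y : Space n × ℝ => (κ y.2 - ρ y.2 * ‖y.1‖ ^ 2) ^ m -
      ((κ z.2 - ρ z.2 * ‖z.1‖ ^ 2) ^ m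
        + m * (κ z.2 - ρ z.2 * ‖z.1‖ ^ 2) ^ (m - 1) *
          ((κ' - ρ' * ‖z.1‖ ^ 2) * (y.2 - z.2) - 2 * ρ z.2 * ⟪z.1, y.1 - z.1⟫
            - ρ z.2 * ‖y.1 - z.1‖ ^ 2)
        + m * (m - 1) * (κ z.2 - ρ z.2 * ‖z.1‖ ^ 2) ^ (m - 2) *
          (4 * ρ z.2 ^ 2 * ⟪z.1, y.1 - z.1⟫ ^ 2) / 2)) =o[𝓝 z]
      fun y => ‖y.1 - z.1‖ ^ 2 + |y.2 - z.2| := by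
  set S : Space n × ℝ → ℝ := fun y => κ y.2 - ρ y.2 * ‖y.1‖ ^ 2 with hS
  set c : ℝ := κ z.2 - ρ z.2 * ‖z.1‖ ^ 2 with hcdef
  set E : Space n × ℝ → ℝ := fun y => ‖y.1 - z.1‖ ^ 2 + |y.2 - z.2| with hE
  set L : Space n × ℝ → ℝ := fun y => (κ' - ρ' * ‖z.1‖ ^ 2) * (y.2 - z.2)
    - 2 * ρ z.2 * ⟪z.1, y.1 - z.1⟫ - ρ z.2 * ‖y.1 - z.1‖ ^ 2 with hL
  have hsnd : Tendsto (fun y : Space n × ℝ => y.2) (𝓝 z) (𝓝 z.2) := continuous_snd.tendsto z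
  have hEnn : ∀ y, 0 ≤ E y := fun y => by positivity
  have ht : (fun y : Space n × ℝ => y.2 - z.2) =O[𝓝 z] E :=
    IsBigO.of_bound 1 (Eventually.of_forall fun y => by
      rw [one_mul, Real.norm_eq_abs, Real.norm_of_nonneg (hEnn y)]
      simp only [hE]
      nlinarith [sq_nonneg ‖y.1 - z.1‖])
  have hh : (fun y : Space n × ℝ => ‖y.1 - z.1‖ ^ 2) =O[𝓝 z] E :=
    IsBigO.of_bound 1 (Eventually.of_forall fun y => by
      rw [one_mul, Real.norm_of_nonneg (by positivity), Real.norm_of_nonneg (hEnn y)]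
      simp only [hE]
      linarith [abs_nonneg (y.2 - z.2)])
  have hScont : Tendsto S (𝓝 z) (𝓝 c) := by
    have h1 : Tendsto (fun y : Space n × ℝ => κ y.2) (𝓝 z) (𝓝 (κ z.2)) :=
      hκ.continuousAt.tendsto.comp hsnd
    have h2 : Tendsto (fun y : Space n × ℝ => ρ y.2) (𝓝 z) (𝓝 (ρ z.2)) :=
      hρ.continuousAt.tendsto.comp hsnd
    have h3 : Tendsto (fun y : Space n × ℝ => ‖y.1‖ ^ 2) (𝓝 z) (𝓝 (‖z.1‖ ^ 2)) :=
      (by fun_prop : Continuous fun y : Space n × ℝ => ‖y.1‖ ^ 2).tendsto z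
    exact h1.sub (h2.mul h3)
  -- `L` is the parabolic expansion, of first order in time and second order in space; mixed terms
  -- are negligible against `E`.
  have hY : (fun y => S y - c - L y) =o[𝓝 z] E := by
    have h1 : (fun y : Space n × ℝ => κ y.2 - κ z.2 - (y.2 - z.2) * κ') =o[𝓝 z] E := by
      have := hκ.isLittleO.comp_tendsto hsnd
      simp only [Function.comp_def, smul_eq_mul] at this
      exact this.trans_isBigO ht
    have h2 : (fun y : Space n × ℝ => ρ y.2 - ρ z.2 - (y.2 - z.2) * ρ') =o[𝓝 z] E := by
      have := hρ.isLittleO.comp_tendsto hsnd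
      simp only [Function.comp_def, smul_eq_mul] at this
      exact this.trans_isBigO ht
    have h3 : (fun y : Space n × ℝ => ‖y.1‖ ^ 2) =O[𝓝 z] (fun _ => (1 : ℝ)) :=
      ((by fun_prop : Continuous fun y : Space n × ℝ => ‖y.1‖ ^ 2).tendsto z).isBigO_one ℝ
    have h4 : (fun y : Space n × ℝ => ρ' * (‖y.1‖ ^ 2 - ‖z.1‖ ^ 2)) =o[𝓝 z] (fun _ => (1 : ℝ)) := by
      rw [isLittleO_one_iff]
      have := (by fun_prop : Continuous fun y : Space n × ℝ =>
        ρ' * (‖y.1‖ ^ 2 - ‖z.1‖ ^ 2)).tendsto z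
      simpa using this
    have h5 := (h1.sub ((h2.mul_isBigO h3).congr_right fun y => mul_one _)).sub
      ((ht.mul_isLittleO h4).congr_right fun y => mul_one _)
    refine h5.congr_left fun y => ?_
    have e : ‖y.1‖ ^ 2 = ‖z.1‖ ^ 2 + 2 * ⟪z.1, y.1 - z.1⟫ + ‖y.1 - z.1‖ ^ 2 := by
      rw [← norm_add_sq_real, add_sub_cancel]
    simp only [hS, hcdef, hL]
    linear_combination ρ z.2 * e
  have hinner : (fun y : Space n × ℝ => ⟪z.1, y.1 - z.1⟫ ^ 2) =O[𝓝 z] E := by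
    refine IsBigO.trans (IsBigO.of_bound (‖z.1‖ ^ 2) (Eventually.of_forall fun y => ?_)) hh
    rw [Real.norm_of_nonneg (by positivity), Real.norm_of_nonneg (by positivity), ← mul_pow,
      ← sq_abs]
    exact pow_le_pow_left₀ (abs_nonneg _) (abs_real_inner_le_norm _ _) 2
  -- A difference of squares: one factor is `O(E)` and the other tends to zero.
  have hYsq : (fun y => (S y - c) ^ 2 - 4 * ρ z.2 ^ 2 * ⟪z.1, y.1 - z.1⟫ ^ 2) =o[𝓝 z] E := by
    have h1 : (fun y => S y - c + 2 * ρ z.2 * ⟪z.1, y.1 - z.1⟫) =O[𝓝 z] E := by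
      have := (hY.isBigO.add (ht.const_mul_left (κ' - ρ' * ‖z.1‖ ^ 2))).sub
        (hh.const_mul_left (ρ z.2))
      refine this.congr_left fun y => ?_
      simp only [hL]
      ring
    have h2 : (fun y => S y - c - 2 * ρ z.2 * ⟪z.1, y.1 - z.1⟫) =o[𝓝 z] fun _ => (1 : ℝ) := by
      rw [isLittleO_one_iff]
      have h3 := (by fun_prop : Continuous fun y : Space n × ℝ =>
        2 * ρ z.2 * ⟪z.1, y.1 - z.1⟫).tendsto z
      simpa using (hScont.sub_const c).sub h3
    refine ((h1.mul_isLittleO h2).congr_right fun y => mul_one _).congr_left fun y => ?_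
    ring
  have hYO : (fun y => (S y - c) ^ 2) =O[𝓝 z] E := by
    refine (hYsq.isBigO.add (hinner.const_mul_left (4 * ρ z.2 ^ 2))).congr_left fun y => ?_
    ring
  have hT := ((rpow_taylor_two hpos m).comp_tendsto hScont).trans_isBigO hYO
  refine ((hT.add (hY.const_mul_left (m * c ^ (m - 1)))).add
    (hYsq.const_mul_left (m * (m - 1) * c ^ (m - 2) / 2))).congr_left fun y => ?_
  simp only [Function.comp_def, hL]
  ring

/-- Here `X` stands for the squared radius relative to the support of the profile, and `s = 1 - X`.
Near the edge, `s < s₀`, the rank-one term is positive and dominates `2mβX` once `β` is small. In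
the interior the decay `-a s` dominates both `2mβX` and the unfavourable term, at most `D N`.
Keeping `β p ≤ 1/2` forces `a ≥ 1/(2(p-2))`, so the choices can be made in the order `s₀`, `D`, `β`.
-/
lemma barenblatt_constants {p lam N : ℝ} (hp : 2 < p) (hlam : 0 < lam) (hN : 0 ≤ N) :
    ∃ a β D : ℝ, 0 < a ∧ 0 < β ∧ β ≤ 1 / 10 ∧ 0 < D ∧ D ≤ 1 ∧ a * (p - 2) + β * p = 1 ∧
      ∀ s X : ℝ, 0 < s → 0 ≤ X → s + X = 1 →
        -a * s + 2 * ((p - 1) / (p - 2)) * β * X <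
          D * X ^ ((p - 2) / 2) * (2 * lam * ((p - 1) / (p - 2) - 1) * X - N * s) := by
  have hp2 : 0 < p - 2 := by linarith
  set m := (p - 1) / (p - 2) with hm
  have hm1 : 0 < m - 1 := by
    rw [hm, div_sub_one hp2.ne']
    exact div_pos (by linarith) hp2
  have hm0 : 0 < m := by linarith
  obtain ⟨s₀, hs₀, hs₀h, hs₀N⟩ : ∃ s₀ : ℝ, 0 < s₀ ∧ s₀ ≤ 1 / 2 ∧ N * s₀ ≤ lam * (m - 1) / 2 := by
    refine ⟨min (1 / 2) (lam * (m - 1) / 2 / (N + 1)), by positivity, min_le_left _ _, ?_⟩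
    calc N * min (1 / 2) (lam * (m - 1) / 2 / (N + 1))
        ≤ N * (lam * (m - 1) / 2 / (N + 1)) := by gcongr; exact min_le_right _ _
      _ = (N / (N + 1)) * (lam * (m - 1) / 2) := by ring
      _ ≤ 1 * (lam * (m - 1) / 2) := by
          gcongr
          rw [div_le_one (by linarith)]
          linarith
      _ = _ := one_mul _
  obtain ⟨D, hD, hD1, hDN⟩ : ∃ D : ℝ, 0 < D ∧ D ≤ 1 ∧ D * N ≤ s₀ / (8 * (p - 2)) := by
    refine ⟨min 1 (s₀ / (8 * (p - 2)) / (N + 1)), by positivity, min_le_left _ _, ?_⟩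
    calc min 1 (s₀ / (8 * (p - 2)) / (N + 1)) * N
        ≤ (s₀ / (8 * (p - 2)) / (N + 1)) * N := by gcongr; exact min_le_right _ _
      _ = (N / (N + 1)) * (s₀ / (8 * (p - 2))) := by ring
      _ ≤ 1 * (s₀ / (8 * (p - 2))) := by
          gcongr
          rw [div_le_one (by linarith)]
          linarith
      _ = _ := one_mul _
  set K := (1 / 2 : ℝ) ^ ((p - 2) / 2) * (lam * (m - 1) / 2) with hK
  have hK0 : 0 < K := by positivity
  obtain ⟨β, hβ, hβ1, hβ2, hβ3, hβ4⟩ : ∃ β : ℝ, 0 < β ∧ β ≤ 1 / 10 ∧ β * p ≤ 1 / 2 ∧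
      2 * m * β ≤ s₀ / (8 * (p - 2)) ∧ 2 * m * β ≤ D * K := by
    refine ⟨min (min (1 / 10) (1 / (2 * p)))
      (min (s₀ / (8 * (p - 2)) / (2 * m)) (D * K / (2 * m))), by positivity, ?_, ?_, ?_, ?_⟩
    · exact (min_le_left _ _).trans (min_le_left _ _)
    · rw [← le_div_iff₀ (by linarith)]
      refine (min_le_left _ _).trans ((min_le_right _ _).trans (le_of_eq ?_))
      field_simp
    · rw [mul_comm, ← le_div_iff₀ (by linarith)]
      exact (min_le_right _ _).trans (min_le_left _ _)
    · rw [mul_comm, ← le_div_iff₀ (by linarith)]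
      exact (min_le_right _ _).trans (min_le_right _ _)
  have ha : 1 / (2 * (p - 2)) ≤ (1 - β * p) / (p - 2) := by
    rw [div_le_div_iff₀ (by positivity) hp2]
    nlinarith
  have ha0 : 0 < (1 - β * p) / (p - 2) := lt_of_lt_of_le (by positivity) ha
  refine ⟨(1 - β * p) / (p - 2), β, D, ha0, hβ, hβ1, hD, hD1, ?_, ?_⟩
  · field_simp
    ring
  intro s X hs hX hsX
  have hX1 : X ≤ 1 := by linarith
  have hXp : 0 ≤ X ^ ((p - 2) / 2) := Real.rpow_nonneg hX _
  have hXp1 : X ^ ((p - 2) / 2) ≤ 1 := Real.rpow_le_one hX hX1 (by linarith)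
  have hb : 2 * m * β * X ≤ 2 * m * β := mul_le_of_le_one_right (by positivity) hX1
  rcases lt_or_ge s s₀ with h | h
  · have h1 : lam * (m - 1) / 2 ≤ 2 * lam * (m - 1) * X - N * s := by
      have : N * s ≤ N * s₀ := by gcongr
      have : 2 * lam * (m - 1) * (1 / 2) ≤ 2 * lam * (m - 1) * X := by
        gcongr
        linarith
      linarith
    have h2 : (1 / 2 : ℝ) ^ ((p - 2) / 2) ≤ X ^ ((p - 2) / 2) :=
      Real.rpow_le_rpow (by norm_num) (by linarith) (by linarith)
    have h3 : D * K ≤ D * X ^ ((p - 2) / 2) * (2 * lam * (m - 1) * X - N * s) := by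
      rw [hK, mul_assoc]
      gcongr
    have h4 : 0 < (1 - β * p) / (p - 2) * s := mul_pos ha0 hs
    linarith
  · have h1 : -(N * 1) ≤ 2 * lam * (m - 1) * X - N * s := by
      have : N * s ≤ N * 1 := by gcongr; linarith
      have : 0 ≤ 2 * lam * (m - 1) * X := by positivity
      linarith
    have h2 : -(D * N) ≤ D * X ^ ((p - 2) / 2) * (2 * lam * (m - 1) * X - N * s) := by
      have h3 : D * X ^ ((p - 2) / 2) * (-(N * 1)) ≤
          D * X ^ ((p - 2) / 2) * (2 * lam * (m - 1) * X - N * s) := by gcongr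
      have h4 : D * X ^ ((p - 2) / 2) * N ≤ D * 1 * N := by gcongr
      linarith
    have h5 : 1 / (2 * (p - 2)) * s₀ ≤ (1 - β * p) / (p - 2) * s := by gcongr
    have h6 : 1 / (2 * (p - 2)) * s₀ = 4 * (s₀ / (8 * (p - 2))) := by field_simp; norm_num
    have h7 : 0 < s₀ / (8 * (p - 2)) := by positivity
    linarith

/-- Spreading of positivity at the unit scale. -/
lemma exists_spreading_unit {p lam N : ℝ} (hp : 2 < p) (hlam : 0 < lam) (hN : 0 ≤ N) :
    ∃ a β κ₀ : ℝ, 0 < a ∧ 0 < β ∧ β ≤ 1 / 10 ∧ 0 < κ₀ ∧ κ₀ ≤ 1 ∧ a * (p - 2) + β * p = 1 ∧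
      ∀ (u : Space n × ℝ → ℝ) (R T : ℝ), 0 ≤ T →
        PosSuper p lam N (Metric.closedBall 0 R ×ˢ Icc 0 T) u →
        (∀ x ∈ Metric.closedBall (0 : Space n) 1, 1 ≤ u (x, 0)) → (1 + T) ^ β ≤ R →
        ∀ x : Space n, ‖x‖ ≤ (1 + T) ^ β / 2 → κ₀ * (1 + T) ^ (-a) ≤ u (x, T) := by
  obtain ⟨a, β, D, ha, hβ, hβ1, hD, hD1, hab, hineq⟩ := barenblatt_constants hp hlam hN
  have hp2 : 0 < p - 2 := by linarith
  have hp1 : 0 < p - 1 := by linarith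
  -- The power for which `(m - 1) * (p - 2) = 1`: then `‖DB‖^(p-2)` is linear in `S`, and both sides
  -- of the barrier inequality share the factor `σ^(m-1)`.
  set m := (p - 1) / (p - 2) with hm
  have hmm : (m - 1) * (p - 2) = 1 := by
    rw [hm]
    field_simp
    ring
  have hm1 : 0 < m - 1 := by
    rw [hm, div_sub_one hp2.ne']
    exact div_pos (by linarith) hp2
  have hm0 : 0 < m := by linarith
  -- Chosen so that the coefficient `(2m)^(p-1) c₀^(p-1)` coming from gradient and Hessian equals
  -- `D`; `c₀ ≤ 1` keeps the initial profile below `1`.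
  set c₀ := D ^ (1 / (p - 1)) / (2 * m) with hc₀
  have hc₀pos : 0 < c₀ := by positivity
  have hc₀1 : c₀ ≤ 1 := by
    rw [hc₀, div_le_one (by positivity)]
    exact (Real.rpow_le_one hD.le hD1 (by positivity)).trans (by linarith)
  have hc₀D : (2 * m) ^ (p - 1) * c₀ ^ (p - 1) = D := by
    rw [← Real.mul_rpow (by positivity) hc₀pos.le, hc₀, mul_div_cancel₀ _ (by positivity),
      ← Real.rpow_mul hD.le, one_div_mul_cancel hp1.ne', Real.rpow_one]
  refine ⟨a, β, c₀ ^ m * (3 / 4) ^ m, ha, hβ, hβ1, by positivity,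
    mul_le_one₀ (Real.rpow_le_one hc₀pos.le hc₀1 hm0.le) (by positivity)
      (Real.rpow_le_one (by norm_num) (by norm_num) hm0.le), hab, ?_⟩
  intro u R T hT hu hbot hR x hx
  -- The profile has peak `c₀^m (1+t)^(-a)` and is positive exactly in the ball of radius `(1+t)^β`.
  set κ : ℝ → ℝ := fun t => c₀ * (1 + t) ^ (-(a / m)) with hκ
  set ρ : ℝ → ℝ := fun t => c₀ * (1 + t) ^ (-(a / m) - 2 * β) with hρ
  set S : Space n × ℝ → ℝ := fun y => κ y.2 - ρ y.2 * ‖y.1‖ ^ 2 with hS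
  set B : Space n × ℝ → ℝ := fun y => max (S y) 0 ^ m with hB
  have hρκ : ∀ t, 0 ≤ t → κ t = ρ t * ((1 + t) ^ β) ^ 2 := by
    intro t ht
    have h1 : (0 : ℝ) < 1 + t := by linarith
    simp only [hκ, hρ]
    rw [mul_assoc, ← Real.rpow_natCast, ← Real.rpow_mul h1.le, ← Real.rpow_add h1]
    congr 2
    push_cast
    ring
  have hρpos : ∀ t, 0 ≤ t → 0 < ρ t := fun t ht => by
    have h1 : (0 : ℝ) < 1 + t := by linarith
    simp only [hρ]
    positivity
  have hScont : ContinuousOn S (Metric.closedBall (0 : Space n) R ×ˢ Icc 0 T) := by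
    have h1 : ∀ e : ℝ, ContinuousOn (fun y : Space n × ℝ => (1 + y.2) ^ e)
        (Metric.closedBall (0 : Space n) R ×ˢ Icc 0 T) := fun e =>
      ContinuousOn.rpow_const (by fun_prop) fun y hy => Or.inl (by
        have := hy.2.1
        simp only [ne_eq]
        linarith)
    have h2 := h1 (-(a / m))
    have h3 := h1 (-(a / m) - 2 * β)
    simp only [hS, hκ, hρ]
    exact (continuousOn_const.mul h2).sub ((continuousOn_const.mul h3).mul (by fun_prop))
  have hBcont : ContinuousOn B (Metric.closedBall (0 : Space n) R ×ˢ Icc 0 T) :=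
    (hScont.sup continuousOn_const).rpow_const fun y _ => Or.inr hm0.le
  have hcomp := le_of_strict_barrier hu.cont hu.super hBcont ?_ (x, T) ?_
  · refine le_trans ?_ hcomp
    have h1 : (0 : ℝ) < 1 + T := by linarith
    have h2 : c₀ * (3 / 4) * (1 + T) ^ (-(a / m)) ≤ S (x, T) := by
      have h3 : ‖x‖ ^ 2 ≤ ((1 + T) ^ β) ^ 2 / 4 := by
        calc ‖x‖ ^ 2 ≤ ((1 + T) ^ β / 2) ^ 2 := by gcongr
          _ = _ := by ring
      have h4 : ρ T * ‖x‖ ^ 2 ≤ ρ T * (((1 + T) ^ β) ^ 2 / 4) :=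
        mul_le_mul_of_nonneg_left h3 (hρpos T hT).le
      have h5 := hρκ T hT
      have h6 : κ T = c₀ * (1 + T) ^ (-(a / m)) := rfl
      simp only [hS]
      linarith
    have h3 : (c₀ * (3 / 4) * (1 + T) ^ (-(a / m))) ^ m ≤ B (x, T) :=
      Real.rpow_le_rpow (by positivity) (h2.trans (le_max_left _ _)) hm0.le
    refine le_trans (le_of_eq ?_) h3
    rw [Real.mul_rpow (by positivity) (by positivity), Real.mul_rpow (by positivity) (by norm_num),
      ← Real.rpow_mul h1.le]
    congr 2
    field_simp
  · rintro ⟨y, t⟩ ⟨hy, ht⟩ hlt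
    simp only [] at ht hy ⊢
    have ht0 : (0 : ℝ) ≤ t := ht.1
    have h1t : (0 : ℝ) < 1 + t := by linarith
    -- Only points with `u < B` are tested, and there `B > 0` because `u ≥ 0`; the singular edge of
    -- the profile plays no role.
    have hSpos : 0 < S (y, t) := by
      by_contra hcon
      have h1 : B (y, t) = 0 := by
        simp only [hB]
        rw [max_eq_right (not_lt.1 hcon), Real.zero_rpow hm0.ne']
      have h2 := hu.nonneg (y, t) ⟨hy, ht⟩
      linarith
    have hBS : B (y, t) = S (y, t) ^ m := by
      simp only [hB]
      rw [max_eq_left hSpos.le]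
    have hylt : ‖y‖ < (1 + t) ^ β := by
      have h1 := hρκ t ht0
      have h2 : ρ t * ‖y‖ ^ 2 < ρ t * ((1 + t) ^ β) ^ 2 := by
        have h3 : S (y, t) = κ t - ρ t * ‖y‖ ^ 2 := rfl
        linarith
      exact lt_of_pow_lt_pow_left₀ 2 (by positivity) (lt_of_mul_lt_mul_left h2 (hρpos t ht0).le)
    refine ⟨?_, ?_, ?_⟩
    · rw [mem_ball_zero_iff]
      refine hylt.trans_le (le_trans ?_ hR)
      exact Real.rpow_le_rpow h1t.le (by linarith [ht.2]) hβ.le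
    · rcases ht0.eq_or_lt with h | h
      · exfalso
        subst h
        have h1 : S (y, 0) ≤ 1 := by
          have h2 : S (y, 0) = κ 0 - ρ 0 * ‖y‖ ^ 2 := rfl
          have h3 : κ 0 = c₀ := by simp [hκ]
          nlinarith [hρpos 0 le_rfl, sq_nonneg ‖y‖]
        have h2 : B (y, 0) ≤ 1 := by
          rw [hBS]
          exact Real.rpow_le_one hSpos.le h1 hm0.le
        have h3 : ‖y‖ < 1 := by simpa using hylt
        have h4 := hbot y (by simpa using h3.le)
        linarith
      · exact h
    · set σ := S (y, t) with hσ
      have hκd : HasDerivAt κ (c₀ * (-(a / m) * (1 + t) ^ (-(a / m) - 1))) t := by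
        have h1 : HasDerivAt (fun t : ℝ => 1 + t) 1 t := (hasDerivAt_id t).const_add 1
        have h2 := (h1.rpow_const (p := -(a / m)) (Or.inl h1t.ne')).const_mul c₀
        simpa using h2
      have hρd : HasDerivAt ρ
          (c₀ * ((-(a / m) - 2 * β) * (1 + t) ^ (-(a / m) - 2 * β - 1))) t := by
        have h1 : HasDerivAt (fun t : ℝ => 1 + t) 1 t := (hasDerivAt_id t).const_add 1
        have h2 := (h1.rpow_const (p := -(a / m) - 2 * β) (Or.inl h1t.ne')).const_mul c₀
        simpa using h2
      rw [Real.rpow_sub_one h1t.ne'] at hκd hρd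
      have hκ' : c₀ * (-(a / m) * ((1 + t) ^ (-(a / m)) / (1 + t))) = -(a / m) * κ t / (1 + t) := by
        simp only [hκ]; ring
      have hρ' : c₀ * ((-(a / m) - 2 * β) * ((1 + t) ^ (-(a / m) - 2 * β) / (1 + t)))
          = (-(a / m) - 2 * β) * ρ t / (1 + t) := by
        simp only [hρ]; ring
      rw [hκ'] at hκd
      rw [hρ'] at hρd
      have hlo := isLittleO_barenblatt (z := (y, t)) hκd hρd hSpos m
      have hσdef : σ = κ t - ρ t * ‖y‖ ^ 2 := rfl
      simp only [] at hlo
      rw [← hσdef] at hlo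
      set q := √(m * (m - 1) * σ ^ (m - 2)) * (2 * ρ t) with hq
      have hq2 : q ^ 2 = m * (m - 1) * σ ^ (m - 2) * (4 * ρ t ^ 2) := by
        rw [hq, mul_pow, Real.sq_sqrt (by positivity)]
        ring
      have hρt := hρpos t ht0
      refine ⟨m * σ ^ (m - 1) * (-(a / m) * κ t / (1 + t)
        - (-(a / m) - 2 * β) * ρ t / (1 + t) * ‖y‖ ^ 2),
        (-(2 * m * σ ^ (m - 1) * ρ t)) • y, q • y, 2 * m * σ ^ (m - 1) * ρ t, by positivity,
        ?_, ?_⟩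
      · intro ε hε
        have hSev : ∀ᶠ z in 𝓝 (y, t), 0 < κ z.2 - ρ z.2 * ‖z.1‖ ^ 2 := by
          have h1 : ContinuousAt (fun z : Space n × ℝ => κ z.2 - ρ z.2 * ‖z.1‖ ^ 2) (y, t) := by
            have h2 : ContinuousAt (fun z : Space n × ℝ => κ z.2) (y, t) :=
              ContinuousAt.comp (g := κ) (f := Prod.snd) (x := (y, t)) hκd.continuousAt
                continuousAt_snd
            have h3 : ContinuousAt (fun z : Space n × ℝ => ρ z.2) (y, t) :=
              ContinuousAt.comp (g := ρ) (f := Prod.snd) (x := (y, t)) hρd.continuousAt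
                continuousAt_snd
            exact h2.sub (h3.mul (by fun_prop))
          exact h1.eventually_const_lt hSpos
        filter_upwards [hlo.bound hε, hSev] with z hz hzS _
        have hBz : B z = (κ z.2 - ρ z.2 * ‖z.1‖ ^ 2) ^ m := by
          simp only [hB, hS]
          rw [max_eq_left hzS.le]
        rw [Real.norm_eq_abs, Real.norm_of_nonneg (by positivity)] at hz
        have h1 := (abs_le.1 hz).1
        rw [hBz, hBS]
        simp only [inner_smul_left, RCLike.conj_to_real, mul_pow, hq2]
        linarith
      · have hX : ρ t * ‖y‖ ^ 2 = κ t * (‖y‖ / (1 + t) ^ β) ^ 2 := by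
          rw [hρκ t ht0]
          field_simp
        set X := (‖y‖ / (1 + t) ^ β) ^ 2 with hXdef
        have hκpos : 0 < κ t := by rw [hρκ t ht0]; positivity
        have hX0 : 0 ≤ X := by positivity
        have hσX : σ = κ t * (1 - X) := by rw [hσdef, hX]; ring
        have hs : 0 < 1 - X := by
          by_contra hcon
          have : σ ≤ 0 := by rw [hσX]; exact mul_nonpos_of_nonneg_of_nonpos hκpos.le (not_lt.1 hcon)
          linarith
        have hmain := hineq (1 - X) X hs hX0 (by ring)
        have hg : ‖(-(2 * m * σ ^ (m - 1) * ρ t)) • y‖ ^ (p - 2)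
            = (2 * m) ^ (p - 2) * σ * (ρ t * ‖y‖) ^ (p - 2) := by
          rw [norm_smul, norm_neg, Real.norm_of_nonneg (by positivity)]
          rw [show 2 * m * σ ^ (m - 1) * ρ t * ‖y‖ = 2 * m * σ ^ (m - 1) * (ρ t * ‖y‖) by ring,
            Real.mul_rpow (by positivity) (by positivity),
            Real.mul_rpow (by positivity) (by positivity), ← Real.rpow_mul hSpos.le, hmm,
            Real.rpow_one]
        have hw : ‖q • y‖ ^ 2 = m * (m - 1) * σ ^ (m - 2) * (4 * ρ t ^ 2) * ‖y‖ ^ 2 := by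
          rw [norm_smul, mul_pow, Real.norm_eq_abs, sq_abs, hq2]
        -- The relation `a(p-2) + βp = 1` makes the diffusion term decay like `1/(1+t)` relative to
        -- the profile, exactly as the time derivative does.
        have hkey : κ t ^ (p - 1) * (1 + t) ^ (-(β * p)) = c₀ ^ (p - 1) / (1 + t) := by
          simp only [hκ]
          rw [Real.mul_rpow hc₀pos.le (by positivity), ← Real.rpow_mul h1t.le, mul_assoc,
            ← Real.rpow_add h1t, show -(a / m) * (p - 1) + -(β * p) = -1 by
              have : a / m * (p - 1) = a * (p - 2) := by rw [hm]; field_simp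
              linarith, Real.rpow_neg_one]
          rfl
        have hgrad : (ρ t * ‖y‖) ^ (p - 2) * ρ t =
            κ t ^ (p - 1) * (1 + t) ^ (-(β * p)) * X ^ ((p - 2) / 2) := by
          have hb : (0 : ℝ) < (1 + t) ^ β := by positivity
          have h1 : ρ t * ‖y‖ = κ t * (1 + t) ^ (-β) * (‖y‖ / (1 + t) ^ β) := by
            rw [hρκ t ht0, Real.rpow_neg h1t.le]
            field_simp
          have h2 : ρ t = κ t * (1 + t) ^ (-(2 * β)) := by
            rw [hρκ t ht0, ← Real.rpow_natCast, ← Real.rpow_mul h1t.le, mul_assoc,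
              ← Real.rpow_add h1t]
            norm_num
            ring_nf
            simp
          have h3 : X ^ ((p - 2) / 2) = (‖y‖ / (1 + t) ^ β) ^ (p - 2) := by
            rw [hXdef, ← Real.rpow_natCast, ← Real.rpow_mul (by positivity)]
            congr 1
            push_cast
            ring
          rw [h1, h3, Real.mul_rpow (by positivity) (by positivity),
            Real.mul_rpow hκpos.le (by positivity), ← Real.rpow_mul h1t.le, h2,
            show p - 1 = (p - 2) + 1 by ring, Real.rpow_add_one hκpos.ne',
            show -(β * p) = -β * (p - 2) + -(2 * β) by ring, Real.rpow_add h1t]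
          ring
        have hσm : σ ^ (m - 1) = σ ^ (m - 2) * σ := by
          rw [show m - 1 = (m - 2) + 1 by ring, Real.rpow_add_one hSpos.ne']
        have h2m : (2 * m) ^ (p - 2) * (2 * m) = (2 * m) ^ (p - 1) := by
          rw [show p - 1 = (p - 2) + 1 by ring, Real.rpow_add_one (by positivity)]
        have hfin : 0 < σ ^ (m - 1) * κ t / (1 + t) := by positivity
        have := mul_lt_mul_of_pos_left hmain hfin
        rw [hg, hw]
        calc m * σ ^ (m - 1) * (-(a / m) * κ t / (1 + t)
              - (-(a / m) - 2 * β) * ρ t / (1 + t) * ‖y‖ ^ 2)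
            = m * σ ^ (m - 1) * (-(a / m) * κ t / (1 + t)
              - (-(a / m) - 2 * β) * (ρ t * ‖y‖ ^ 2) / (1 + t)) := by ring
          _ = σ ^ (m - 1) * κ t / (1 + t) * (-a * (1 - X) + 2 * m * β * X) := by
              rw [hX]
              field_simp
              ring
          _ < σ ^ (m - 1) * κ t / (1 + t) *
              (D * X ^ ((p - 2) / 2) * (2 * lam * (m - 1) * X - N * (1 - X))) := this
          _ = σ ^ (m - 1) * ((2 * m) ^ (p - 1) * (c₀ ^ (p - 1) / (1 + t)) * X ^ ((p - 2) / 2)) *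
              (2 * lam * (m - 1) * (κ t * X) - N * (κ t * (1 - X))) := by
              rw [← hc₀D]
              ring
          _ = σ ^ (m - 1) * ((2 * m) ^ (p - 1) * ((ρ t * ‖y‖) ^ (p - 2) * ρ t)) *
              (2 * lam * (m - 1) * (ρ t * ‖y‖ ^ 2) - N * σ) := by
              rw [hgrad, hkey, hX, hσX]
              ring
          _ = _ := by
              rw [← h2m, hσm]
              ring
  · refine ⟨?_, hT, le_rfl⟩
    rw [mem_closedBall_zero_iff]
    have : 0 ≤ (1 + T) ^ β := by positivity
    linarith

/-- Spreading of positivity. -/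
lemma exists_spreading {p lam N : ℝ} (hp : 2 < p) (hlam : 0 < lam) (hN : 0 ≤ N) :
    ∃ a β κ₀ : ℝ, 0 < a ∧ 0 < β ∧ β ≤ 1 / 10 ∧ 0 < κ₀ ∧ κ₀ ≤ 1 ∧ a * (p - 2) + β * p = 1 ∧
      ∀ (u : Space n × ℝ → ℝ) (x₀ : Space n) (s t r k R : ℝ), 0 < r → 0 < k → s ≤ t →
        PosSuper p lam N (Metric.closedBall x₀ R ×ˢ Icc s t) u →
        (∀ x ∈ Metric.closedBall x₀ r, k ≤ u (x, s)) →
        r * (1 + (t - s) / (k ^ (2 - p) * r ^ p)) ^ β ≤ R →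
        ∀ x : Space n, ‖x - x₀‖ ≤ r * (1 + (t - s) / (k ^ (2 - p) * r ^ p)) ^ β / 2 →
          κ₀ * k * (1 + (t - s) / (k ^ (2 - p) * r ^ p)) ^ (-a) ≤ u (x, t) := by
  obtain ⟨a, β, κ₀, ha, hβ, hβ1, hκ, hκ1, hab, h⟩ := exists_spreading_unit (n := n) hp hlam hN
  refine ⟨a, β, κ₀, ha, hβ, hβ1, hκ, hκ1, hab, ?_⟩
  intro u x₀ s t r k R hr hk hst hu hbot hR x hx
  set θ := k ^ (2 - p) * r ^ p with hθ
  have hθ0 : 0 < θ := by positivity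
  set T := (t - s) / θ with hT
  have hT0 : 0 ≤ T := div_nonneg (by linarith) hθ0.le
  have hv : PosSuper p lam N (Metric.closedBall 0 (R / r) ×ˢ Icc 0 T)
      (fun y => u (scaleMap x₀ s r θ y) / k) := by
    refine hu.rescale hr hk hθ ?_
    rintro ⟨y, τ⟩ ⟨hy, hτ⟩
    refine ⟨?_, ?_, ?_⟩
    · rw [mem_closedBall_zero_iff, le_div_iff₀ hr] at hy
      rw [mem_closedBall_iff_norm]
      simp only [scaleMap, add_sub_cancel_left, norm_smul, Real.norm_of_nonneg hr.le]
      simp only [] at hy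
      linarith
    · have := mul_nonneg hθ0.le hτ.1
      simp only [scaleMap]
      linarith
    · have := mul_le_mul_of_nonneg_left hτ.2 hθ0.le
      rw [hT, mul_div_cancel₀ _ hθ0.ne'] at this
      simp only [scaleMap]
      linarith
  have h1 := h _ (R / r) T hT0 hv ?_ ?_ (r⁻¹ • (x - x₀)) ?_
  · have h2 : scaleMap x₀ s r θ (r⁻¹ • (x - x₀), T) = (x, t) := by
      simp only [scaleMap, smul_smul, mul_inv_cancel₀ hr.ne', one_smul, hT,
        mul_div_cancel₀ _ hθ0.ne']
      simp
    rw [h2, le_div_iff₀ hk] at h1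
    linarith
  · intro y hy
    rw [le_div_iff₀ hk, one_mul]
    simp only [scaleMap, mul_zero, add_zero]
    refine hbot _ ?_
    rw [mem_closedBall_zero_iff] at hy
    rw [mem_closedBall_iff_norm, add_sub_cancel_left, norm_smul, Real.norm_of_nonneg hr.le]
    exact mul_le_of_le_one_right hr.le hy
  · rw [le_div_iff₀ hr]
    linarith
  · rw [norm_smul, norm_inv, Real.norm_of_nonneg hr.le, inv_mul_le_iff₀ hr]
    linarith

end Barenblatt

end DegenerateParabolic

end

noncomputable section

namespace DegenerateParabolic

open Filter Topology
open scoped RealInnerProductSpace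

/-! ### Convexity inequalities for powers of the norm. -/

section PowerInequalities

lemma rpow_le_tangent {e X Y : ℝ} (he : 0 ≤ e) (he1 : e ≤ 1) (hX : 0 < X) (hY : 0 ≤ Y) :
    Y ^ e ≤ X ^ e + e * X ^ (e - 1) * (Y - X) := by
  have h1 := rpow_one_add_le_one_add_mul_self (s := Y / X - 1)
    (by linarith [div_nonneg hY hX.le]) he he1
  have h2 : Y ^ e = X ^ e * (1 + (Y / X - 1)) ^ e := by
    rw [add_sub_cancel, ← Real.mul_rpow hX.le (by positivity), mul_div_cancel₀ _ hX.ne']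
  rw [h2, Real.rpow_sub_one hX.ne']
  calc X ^ e * (1 + (Y / X - 1)) ^ e ≤ X ^ e * (1 + e * (Y / X - 1)) := by gcongr
    _ = _ := by field_simp

lemma rpow_tangent_le {e X Y : ℝ} (he : 1 ≤ e) (hX : 0 < X) (hY : 0 ≤ Y) :
    X ^ e + e * X ^ (e - 1) * (Y - X) ≤ Y ^ e := by
  have h1 := one_add_mul_self_le_rpow_one_add (s := Y / X - 1)
    (by linarith [div_nonneg hY hX.le]) he
  have h2 : Y ^ e = X ^ e * (1 + (Y / X - 1)) ^ e := by
    rw [add_sub_cancel, ← Real.mul_rpow hX.le (by positivity), mul_div_cancel₀ _ hX.ne']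
  rw [h2, Real.rpow_sub_one hX.ne']
  calc _ = X ^ e * (1 + e * (Y / X - 1)) := by field_simp
    _ ≤ _ := by gcongr

variable {n : ℕ} {q : ℝ}

/-- A paraboloid above `‖x‖ ^ q`, for `q ≤ 2`. -/
lemma norm_rpow_le_paraboloid (hq : 0 ≤ q) (hq2 : q ≤ 2) {σ : ℝ} (hσ : 0 < σ) (x : Space n) :
    ‖x‖ ^ q ≤ (1 - q / 2) * σ ^ q + q / 2 * σ ^ (q - 2) * ‖x‖ ^ 2 := by
  -- As a function of `‖x‖²` the power is concave, and its tangent line is a paraboloid in `x`.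
  have h := rpow_le_tangent (e := q / 2) (X := σ ^ 2) (Y := ‖x‖ ^ 2) (by linarith) (by linarith)
    (by positivity) (by positivity)
  have e1 : ∀ s : ℝ, 0 ≤ s → (s ^ 2) ^ (q / 2) = s ^ q := fun s hs => by
    rw [← Real.rpow_natCast, ← Real.rpow_mul hs]
    congr 1
    push_cast
    ring
  have e2 : (σ ^ 2) ^ (q / 2 - 1) = σ ^ (q - 2) := by
    rw [← Real.rpow_natCast, ← Real.rpow_mul hσ.le]
    congr 1
    push_cast
    ring
  have e3 : σ ^ (q - 2) * σ ^ 2 = σ ^ q := by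
    rw [← Real.rpow_natCast, ← Real.rpow_add hσ]
    norm_num
  rw [e1 _ (norm_nonneg _), e1 _ hσ.le, e2] at h
  linear_combination h - q / 2 * e3

/-- Convexity of `‖x‖ ^ q`. -/
lemma norm_rpow_convex (hq : 1 < q) (e h : Space n) :
    ‖e‖ ^ q + q * ‖e‖ ^ (q - 2) * ⟪e, h⟫ ≤ ‖e + h‖ ^ q := by
  rcases eq_or_ne e 0 with rfl | he
  · simp only [norm_zero, inner_zero_left, mul_zero, add_zero, zero_add]
    rw [Real.zero_rpow (by linarith)]
    positivity
  · have he0 : 0 < ‖e‖ := norm_pos_iff.2 he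
    have h1 := rpow_tangent_le hq.le he0 (norm_nonneg (e + h))
    refine le_trans ?_ h1
    have h2 : ⟪e, h⟫ ≤ ‖e‖ * (‖e + h‖ - ‖e‖) := by
      have h3 := real_inner_le_norm e (e + h)
      rw [inner_add_right, real_inner_self_eq_norm_sq] at h3
      nlinarith
    have h4 : ‖e‖ ^ (q - 1) = ‖e‖ ^ (q - 2) * ‖e‖ := by
      rw [show q - 1 = q - 2 + 1 by ring, Real.rpow_add_one he0.ne']
    rw [h4]
    have h5 := mul_le_mul_of_nonneg_left h2
      (by positivity : 0 ≤ q * ‖e‖ ^ (q - 2))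
    linarith

/-- Strong monotonicity of the truncated gradient map `e ↦ max ‖e‖ τ ^ (q - 2) • e`. -/
lemma truncGrad_lower (hq : 1 < q) (hq2 : q < 2) {τ R : ℝ} (hτ : 0 < τ) {e₁ e₂ : Space n}
    (h12 : ‖e₁‖ ≤ ‖e₂‖) (h2 : ‖e₂‖ = R) (hτR : τ ≤ R) :
    (q - 1) * R ^ (q - 2) * ‖e₁ - e₂‖ ≤
      ‖max ‖e₁‖ τ ^ (q - 2) • e₁ - max ‖e₂‖ τ ^ (q - 2) • e₂‖ := by
  have hR : 0 < R := hτ.trans_le hτR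
  set α := ‖e₁‖ with hα
  rw [h2, max_eq_left hτR]
  have hα0 : 0 ≤ α := norm_nonneg _
  have hαR : α ≤ R := h2 ▸ h12
  set w₁ := max α τ ^ (q - 2) with hw₁
  set w₂ := R ^ (q - 2) with hw₂
  have hw₂0 : 0 < w₂ := by positivity
  have hσ : 0 < max α τ := lt_max_of_lt_right hτ
  have hw12 : w₂ ≤ w₁ := Real.rpow_le_rpow_of_nonpos hσ (max_le hαR hτR) (by linarith)
  have hRq : R ^ (q - 1) = w₂ * R := by
    rw [hw₂, show q - 1 = q - 2 + 1 by ring, Real.rpow_add_one hR.ne']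
  have hconc : ∀ s : ℝ, 0 ≤ s → s ^ (q - 1) ≤ w₂ * ((2 - q) * R + (q - 1) * s) := by
    intro s hs
    have h := rpow_le_tangent (e := q - 1) (by linarith) (by linarith) hR hs
    rw [hRq, show q - 1 - 1 = q - 2 by ring, ← hw₂] at h
    linarith
  -- The truncated radial profile lies below the tangent of `s^(q-1)` at `R`. This controls the
  -- difference `w₁ - w₂` in the inner product below, where its term may be negative.
  have hj : w₁ * α ≤ w₂ * ((2 - q) * R + (q - 1) * α) := by
    rcases le_total τ α with h | h
    · have hα' : 0 < α := hτ.trans_le h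
      have : w₁ * α = α ^ (q - 1) := by
        rw [hw₁, max_eq_left h, show q - 1 = q - 2 + 1 by ring, Real.rpow_add_one hα'.ne']
      rw [this]
      exact hconc α hα0
    · have h3 : w₁ * τ ≤ w₂ * ((2 - q) * R + (q - 1) * τ) := by
        have : w₁ * τ = τ ^ (q - 1) := by
          rw [hw₁, max_eq_right h, show q - 1 = q - 2 + 1 by ring, Real.rpow_add_one hτ.ne']
        rw [this]
        exact hconc τ hτ.le
      have h4 : w₁ * α * τ ≤ w₂ * ((2 - q) * R + (q - 1) * α) * τ := by
        have h5 := mul_le_mul_of_nonneg_left h3 hα0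
        have h6 : 0 ≤ w₂ * ((2 - q) * R) * (τ - α) := by
          have := sub_nonneg.2 h
          have : 0 ≤ 2 - q := by linarith
          positivity
        nlinarith
      exact le_of_mul_le_mul_right h4 hτ
  have hD : R - α ≤ ‖e₁ - e₂‖ := by
    rw [← h2, norm_sub_rev]
    exact norm_sub_norm_le _ _
  have hin : (q - 1) * w₂ * ‖e₁ - e₂‖ ^ 2 ≤ ⟪w₁ • e₁ - w₂ • e₂, e₁ - e₂⟫ := by
    have h3 : ⟪w₁ • e₁ - w₂ • e₂, e₁ - e₂⟫ =
        w₂ * ‖e₁ - e₂‖ ^ 2 + (w₁ - w₂) * ⟪e₁, e₁ - e₂⟫ := by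
      rw [← real_inner_self_eq_norm_sq, ← real_inner_smul_left,
        ← real_inner_smul_left, ← inner_add_left]
      congr 1
      module
    have h4 : -(α * (R - α)) ≤ ⟪e₁, e₁ - e₂⟫ := by
      rw [inner_sub_right, real_inner_self_eq_norm_sq, ← hα]
      have := real_inner_le_norm e₁ e₂
      rw [h2, ← hα] at this
      linarith
    have h5 := mul_le_mul_of_nonneg_left h4 (sub_nonneg.2 hw12)
    have h6 : (w₁ - w₂) * α ≤ (2 - q) * w₂ * (R - α) := by linarith
    have h7 := mul_le_mul_of_nonneg_right h6 (sub_nonneg.2 hαR)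
    have h8 : (R - α) * (R - α) ≤ ‖e₁ - e₂‖ ^ 2 := by
      rw [← sq]
      exact pow_le_pow_left₀ (sub_nonneg.2 hαR) hD 2
    have h9 := mul_le_mul_of_nonneg_left h8 (by
      have : 0 ≤ 2 - q := by linarith
      positivity : 0 ≤ (2 - q) * w₂)
    rw [h3]
    nlinarith
  rcases (norm_nonneg (e₁ - e₂)).eq_or_lt with h | h
  · rw [← h, mul_zero]
    positivity
  · refine le_of_mul_le_mul_right ?_ h
    calc _ = (q - 1) * w₂ * ‖e₁ - e₂‖ ^ 2 := by ring
      _ ≤ _ := hin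
      _ ≤ _ := real_inner_le_norm _ _

/-- Lipschitz bound for the truncated gradient map. -/
lemma truncGrad_upper (hq : 1 < q) (hq2 : q < 2) {τ : ℝ} (hτ : 0 < τ) (e₁ e₂ : Space n) :
    ‖max ‖e₁‖ τ ^ (q - 2) • e₁ - max ‖e₂‖ τ ^ (q - 2) • e₂‖ ≤ 2 * τ ^ (q - 2) * ‖e₁ - e₂‖ := by
  wlog h12 : ‖e₁‖ ≤ ‖e₂‖ generalizing e₁ e₂
  · rw [norm_sub_rev, norm_sub_rev e₁]
    exact this e₂ e₁ (not_le.1 h12).le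
  set σ₁ := max ‖e₁‖ τ with hσ₁
  set σ₂ := max ‖e₂‖ τ with hσ₂
  have hs1 : 0 < σ₁ := lt_max_of_lt_right hτ
  have hs2 : 0 < σ₂ := lt_max_of_lt_right hτ
  have hs12 : σ₁ ≤ σ₂ := max_le_max_right _ h12
  set w₁ := σ₁ ^ (q - 2) with hw₁
  set w₂ := σ₂ ^ (q - 2) with hw₂
  have hw12 : w₂ ≤ w₁ := Real.rpow_le_rpow_of_nonpos hs1 hs12 (by linarith)
  have hw1τ : w₁ ≤ τ ^ (q - 2) :=
    Real.rpow_le_rpow_of_nonpos hτ (le_max_right _ _) (by linarith)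
  have hw10 : 0 < w₁ := by positivity
  have hD : ‖e₂‖ - ‖e₁‖ ≤ ‖e₁ - e₂‖ := by
    rw [norm_sub_rev]
    exact norm_sub_norm_le _ _
  have hj : w₁ * ‖e₁‖ ≤ w₂ * ‖e₂‖ := by
    have h1 : σ₁ ^ (q - 1) ≤ σ₂ ^ (q - 1) := Real.rpow_le_rpow hs1.le hs12 (by linarith)
    rw [show q - 1 = q - 2 + 1 by ring, Real.rpow_add_one hs1.ne', Real.rpow_add_one hs2.ne'] at h1
    have hw20 : 0 < w₂ := by positivity
    rcases le_total τ ‖e₂‖ with h | h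
    · have e2 : σ₂ = ‖e₂‖ := max_eq_left h
      calc w₁ * ‖e₁‖ ≤ w₁ * σ₁ := by gcongr; exact le_max_left _ _
        _ ≤ w₂ * σ₂ := h1
        _ = _ := by rw [e2]
    · have e2 : σ₂ = τ := max_eq_right h
      have e1 : σ₁ = τ := max_eq_right (h12.trans h)
      rw [hw₁, hw₂, e1, e2]
      gcongr
  have hdec : w₁ • e₁ - w₂ • e₂ = w₁ • (e₁ - e₂) + (w₁ - w₂) • e₂ := by module
  rw [hdec]
  calc _ ≤ ‖w₁ • (e₁ - e₂)‖ + ‖(w₁ - w₂) • e₂‖ := norm_add_le _ _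
    _ = w₁ * ‖e₁ - e₂‖ + (w₁ - w₂) * ‖e₂‖ := by
        rw [norm_smul, norm_smul, Real.norm_of_nonneg hw10.le,
          Real.norm_of_nonneg (sub_nonneg.2 hw12)]
    _ ≤ w₁ * ‖e₁ - e₂‖ + w₁ * ‖e₁ - e₂‖ := by
        have := mul_le_mul_of_nonneg_left hD hw10.le
        linarith
    _ = 2 * w₁ * ‖e₁ - e₂‖ := by ring
    _ ≤ _ := by gcongr

end PowerInequalities

/-! ### Slow erosion of cusps. -/

section Erosion

variable {n : ℕ} {p lam N : ℝ}

/-- A barrier cusp of the critical power erodes at bounded speed. -/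
lemma exists_erosion (hp : 2 < p) (hN : 0 ≤ N) :
    ∃ C > 0, ∀ u : Space n × ℝ → ℝ,
      PosSuper p lam N (Metric.closedBall 0 1 ×ˢ Icc 0 2) u →
      ∀ (y : Space n) (s t₁ t₂ : ℝ), ‖y‖ ≤ 1 / 8 → s ≤ -1 → 0 ≤ t₁ → t₁ ≤ t₂ → t₂ ≤ 2 →
        (∀ x ∈ Metric.closedBall (0 : Space n) 1,
          s + 3 * t₁ - 8 * ‖x - y‖ ^ (p / (p - 1)) ≤ u (x, t₁)) →
        ∀ x ∈ Metric.closedBall (0 : Space n) 1,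
          s + 3 * t₁ - 8 * ‖x - y‖ ^ (p / (p - 1)) - C * (t₂ - t₁) ≤ u (x, t₂) := by
  -- For this exponent the product of the Hessian of `‖x‖^q` with the power `p - 2` of its gradient
  -- is homogeneous of degree zero, hence bounded up to the vertex.
  set q := p / (p - 1) with hqdef
  have hp1 : 0 < p - 1 := by linarith
  have hq1 : 1 < q := by rw [hqdef, lt_div_iff₀ hp1]; linarith
  have hq2 : q < 2 := by rw [hqdef, div_lt_iff₀ hp1]; linarith
  have hqp : q * (p - 1) = p := by rw [hqdef]; field_simp
  refine ⟨N * (8 * q) ^ (p - 1) + 1, by positivity, ?_⟩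
  intro u hu y s t₁ t₂ hy hs ht1 ht12 ht2 hinit x hx
  set C := N * (8 * q) ^ (p - 1) + 1 with hC
  have hsub : Metric.closedBall (0 : Space n) 1 ×ˢ Icc t₁ t₂ ⊆
      Metric.closedBall (0 : Space n) 1 ×ˢ Icc 0 2 :=
    prod_mono le_rfl (Icc_subset_Icc ht1 ht2)
  have hu' := hu.mono hsub
  have key : ∀ ε > 0, s + 3 * t₁ - 8 * (‖x - y‖ ^ 2 + ε) ^ (q / 2) - C * (t₂ - t₁) ≤ u (x, t₂) := by
    intro ε hε
    set B : Space n × ℝ → ℝ :=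
      fun z => s + 3 * t₁ - 8 * (‖z.1 - y‖ ^ 2 + ε) ^ (q / 2) - C * (z.2 - t₁) with hB
    have hBc : Continuous B := by
      have : Continuous fun z : Space n × ℝ => (‖z.1 - y‖ ^ 2 + ε) ^ (q / 2) :=
        Continuous.rpow_const (by fun_prop) fun z => Or.inl (by positivity)
      fun_prop
    have hge : ∀ w : Space n, ‖w‖ ^ q ≤ (‖w‖ ^ 2 + ε) ^ (q / 2) := by
      intro w
      have : ‖w‖ ^ q = (‖w‖ ^ 2) ^ (q / 2) := by
        rw [← Real.rpow_natCast, ← Real.rpow_mul (norm_nonneg _)]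
        congr 1
        push_cast
        ring
      rw [this]
      exact Real.rpow_le_rpow (by positivity) (by linarith) (by linarith)
    refine le_of_strict_barrier hu'.cont hu'.super hBc.continuousOn ?_ (x, t₂)
      ⟨hx, ht12, le_rfl⟩
    rintro ⟨x', t⟩ ⟨hx', ht⟩ hlt
    simp only [] at hx' ht ⊢
    have hCt : 0 ≤ C * (t - t₁) := mul_nonneg (by positivity) (by linarith [ht.1])
    refine ⟨?_, ?_, ?_⟩
    · rw [mem_closedBall_zero_iff] at hx'
      rw [mem_ball_zero_iff]
      refine lt_of_le_of_ne hx' fun h1 => ?_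
      -- The opening `8` makes the cusp negative on the lateral boundary: there `8‖x' - y‖^q ≥ 6`,
      -- while `s + 3t₁ ≤ 5`.
      have h2 : 7 / 8 ≤ ‖x' - y‖ := by
        have := norm_sub_norm_le x' y
        linarith
      have h3 : (3 / 4 : ℝ) ≤ ‖x' - y‖ ^ q := by
        calc (3 / 4 : ℝ) ≤ (7 / 8 : ℝ) ^ (2 : ℝ) := by norm_num
          _ ≤ (7 / 8 : ℝ) ^ q :=
            Real.rpow_le_rpow_of_exponent_ge (by norm_num) (by norm_num) hq2.le
          _ ≤ _ := Real.rpow_le_rpow (by norm_num) h2 (by linarith)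
      have h4 := hge (x' - y)
      have h5 := hu'.nonneg (x', t) ⟨by simpa using hx', ht⟩
      simp only [hB] at hlt
      linarith
    · refine lt_of_le_of_ne ht.1 fun h1 => ?_
      subst h1
      have h2 := hinit x' hx'
      have h4 := hge (x' - y)
      simp only [hB] at hlt
      linarith
    · set X := ‖x' - y‖ ^ 2 + ε with hX
      have hX0 : 0 < X := by positivity
      -- The tangent inequality gives a paraboloid below the smoothed cusp, so no rank-one part is
      -- needed.
      refine ⟨-C, (-(8 * q * X ^ (q / 2 - 1))) • (x' - y), 0, 8 * q * X ^ (q / 2 - 1),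
        by positivity, ?_, ?_⟩
      · intro η hη
        refine Eventually.of_forall fun z _ => ?_
        have h1 := rpow_le_tangent (e := q / 2) (X := X) (Y := ‖z.1 - y‖ ^ 2 + ε) (by linarith)
          (by linarith) hX0 (by positivity)
        have h2 : ‖z.1 - y‖ ^ 2 + ε - X = 2 * ⟪x' - y, z.1 - x'⟫ + ‖z.1 - x'‖ ^ 2 := by
          have : z.1 - y = (x' - y) + (z.1 - x') := by abel
          rw [this, norm_add_sq_real, hX]
          ring
        rw [h2] at h1
        have h3 : 0 ≤ η * (‖z.1 - x'‖ ^ 2 + |z.2 - t|) := by positivity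
        simp only [hB, real_inner_smul_left, inner_zero_left]
        rw [← hX]
        linarith
      · rw [norm_smul, norm_neg, Real.norm_of_nonneg (by positivity), norm_zero]
        have h1 : (8 * q * X ^ (q / 2 - 1) * ‖x' - y‖) ^ (p - 2) * (8 * q * X ^ (q / 2 - 1)) ≤
            (8 * q) ^ (p - 1) := by
          have hle : ‖x' - y‖ ≤ X ^ (1 / 2 : ℝ) := by
            rw [← Real.sqrt_eq_rpow]
            exact Real.le_sqrt_of_sq_le (by linarith)
          have h2 : 8 * q * X ^ (q / 2 - 1) * ‖x' - y‖ ≤ 8 * q * X ^ (q / 2 - 1 / 2) := by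
            calc 8 * q * X ^ (q / 2 - 1) * ‖x' - y‖ ≤ 8 * q * X ^ (q / 2 - 1) * X ^ (1 / 2 : ℝ) := by
                  gcongr
              _ = 8 * q * (X ^ (q / 2 - 1) * X ^ (1 / 2 : ℝ)) := by ring
              _ = _ := by
                  rw [← Real.rpow_add hX0]
                  congr 2
                  ring
          calc _ ≤ (8 * q * X ^ (q / 2 - 1 / 2)) ^ (p - 2) * (8 * q * X ^ (q / 2 - 1)) := by
                gcongr
            _ = (8 * q) ^ (p - 2) * (8 * q) * (X ^ ((q / 2 - 1 / 2) * (p - 2)) *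
                X ^ (q / 2 - 1)) := by
                rw [Real.mul_rpow (by positivity) (by positivity), ← Real.rpow_mul hX0.le]
                ring
            _ = (8 * q) ^ (p - 1) := by
                rw [← Real.rpow_add hX0, ← Real.rpow_add_one (by positivity),
                  show (q / 2 - 1 / 2) * (p - 2) + (q / 2 - 1) = 0 by linarith,
                  show p - 2 + 1 = p - 1 by ring]
                simp
        have h2 := mul_le_mul_of_nonneg_left h1 hN
        rw [hC]
        nlinarith
  have hlim : Tendsto (fun ε : ℝ => s + 3 * t₁ - 8 * (‖x - y‖ ^ 2 + ε) ^ (q / 2) - C * (t₂ - t₁))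
      (𝓝[>] 0) (𝓝 (s + 3 * t₁ - 8 * (‖x - y‖ ^ 2 + 0) ^ (q / 2) - C * (t₂ - t₁))) := by
    refine Tendsto.mono_left (Continuous.tendsto ?_ 0) nhdsWithin_le_nhds
    have : Continuous fun ε : ℝ => (‖x - y‖ ^ 2 + ε) ^ (q / 2) :=
      Continuous.rpow_const (by fun_prop) fun z => Or.inr (by linarith)
    fun_prop
  have h1 := le_of_tendsto hlim (by
    filter_upwards [self_mem_nhdsWithin] with ε hε
    exact key ε hε)
  have h2 : (‖x - y‖ ^ 2 + 0) ^ (q / 2) = ‖x - y‖ ^ q := by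
    rw [add_zero, ← Real.rpow_natCast, ← Real.rpow_mul (norm_nonneg _)]
    congr 1
    push_cast
    ring
  rwa [h2] at h1

end Erosion

/-! ### Supersolutions above a convex kink. -/

section Kink

variable {n : ℕ} {p lam N : ℝ}

/-- A supersolution lying above a convex kink formed by two planes and nearly touching it has a
kink of bounded strength. -/
lemma kink_bound (hp : 2 < p) {u : Space n × ℝ → ℝ} {x₀ : Space n}
    {t ρ h A b c₁ c₂ η γ : ℝ} {g₁ g₂ : Space n} (hρ : 0 < ρ) (hh : 0 < h) (hA : 0 < A) (hb : 0 < b)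
    (hu : ContinuousOn u (Metric.closedBall x₀ ρ ×ˢ Icc (t - h) t))
    (hs : ∀ z ∈ Metric.closedBall x₀ ρ ×ˢ Icc (t - h) t, SuperAt p lam N u z)
    (h₁ : ∀ x ∈ Metric.closedBall x₀ ρ, ∀ t' ∈ Icc (t - h) t,
      c₁ + ⟪g₁, x - x₀⟫ - A / 2 * ‖x - x₀‖ ^ 2 + b * (t' - t) ≤ u (x, t'))
    (h₂ : ∀ x ∈ Metric.closedBall x₀ ρ, ∀ t' ∈ Icc (t - h) t,
      c₂ + ⟪g₂, x - x₀⟫ - A / 2 * ‖x - x₀‖ ^ 2 + b * (t' - t) ≤ u (x, t'))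
    (hη₁ : u (x₀, t) ≤ c₁ + η) (hη₂ : u (x₀, t) ≤ c₂ + η)
    (hδ : 0 < ‖g₁ - g₂‖) (hcc : |c₁ - c₂| ≤ ‖g₁ - g₂‖ * ρ) (hg₁ : ‖g₁‖ ≤ γ) (hg₂ : ‖g₂‖ = γ)
    (hηA : η < A / 2 * ρ ^ 2) (hηb : η < b * h) (hAγ : 2 * A * ρ ≤ γ / 8) :
    (γ / 8) ^ (p - 2) * (lam * (‖g₁ - g₂‖ / (16 * ρ)) - N * (2 * A)) ≤ 2 * b := by
  set δ := ‖g₁ - g₂‖ with hδdef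
  set d := g₁ - g₂ with hd
  set ℓ := 2 * δ * ρ with hℓ
  have hℓ0 : 0 < ℓ := by positivity
  have hγ0 : 0 < γ := by
    have h1 : 0 < 2 * A * ρ := by positivity
    linarith
  set D : Space n → ℝ := fun x => c₁ - c₂ + ⟪d, x - x₀⟫ with hD
  -- A weighted mean of the two planes with a convex quadratic term across the kink; it stays below
  -- their maximum because `|D| ≤ ℓ`. The uneven weights keep its gradient away from zero: with
  -- `‖g₂‖ = γ` and `‖g₁‖ ≤ γ`, at least `γ/8` remains.
  set Θ : Space n → ℝ := fun x => (c₁ + 3 * c₂) / 4 + ⟪(1 / 4 : ℝ) • g₁ + (3 / 4 : ℝ) • g₂, x - x₀⟫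
    + 1 / (16 * ℓ) * D x ^ 2 - A * ‖x - x₀‖ ^ 2 with hΘ
  have hDle : ∀ x ∈ Metric.closedBall x₀ ρ, |D x| ≤ ℓ := by
    intro x hx
    rw [mem_closedBall_iff_norm] at hx
    have h3 : |⟪d, x - x₀⟫| ≤ δ * ρ :=
      (abs_real_inner_le_norm _ _).trans (by gcongr)
    calc |D x| ≤ |c₁ - c₂| + |⟪d, x - x₀⟫| := abs_add_le _ _
      _ ≤ ℓ := by rw [hℓ]; linarith
  have hΘle : ∀ x ∈ Metric.closedBall x₀ ρ, ∀ t' ∈ Icc (t - h) t,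
      Θ x + 2 * b * (t' - t) + (A / 2 * ‖x - x₀‖ ^ 2 + b * (t - t')) ≤ u (x, t') := by
    intro x hx t' ht'
    have e1 := h₁ x hx t' ht'
    have e2 := h₂ x hx t' ht'
    have e3 : 1 / (16 * ℓ) * D x ^ 2 ≤ |D x| / 16 := by
      have h4 := hDle x hx
      rw [← sq_abs, one_div_mul_eq_div, div_le_div_iff₀ (by positivity) (by norm_num)]
      nlinarith [abs_nonneg (D x)]
    have e4 : ⟪(1 / 4 : ℝ) • g₁ + (3 / 4 : ℝ) • g₂, x - x₀⟫
        = 1 / 4 * ⟪g₁, x - x₀⟫ + 3 / 4 * ⟪g₂, x - x₀⟫ := by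
      rw [inner_add_left, real_inner_smul_left, real_inner_smul_left]
    have e5 : D x = (c₁ + ⟪g₁, x - x₀⟫) - (c₂ + ⟪g₂, x - x₀⟫) := by
      simp only [hD, hd, inner_sub_left]
      ring
    simp only [hΘ, e4]
    rcases abs_cases (D x) with ⟨h5, h6⟩ | ⟨h5, h6⟩
    · rw [h5] at e3
      linarith
    · rw [h5] at e3
      linarith
  have hK : IsCompact (Metric.closedBall x₀ ρ ×ˢ Icc (t - h) t) :=
    (isCompact_closedBall x₀ ρ).prod isCompact_Icc
  have hx₀mem : ((x₀, t) : Space n × ℝ) ∈ Metric.closedBall x₀ ρ ×ˢ Icc (t - h) t :=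
    ⟨Metric.mem_closedBall_self hρ.le, by linarith, le_rfl⟩
  have hcT : Continuous fun z : Space n × ℝ => Θ z.1 + 2 * b * (z.2 - t) := by
    simp only [hΘ, hD]
    fun_prop
  obtain ⟨⟨x', t'⟩, hz, hmin⟩ := hK.exists_isMinOn ⟨_, hx₀mem⟩ (hu.sub hcT.continuousOn)
  have hm : ∀ y ∈ Metric.closedBall x₀ ρ ×ˢ Icc (t - h) t,
      u (x', t') - (Θ x' + 2 * b * (t' - t)) ≤ u y - (Θ y.1 + 2 * b * (y.2 - t)) :=
    fun y hy => hmin hy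
  have hm0 := hm _ hx₀mem
  have hΘ0 : (c₁ + 3 * c₂) / 4 ≤ Θ x₀ := by
    have : 0 ≤ 1 / (16 * ℓ) * D x₀ ^ 2 := by positivity
    simp only [hΘ, sub_self, inner_zero_right, norm_zero]
    linarith
  -- `Θ` has twice the downward curvature and twice the time slope of the given bounds. This surplus
  -- is at most `η` at the minimum, which therefore avoids the lateral and initial boundary.
  have hgap : A / 2 * ‖x' - x₀‖ ^ 2 + b * (t - t') ≤ η := by
    have h3 := hΘle x' hz.1 t' hz.2
    simp only [sub_self, mul_zero, add_zero] at hm0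
    linarith
  have ht't : t' ≤ t := hz.2.2
  have hx'lt : ‖x' - x₀‖ < ρ := by
    by_contra hcon
    have h3 : ρ ^ 2 ≤ ‖x' - x₀‖ ^ 2 := pow_le_pow_left₀ hρ.le (not_lt.1 hcon) 2
    have h4 : 0 ≤ b * (t - t') := mul_nonneg hb.le (by linarith)
    have h5 : A / 2 * ρ ^ 2 ≤ A / 2 * ‖x' - x₀‖ ^ 2 := by gcongr
    linarith
  have ht'lt : t - h < t' := by
    by_contra hcon
    have h3 : b * h ≤ b * (t - t') := by
      gcongr
      linarith
    have h4 : 0 ≤ A / 2 * ‖x' - x₀‖ ^ 2 := by positivity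
    linarith
  set g := (1 / 4 : ℝ) • g₁ + (3 / 4 : ℝ) • g₂ + (1 / (8 * ℓ) * D x') • d
    - (2 * A) • (x' - x₀) with hg
  have key := hs _ hz (2 * b) g (√(1 / (8 * ℓ)) • d) (2 * A) (by positivity) ?_
  · have hw : ‖√(1 / (8 * ℓ)) • d‖ ^ 2 = δ / (16 * ρ) := by
      rw [norm_smul, mul_pow, Real.norm_eq_abs, sq_abs, Real.sq_sqrt (by positivity), ← hδdef, hℓ]
      field_simp
      norm_num
    rw [hw] at key
    rcases le_or_gt 0 (lam * (δ / (16 * ρ)) - N * (2 * A)) with hpos | hneg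
    · refine le_trans ?_ key
      refine mul_le_mul_of_nonneg_right ?_ hpos
      refine Real.rpow_le_rpow (by positivity) ?_ (by linarith)
      have n1 : ‖(1 / 4 : ℝ) • g₁‖ ≤ γ / 4 := by
        rw [norm_smul, Real.norm_of_nonneg (by norm_num)]
        linarith
      have n2 : ‖(3 / 4 : ℝ) • g₂‖ = 3 / 4 * γ := by
        rw [norm_smul, Real.norm_of_nonneg (by norm_num), hg₂]
      have n3 : ‖(1 / (8 * ℓ) * D x') • d‖ ≤ γ / 4 := by
        rw [norm_smul, Real.norm_eq_abs, abs_mul, abs_of_pos (by positivity : 0 < 1 / (8 * ℓ))]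
        have h3 := hDle x' hz.1
        have h4 : δ ≤ 2 * γ := by
          have := norm_sub_le g₁ g₂
          linarith
        calc 1 / (8 * ℓ) * |D x'| * ‖d‖ ≤ 1 / (8 * ℓ) * ℓ * (2 * γ) := by gcongr
          _ = γ / 4 := by field_simp; norm_num
      have n4 : ‖(2 * A) • (x' - x₀)‖ ≤ γ / 8 := by
        rw [norm_smul, Real.norm_of_nonneg (by positivity)]
        refine le_trans ?_ hAγ
        gcongr
      have h5 : (3 / 4 : ℝ) • g₂ = g - (1 / 4 : ℝ) • g₁ - (1 / (8 * ℓ) * D x') • d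
          + (2 * A) • (x' - x₀) := by
        rw [hg]
        abel
      have h6 : ‖(3 / 4 : ℝ) • g₂‖ ≤ ‖g‖ + ‖(1 / 4 : ℝ) • g₁‖ + ‖(1 / (8 * ℓ) * D x') • d‖
          + ‖(2 * A) • (x' - x₀)‖ := by
        rw [h5]
        have e1 := norm_sub_le g ((1 / 4 : ℝ) • g₁)
        have e2 := norm_sub_le (g - (1 / 4 : ℝ) • g₁) ((1 / (8 * ℓ) * D x') • d)
        have e3 := norm_add_le (g - (1 / 4 : ℝ) • g₁ - (1 / (8 * ℓ) * D x') • d)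
          ((2 * A) • (x' - x₀))
        linarith
      linarith
    · exact (mul_nonpos_of_nonneg_of_nonpos (by positivity) hneg.le).trans (by positivity)
  · have hnb : Metric.ball x₀ ρ ×ˢ Ioi (t - h) ∈ 𝓝 (x', t') :=
      (Metric.isOpen_ball.prod isOpen_Ioi).mem_nhds ⟨by rwa [mem_ball_iff_norm], ht'lt⟩
    filter_upwards [hnb] with y hy hyt
    have h3 := hm y ⟨Metric.ball_subset_closedBall hy.1, le_of_lt hy.2, hyt.trans ht't⟩
    refine le_trans (le_of_eq ?_) (sub_nonneg.1 (by linarith :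
      0 ≤ u y - (u (x', t') + (Θ y.1 - Θ x') + 2 * b * (y.2 - t'))))
    have d1 : D y.1 = D x' + ⟪d, y.1 - x'⟫ := by
      simp only [hD]
      rw [show y.1 - x₀ = (x' - x₀) + (y.1 - x') by abel, inner_add_right]
      ring
    have d2 : ‖y.1 - x₀‖ ^ 2 = ‖x' - x₀‖ ^ 2 + 2 * ⟪x' - x₀, y.1 - x'⟫ + ‖y.1 - x'‖ ^ 2 := by
      rw [← norm_add_sq_real]
      congr 2
      abel
    have d3 : ⟪(1 / 4 : ℝ) • g₁ + (3 / 4 : ℝ) • g₂, y.1 - x₀⟫ =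
        ⟪(1 / 4 : ℝ) • g₁ + (3 / 4 : ℝ) • g₂, x' - x₀⟫ +
        ⟪(1 / 4 : ℝ) • g₁ + (3 / 4 : ℝ) • g₂, y.1 - x'⟫ := by
      rw [← inner_add_right]
      congr 1
      abel
    have d4 : ⟪g, y.1 - x'⟫ = ⟪(1 / 4 : ℝ) • g₁ + (3 / 4 : ℝ) • g₂, y.1 - x'⟫
        + 1 / (8 * ℓ) * D x' * ⟪d, y.1 - x'⟫ - 2 * A * ⟪x' - x₀, y.1 - x'⟫ := by
      rw [hg, inner_sub_left, inner_add_left, real_inner_smul_left, real_inner_smul_left]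
    have d5 : ⟪√(1 / (8 * ℓ)) • d, y.1 - x'⟫ ^ 2 = 1 / (8 * ℓ) * ⟪d, y.1 - x'⟫ ^ 2 := by
      rw [real_inner_smul_left, mul_pow, Real.sq_sqrt (by positivity)]
    rw [d4, d5]
    simp only [hΘ]
    rw [d1, d2, d3]
    field_simp
    ring

end Kink

end DegenerateParabolic

end

noncomputable section

namespace DegenerateParabolic

open Filter Topology
open scoped RealInnerProductSpace

/-! ### Lipschitz dependence of vertices on contact points. -/

section Contact

variable {n : ℕ} {p lam N : ℝ}

/-- First `ν₀` is chosen so that the kink term beats the Hessian error, then `m₀` small in terms of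
`ν₀`, then `κ`. The factors `Z = κ^(2-q)` in `ν` and `Z²` in `c₀` compensate the large factor
`κ^(q-2)` created by truncating paraboloids at relative radius `κ`. The number `6` is twice the time
slope `3` of the cusps. -/
lemma kink_constants {q : ℝ} (hq1 : 1 < q) (hq2 : q < 2) (hp : 2 < p) (hlam : 0 < lam)
    (hN : 0 ≤ N) :
    ∃ κ ν c₀ : ℝ, 0 < κ ∧ κ ≤ 1 / 2 ∧ 0 < ν ∧ ν ≤ 1 / 20 ∧ 0 < c₀ ∧ c₀ ≤ 1 ∧
      8 * κ ^ q + 5 * q * κ ^ (q - 2) * c₀ ≤ q * (q - 1) * ν ∧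
      8 * κ ^ q + 5 * q * κ ^ (q - 2) * c₀ < q / 2 * κ ^ (q - 2) * ν ^ 2 ∧
      512 * (8 * κ ^ q + 5 * q * κ ^ (q - 2) * c₀) < 3 / 4 ∧
      32 * κ ^ (q - 2) * ν ≤ 1 ∧
      6 < q ^ (p - 2) * (8 * q) * (lam * (q - 1) / (16 * ν) - 2 * N * κ ^ (q - 2)) := by
  obtain ⟨ν₀, hν₀, hν₀1, hν₀2⟩ : ∃ ν₀ : ℝ, 0 < ν₀ ∧ ν₀ ≤ 1 / 32 ∧
      1 ≤ lam * (q - 1) / (16 * ν₀) - 2 * N := by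
    have h1 : 0 < lam * (q - 1) := mul_pos hlam (by linarith)
    refine ⟨min (1 / 32) (lam * (q - 1) / (16 * (2 * N + 1))), by positivity, min_le_left _ _, ?_⟩
    have h2 : 2 * N + 1 ≤
        lam * (q - 1) / (16 * min (1 / 32) (lam * (q - 1) / (16 * (2 * N + 1)))) := by
      rw [le_div_iff₀ (by positivity)]
      calc (2 * N + 1) * (16 * min (1 / 32) (lam * (q - 1) / (16 * (2 * N + 1))))
          ≤ (2 * N + 1) * (16 * (lam * (q - 1) / (16 * (2 * N + 1)))) := by
            gcongr
            exact min_le_right _ _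
        _ = lam * (q - 1) := by field_simp
    linarith
  have hq10 : 0 < q - 1 := by linarith
  set m₀ := min (q * (q - 1) * ν₀) (min (q * ν₀ ^ 2 / 4) (1 / 1024)) with hm₀
  have hm₀0 : 0 < m₀ := by positivity
  have hm₀1 : m₀ ≤ q * (q - 1) * ν₀ := min_le_left _ _
  have hm₀2 : m₀ ≤ q * ν₀ ^ 2 / 4 := (min_le_right _ _).trans (min_le_left _ _)
  have hm₀3 : m₀ ≤ 1 / 1024 := (min_le_right _ _).trans (min_le_right _ _)
  set κ := min (1 / 2) ((m₀ / 16) ^ (1 / (2 * q - 2))) with hκ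
  have hκ0 : 0 < κ := by positivity
  have hκ2 : κ ≤ 1 / 2 := min_le_left _ _
  have hκm : κ ^ (2 * q - 2) ≤ m₀ / 16 := by
    calc κ ^ (2 * q - 2) ≤ ((m₀ / 16) ^ (1 / (2 * q - 2))) ^ (2 * q - 2) :=
          Real.rpow_le_rpow hκ0.le (min_le_right _ _) (by linarith)
      _ = m₀ / 16 := by
          rw [← Real.rpow_mul (by positivity), one_div_mul_cancel (by linarith), Real.rpow_one]
  set Z := κ ^ (2 - q) with hZ
  have hZ0 : 0 < Z := by positivity
  have hZ1 : Z ≤ 1 := Real.rpow_le_one hκ0.le (by linarith) (by linarith)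
  have hZi : κ ^ (q - 2) = Z⁻¹ := by
    rw [hZ, ← Real.rpow_neg hκ0.le]
    congr 1
    ring
  have hκq : κ ^ q ≤ m₀ / 16 * Z := by
    calc κ ^ q = κ ^ (2 * q - 2) * Z := by
          rw [hZ, ← Real.rpow_add hκ0]
          congr 1
          ring
      _ ≤ _ := by gcongr
  have hS : 8 * κ ^ q + 5 * q * κ ^ (q - 2) * (m₀ / (10 * q) * Z ^ 2) ≤ m₀ * Z := by
    have : 5 * q * κ ^ (q - 2) * (m₀ / (10 * q) * Z ^ 2) = m₀ / 2 * Z := by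
      rw [hZi]
      field_simp
      norm_num
    rw [this]
    linarith
  refine ⟨κ, ν₀ * Z, m₀ / (10 * q) * Z ^ 2, hκ0, hκ2, by positivity, ?_, by positivity, ?_,
    ?_, ?_, ?_, ?_, ?_⟩
  · nlinarith
  · have h1 : m₀ / (10 * q) ≤ 1 := by
      rw [div_le_one (by positivity)]
      linarith
    exact mul_le_one₀ h1 (by positivity) (pow_le_one₀ hZ0.le hZ1)
  · refine hS.trans ?_
    calc m₀ * Z ≤ q * (q - 1) * ν₀ * Z := by gcongr
      _ = _ := by ring
  · refine hS.trans_lt ?_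
    have : q / 2 * κ ^ (q - 2) * (ν₀ * Z) ^ 2 = q * ν₀ ^ 2 / 2 * Z := by
      rw [hZi]
      field_simp
    rw [this]
    have h3 : 0 < q * ν₀ ^ 2 / 4 := by positivity
    gcongr
    linarith
  · have : m₀ * Z ≤ 1 / 1024 * 1 := by gcongr
    linarith
  · rw [hZi]
    calc 32 * Z⁻¹ * (ν₀ * Z) = 32 * ν₀ := by field_simp
      _ ≤ 1 := by linarith
  · have h1 : 1 ≤ lam * (q - 1) / (16 * (ν₀ * Z)) - 2 * N * κ ^ (q - 2) := by
      have : lam * (q - 1) / (16 * (ν₀ * Z)) - 2 * N * κ ^ (q - 2)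
          = (lam * (q - 1) / (16 * ν₀) - 2 * N) * Z⁻¹ := by
        rw [hZi]
        field_simp
      rw [this]
      have h2 : 1 ≤ Z⁻¹ := (one_le_inv₀ hZ0).2 hZ1
      nlinarith
    have h2 : 1 ≤ q ^ (p - 2) := Real.one_le_rpow hq1.le (by linarith)
    have h3 : 8 ≤ q ^ (p - 2) * (8 * q) := by nlinarith
    nlinarith

set_option maxHeartbeats 2000000 in
/-- At a fixed time the vertices of touching cusps depend in a Lipschitz way on the contact
points. -/
lemma exists_contact_lipschitz (hp : 2 < p) (hlam : 0 < lam) (hN : 0 ≤ N) :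
    ∃ C > 0, ∀ u : Space n × ℝ → ℝ,
      PosSuper p lam N (Metric.closedBall 0 1 ×ˢ Icc 0 2) u →
      ∀ (t : ℝ) (x₁ x₂ y₁ y₂ : Space n) (s₁ s₂ : ℝ), 0 ≤ t → t ≤ 2 → ‖x₁‖ ≤ 1 → ‖x₂‖ ≤ 1 →
        ‖y₁‖ ≤ 1 / 8 → ‖y₂‖ ≤ 1 / 8 → s₁ ≤ -1 →
        (∀ x ∈ Metric.closedBall (0 : Space n) 1, ∀ t' ∈ Icc 0 t,
          s₁ + 3 * t' - 8 * ‖x - y₁‖ ^ (p / (p - 1)) ≤ u (x, t')) →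
        (∀ x ∈ Metric.closedBall (0 : Space n) 1, ∀ t' ∈ Icc 0 t,
          s₂ + 3 * t' - 8 * ‖x - y₂‖ ^ (p / (p - 1)) ≤ u (x, t')) →
        u (x₁, t) = s₁ + 3 * t - 8 * ‖x₁ - y₁‖ ^ (p / (p - 1)) →
        u (x₂, t) = s₂ + 3 * t - 8 * ‖x₂ - y₂‖ ^ (p / (p - 1)) →
        ‖y₁ - y₂‖ ≤ C * ‖x₁ - x₂‖ := by
  set q := p / (p - 1) with hqdef
  have hp1 : 0 < p - 1 := by linarith
  have hq1 : 1 < q := by rw [hqdef, lt_div_iff₀ hp1]; linarith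
  have hq2 : q < 2 := by rw [hqdef, div_lt_iff₀ hp1]; linarith
  have hqp : q * (p - 1) = p := by rw [hqdef]; field_simp
  obtain ⟨κ, ν, c₀, hκ, hκ2, hν, hν20, hc₀, hc₀1, ha, hb, hc, hd', he⟩ :=
    kink_constants (lam := lam) (N := N) (p := p) hq1 hq2 hp hlam hN
  refine ⟨c₀⁻¹, by positivity, ?_⟩
  intro u hu t x₁ x₂ y₁ y₂ s₁ s₂ ht0 ht2 hx₁ hx₂ hy₁ hy₂ hs₁ hb₁ hb₂ hu₁ hu₂
  -- If the contact points are closer than `c₀ d`, both cusps nearly touch `u` at `x₁`. Replacing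
  -- each by a paraboloid below it gives two graphs under `u` whose gradients differ by at least
  -- `8q(q-1)K d`; at scale `ρ = ν d` this kink is too strong for `kink_bound`.
  by_contra hcon
  rw [not_le, inv_mul_lt_iff₀ hc₀] at hcon
  set d := ‖y₁ - y₂‖ with hd
  have hd0 : 0 < d := by
    by_contra h
    have : c₀ * d ≤ 0 := mul_nonpos_of_nonneg_of_nonpos hc₀.le (not_lt.1 h)
    linarith [norm_nonneg (x₁ - x₂)]
  have hdq : d ≤ 1 / 4 := (norm_sub_le _ _).trans (by linarith)
  set e₁ := x₁ - y₁ with he₁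
  set e₂ := x₁ - y₂ with he₂
  have hee : e₁ - e₂ = -(y₁ - y₂) := by rw [he₁, he₂]; abel
  have heed : ‖e₁ - e₂‖ = d := by rw [hee, norm_neg]
  set R := max ‖e₁‖ ‖e₂‖ with hR
  have hr1 : ‖e₁‖ ≤ R := le_max_left _ _
  have hr2 : ‖e₂‖ ≤ R := le_max_right _ _
  have hdR : d ≤ 2 * R := by
    rw [← heed]
    exact (norm_sub_le _ _).trans (by linarith)
  have hR0 : 0 < R := by linarith
  have hR98 : R ≤ 9 / 8 := max_le ((norm_sub_le _ _).trans (by linarith))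
    ((norm_sub_le _ _).trans (by linarith))
  -- Since `q < 2`, tangent paraboloids degenerate at the vertex of a cusp; distances to the vertex
  -- are therefore truncated below at `τ`.
  set τ := κ * R with hτ
  have hτ0 : 0 < τ := by positivity
  have hτR : τ ≤ R := mul_le_of_le_one_left hR0.le (by linarith)
  set K := R ^ (q - 2) with hK
  have hK0 : 0 < K := by positivity
  have hKR2 : K * R ^ 2 = R ^ q := by
    rw [hK, ← Real.rpow_natCast, ← Real.rpow_add hR0]
    norm_num
  have hKR1 : K * R = R ^ (q - 1) := by
    rw [hK, ← Real.rpow_add_one hR0.ne']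
    congr 1
    ring
  have hτq : τ ^ (q - 2) = κ ^ (q - 2) * K := by
    rw [hτ, Real.mul_rpow hκ.le hR0.le]
  have hKτ : K ≤ τ ^ (q - 2) := Real.rpow_le_rpow_of_nonpos hτ0 hτR (by linarith)
  set S := 8 * κ ^ q + 5 * q * κ ^ (q - 2) * c₀ with hS
  -- if one vertex is close to the contact point, the vertices are far apart
  have hfar : ∀ a b : Space n, ‖a - b‖ = d → R = max ‖a‖ ‖b‖ → ‖a‖ < τ → R ≤ 2 * d := by
    intro a b hab hmax ha
    have h1 : ‖b‖ = R := by
      rcases le_total ‖a‖ ‖b‖ with h | h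
      · rw [hmax, max_eq_right h]
      · rw [max_eq_left h] at hmax
        linarith
    have h2 : ‖b‖ - ‖a‖ ≤ d := by
      rw [← hab, norm_sub_rev]
      exact norm_sub_norm_le _ _
    have h3 : τ ≤ R / 2 := by
      have := mul_le_mul_of_nonneg_right hκ2 hR0.le
      rw [hτ]
      linarith
    linarith
  -- The truncation costs something only when `‖a‖ < τ`. Then `R ≤ 2d`, so the cost is of order `κ^q
  -- K d²`.
  have hloss : ∀ a b : Space n, ‖a - b‖ = d → R = max ‖a‖ ‖b‖ →
      (1 - q / 2) * max ‖a‖ τ ^ q + q / 2 * max ‖a‖ τ ^ (q - 2) * ‖a‖ ^ 2 ≤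
        ‖a‖ ^ q + 4 * κ ^ q * K * d ^ 2 := by
    intro a b hab hmax
    rcases le_or_gt τ ‖a‖ with h | h
    · rw [max_eq_left h]
      have ha0 : 0 < ‖a‖ := hτ0.trans_le h
      have h1 : ‖a‖ ^ (q - 2) * ‖a‖ ^ 2 = ‖a‖ ^ q := by
        rw [← Real.rpow_natCast, ← Real.rpow_add ha0]
        norm_num
      have h2 : 0 ≤ 4 * κ ^ q * K * d ^ 2 := by positivity
      linear_combination (norm := skip) h2 + q / 2 * h1
      ring_nf
      exact le_rfl
    · rw [max_eq_right h.le]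
      have h1 := hfar a b hab hmax h
      have h2 : τ ^ (q - 2) * τ ^ 2 = τ ^ q := by
        rw [← Real.rpow_natCast, ← Real.rpow_add hτ0]
        norm_num
      have h3 : q / 2 * τ ^ (q - 2) * ‖a‖ ^ 2 ≤ q / 2 * τ ^ (q - 2) * τ ^ 2 := by gcongr
      have h4 : τ ^ q = κ ^ q * (K * R ^ 2) := by
        rw [hKR2, hτ, Real.mul_rpow hκ.le hR0.le]
      have h5 : R ^ 2 ≤ 4 * d ^ 2 := by
        calc R ^ 2 ≤ (2 * d) ^ 2 := by gcongr
          _ = 4 * d ^ 2 := by ring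
      have h6 : κ ^ q * (K * R ^ 2) ≤ κ ^ q * (K * (4 * d ^ 2)) := by gcongr
      have h7 : 0 ≤ ‖a‖ ^ q := by positivity
      have h8 : q / 2 * τ ^ (q - 2) * τ ^ 2 = q / 2 * τ ^ q := by rw [mul_assoc, h2]
      linarith
  have hR' : R = max ‖e₂‖ ‖e₁‖ := by rw [hR, max_comm]
  have heed' : ‖e₂ - e₁‖ = d := by rw [norm_sub_rev, heed]
  have hl1 := hloss e₁ e₂ heed hR
  have hl2 := hloss e₂ e₁ heed' hR'
  set σ₁ := max ‖e₁‖ τ with hσ₁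
  set σ₂ := max ‖e₂‖ τ with hσ₂
  have hσ₁0 : 0 < σ₁ := lt_max_of_lt_right hτ0
  have hσ₂0 : 0 < σ₂ := lt_max_of_lt_right hτ0
  have hσ₁τ : σ₁ ^ (q - 2) ≤ τ ^ (q - 2) :=
    Real.rpow_le_rpow_of_nonpos hτ0 (le_max_right _ _) (by linarith)
  have hσ₂τ : σ₂ ^ (q - 2) ≤ τ ^ (q - 2) :=
    Real.rpow_le_rpow_of_nonpos hτ0 (le_max_right _ _) (by linarith)
  set P₁ := (1 - q / 2) * σ₁ ^ q + q / 2 * σ₁ ^ (q - 2) * ‖e₁‖ ^ 2 with hP₁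
  set P₂ := (1 - q / 2) * σ₂ ^ q + q / 2 * σ₂ ^ (q - 2) * ‖e₂‖ ^ 2 with hP₂
  have hP₁l : ‖e₁‖ ^ q ≤ P₁ := norm_rpow_le_paraboloid (by linarith) hq2.le hσ₁0 e₁
  have hP₂l : ‖e₂‖ ^ q ≤ P₂ := norm_rpow_le_paraboloid (by linarith) hq2.le hσ₂0 e₂
  have hpar : ∀ (e h : Space n) (σ : ℝ), 0 < σ → σ ^ (q - 2) ≤ τ ^ (q - 2) →
      ‖e + h‖ ^ q ≤ ((1 - q / 2) * σ ^ q + q / 2 * σ ^ (q - 2) * ‖e‖ ^ 2)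
        + q * σ ^ (q - 2) * ⟪e, h⟫ + q / 2 * τ ^ (q - 2) * ‖h‖ ^ 2 := by
    intro e h σ hσ hστ
    have h1 := norm_rpow_le_paraboloid (q := q) (by linarith) hq2.le hσ (e + h)
    rw [norm_add_sq_real] at h1
    have h2 : q / 2 * σ ^ (q - 2) * ‖h‖ ^ 2 ≤ q / 2 * τ ^ (q - 2) * ‖h‖ ^ 2 := by gcongr
    linarith
  -- the two cusps nearly agree at the contact point
  set h := x₂ - x₁ with hh
  have hhn : ‖h‖ ≤ c₀ * d := by rw [hh, norm_sub_rev]; exact hcon.le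
  have hx2y1 : x₂ - y₁ = e₁ + h := by rw [he₁, hh]; abel
  have hx2y2 : x₂ - y₂ = e₂ + h := by rw [he₂, hh]; abel
  have hgrad : ‖σ₁ ^ (q - 2) • e₁ - ‖e₂‖ ^ (q - 2) • e₂‖ ≤ 4 * τ ^ (q - 2) * d := by
    rcases le_or_gt τ ‖e₂‖ with hc2 | hc2
    · have h1 := truncGrad_upper hq1 hq2 hτ0 e₁ e₂
      rw [heed, max_eq_left hc2] at h1
      refine h1.trans ?_
      gcongr
      norm_num
    · have h1 := hfar e₂ e₁ heed' hR' hc2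
      have h2 : σ₁ ≤ R := max_le hr1 hτR
      have h3 : ‖σ₁ ^ (q - 2) • e₁‖ ≤ R ^ (q - 1) := by
        rw [norm_smul, Real.norm_of_nonneg (by positivity)]
        calc σ₁ ^ (q - 2) * ‖e₁‖ ≤ σ₁ ^ (q - 2) * σ₁ := by gcongr; exact le_max_left _ _
          _ = σ₁ ^ (q - 1) := by
              rw [← Real.rpow_add_one hσ₁0.ne']
              congr 1
              ring
          _ ≤ _ := Real.rpow_le_rpow hσ₁0.le h2 (by linarith)
      have h4 : ‖‖e₂‖ ^ (q - 2) • e₂‖ ≤ R ^ (q - 1) := by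
        rw [norm_smul, Real.norm_of_nonneg (by positivity)]
        rcases (norm_nonneg e₂).eq_or_lt with h5 | h5
        · rw [← h5, mul_zero]
          positivity
        · rw [← Real.rpow_add_one h5.ne', show q - 2 + 1 = q - 1 by ring]
          exact Real.rpow_le_rpow h5.le hr2 (by linarith)
      calc _ ≤ R ^ (q - 1) + R ^ (q - 1) := (norm_sub_le _ _).trans (add_le_add h3 h4)
        _ = 2 * (K * R) := by rw [hKR1]; ring
        _ ≤ 2 * (τ ^ (q - 2) * (2 * d)) := by gcongr
        _ = _ := by ring
  -- At `x₂` the first cusp lies below `u`, which equals the second cusp there. Expanding both from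
  -- `x₁` transfers the comparison to `x₁`, up to an error quadratic in `d`.
  have hdiff : s₁ - 8 * ‖e₁‖ ^ q ≤ s₂ - 8 * ‖e₂‖ ^ q
      + 8 * (4 * κ ^ q + 5 * q * κ ^ (q - 2) * c₀) * K * d ^ 2 := by
    have h1 := hb₁ x₂ (by simpa using hx₂) t ⟨ht0, le_rfl⟩
    rw [hu₂, hx2y1, hx2y2] at h1
    have h2 := hpar e₁ h σ₁ hσ₁0 hσ₁τ
    have h3 := norm_rpow_convex hq1 e₂ h
    have h4 : σ₁ ^ (q - 2) * ⟪e₁, h⟫ - ‖e₂‖ ^ (q - 2) * ⟪e₂, h⟫ ≤ 4 * τ ^ (q - 2) * d * (c₀ * d) := by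
      rw [← real_inner_smul_left, ← real_inner_smul_left, ← inner_sub_left]
      refine (real_inner_le_norm _ _).trans ?_
      gcongr
    have h5 : q / 2 * τ ^ (q - 2) * ‖h‖ ^ 2 ≤ q * (τ ^ (q - 2) * c₀ * d ^ 2) := by
      have h6 : ‖h‖ ^ 2 ≤ c₀ * d ^ 2 := by
        calc ‖h‖ ^ 2 ≤ (c₀ * d) ^ 2 := by gcongr
          _ = c₀ * (c₀ * d ^ 2) := by ring
          _ ≤ c₀ * (1 * d ^ 2) := by gcongr
          _ = _ := by ring
      calc q / 2 * τ ^ (q - 2) * ‖h‖ ^ 2 ≤ q / 2 * τ ^ (q - 2) * (c₀ * d ^ 2) := by gcongr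
        _ ≤ q * τ ^ (q - 2) * (c₀ * d ^ 2) := by gcongr; linarith
        _ = _ := by ring
    have h6 := mul_le_mul_of_nonneg_left h4 (by linarith : 0 ≤ q)
    have h7 : 8 * (4 * κ ^ q + 5 * q * κ ^ (q - 2) * c₀) * K * d ^ 2 =
        8 * (4 * κ ^ q * K * d ^ 2) + 8 * (q * (4 * τ ^ (q - 2) * d * (c₀ * d)))
          + 8 * (q * (τ ^ (q - 2) * c₀ * d ^ 2)) := by
      rw [hτq]
      ring
    rw [h7]
    linarith
  have hge : s₂ - 8 * ‖e₂‖ ^ q ≤ s₁ - 8 * ‖e₁‖ ^ q := by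
    have h1 := hb₂ x₁ (by simpa using hx₁) t ⟨ht0, le_rfl⟩
    rw [hu₁] at h1
    linarith
  set c₁ := s₁ + 3 * t - 8 * P₁ with hc₁
  set c₂ := s₂ + 3 * t - 8 * P₂ with hc₂
  set η := 8 * S * K * d ^ 2 with hη
  have hηeq : η = 8 * (4 * κ ^ q + 5 * q * κ ^ (q - 2) * c₀) * K * d ^ 2
      + 8 * (4 * κ ^ q * K * d ^ 2) := by
    rw [hη, hS]
    ring
  have hX0 : 0 ≤ 8 * (4 * κ ^ q + 5 * q * κ ^ (q - 2) * c₀) * K * d ^ 2 := by positivity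
  have hη₁ : u (x₁, t) ≤ c₁ + η := by
    rw [hu₁, hc₁]
    linarith
  have hη₂ : u (x₁, t) ≤ c₂ + η := by
    rw [hu₁, hc₂]
    linarith
  have hc₁u : c₁ ≤ u (x₁, t) := by
    rw [hu₁, hc₁]
    linarith
  have hc₂u : c₂ ≤ u (x₁, t) := by
    rw [hu₁, hc₂]
    linarith
  -- localization
  have hpos := hu.nonneg (x₁, t) ⟨by simpa using hx₁, ht0, ht2⟩
  have hE0 : 0 ≤ ‖e₁‖ ^ q := by positivity
  -- Nonnegativity of `u` and `s₁ ≤ -1` delay the contact, leaving room for the time depth `1/4`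
  -- used in `kink_bound`.
  have ht3 : 1 / 3 ≤ t := by linarith
  have hx₁b : ‖x₁‖ ≤ 0.925 := by
    have h1 : ‖e₁‖ ^ q ≤ 5 / 8 := by linarith
    have h2 : ‖e₁‖ ≤ 0.8 := by
      by_contra hcon2
      rw [not_le] at hcon2
      have h3 : (0.8 : ℝ) ^ q ≤ ‖e₁‖ ^ q := Real.rpow_le_rpow (by norm_num) hcon2.le (by linarith)
      have h4 : (0.8 : ℝ) ^ (2 : ℝ) ≤ 0.8 ^ q :=
        Real.rpow_le_rpow_of_exponent_ge (by norm_num) (by norm_num) hq2.le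
      norm_num at h3 h4
      linarith
    have h3 : ‖x₁‖ ≤ ‖e₁‖ + ‖y₁‖ := by
      have : x₁ = e₁ + y₁ := by rw [he₁]; abel
      conv_lhs => rw [this]
      exact norm_add_le _ _
    linarith
  set ρ := ν * d with hρ
  have hρ0 : 0 < ρ := by positivity
  have hρ80 : ρ ≤ 1 / 80 := by
    calc ν * d ≤ 1 / 20 * (1 / 4) := by gcongr
      _ = 1 / 80 := by norm_num
  have hball : ∀ x ∈ Metric.closedBall x₁ ρ, x ∈ Metric.closedBall (0 : Space n) 1 := by
    intro x hx
    rw [mem_closedBall_iff_norm] at hx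
    rw [mem_closedBall_zero_iff]
    have : ‖x‖ ≤ ‖x - x₁‖ + ‖x₁‖ := by simpa using norm_add_le (x - x₁) x₁
    linarith
  have hsub : Metric.closedBall x₁ ρ ×ˢ Icc (t - 1 / 4) t ⊆
      Metric.closedBall (0 : Space n) 1 ×ˢ Icc 0 2 := by
    rintro ⟨x, t'⟩ ⟨hx, ht'⟩
    exact ⟨hball x hx, by linarith [ht'.1], by linarith [ht'.2]⟩
  have hu' := hu.mono hsub
  set A := 8 * q * τ ^ (q - 2) with hA
  have hA0 : 0 < A := by positivity
  have hlow : ∀ (y e : Space n) (s σ : ℝ), e = x₁ - y → 0 < σ → σ ^ (q - 2) ≤ τ ^ (q - 2) →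
      (∀ x ∈ Metric.closedBall (0 : Space n) 1, ∀ t' ∈ Icc 0 t,
        s + 3 * t' - 8 * ‖x - y‖ ^ q ≤ u (x, t')) →
      ∀ x ∈ Metric.closedBall x₁ ρ, ∀ t' ∈ Icc (t - 1 / 4) t,
        (s + 3 * t - 8 * ((1 - q / 2) * σ ^ q + q / 2 * σ ^ (q - 2) * ‖e‖ ^ 2))
          + ⟪(-(8 * q * σ ^ (q - 2))) • e, x - x₁⟫ - A / 2 * ‖x - x₁‖ ^ 2 + 3 * (t' - t)
          ≤ u (x, t') := by
    intro y e s σ hey hσ hστ hb x hx t' ht'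
    have h1 := hb x (hball x hx) t' ⟨by linarith [ht'.1], ht'.2⟩
    have h2 := hpar e (x - x₁) σ hσ hστ
    have h3 : x - y = e + (x - x₁) := by rw [hey]; abel
    rw [h3] at h1
    rw [real_inner_smul_left, hA]
    linarith
  have hL₁ := hlow y₁ e₁ s₁ σ₁ he₁ hσ₁0 hσ₁τ hb₁
  have hL₂ := hlow y₂ e₂ s₂ σ₂ he₂ hσ₂0 hσ₂τ hb₂
  rw [← hP₁, ← hc₁] at hL₁
  rw [← hP₂, ← hc₂] at hL₂
  set g₁ := (-(8 * q * σ₁ ^ (q - 2))) • e₁ with hg₁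
  set g₂ := (-(8 * q * σ₂ ^ (q - 2))) • e₂ with hg₂
  set γ := 8 * q * R ^ (q - 1) with hγ
  have hgn : ∀ (e : Space n), ‖e‖ ≤ R → ‖(-(8 * q * max ‖e‖ τ ^ (q - 2))) • e‖ ≤ γ := by
    intro e heR
    have hσ0 : 0 < max ‖e‖ τ := lt_max_of_lt_right hτ0
    rw [norm_smul, norm_neg, Real.norm_of_nonneg (by positivity), hγ, mul_assoc]
    have h1 : max ‖e‖ τ ^ (q - 2) * ‖e‖ ≤ R ^ (q - 1) := by
      calc max ‖e‖ τ ^ (q - 2) * ‖e‖ ≤ max ‖e‖ τ ^ (q - 2) * max ‖e‖ τ := by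
            gcongr; exact le_max_left _ _
        _ = max ‖e‖ τ ^ (q - 1) := by
            rw [← Real.rpow_add_one hσ0.ne']
            congr 1
            ring
        _ ≤ _ := Real.rpow_le_rpow hσ0.le (max_le heR hτR) (by linarith)
    gcongr
  have hgeq : ∀ (e : Space n), ‖e‖ = R → ‖(-(8 * q * max ‖e‖ τ ^ (q - 2))) • e‖ = γ := by
    intro e heR
    rw [heR, max_eq_left hτR, norm_smul, norm_neg, Real.norm_of_nonneg (by positivity), hγ, heR,
      ← hKR1, hK]
    ring
  have hgdiff : g₁ - g₂ = (-(8 * q)) • (σ₁ ^ (q - 2) • e₁ - σ₂ ^ (q - 2) • e₂) := by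
    rw [hg₁, hg₂]
    module
  have hδ : 8 * q * ((q - 1) * K * d) ≤ ‖g₁ - g₂‖ := by
    rw [hgdiff, norm_smul, norm_neg, Real.norm_of_nonneg (by positivity)]
    gcongr
    rcases le_total ‖e₁‖ ‖e₂‖ with h12 | h12
    · have h1 := truncGrad_lower hq1 hq2 hτ0 h12 (by rw [hR, max_eq_right h12]) hτR
      rwa [heed] at h1
    · have h1 := truncGrad_lower hq1 hq2 hτ0 h12 (by rw [hR, max_eq_left h12]) hτR
      rw [heed'] at h1
      rwa [norm_sub_rev]
  have hq10 : 0 < q - 1 := by linarith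
  have hδ0 : 0 < ‖g₁ - g₂‖ := lt_of_lt_of_le (by positivity) hδ
  have hcc : |c₁ - c₂| ≤ ‖g₁ - g₂‖ * ρ := by
    have h1 : |c₁ - c₂| ≤ η := abs_sub_le_iff.2 ⟨by linarith, by linarith⟩
    calc |c₁ - c₂| ≤ η := h1
      _ ≤ 8 * (q * (q - 1) * ν) * K * d ^ 2 := by rw [hη]; gcongr
      _ = 8 * q * ((q - 1) * K * d) * ρ := by rw [hρ]; ring
      _ ≤ _ := by gcongr
  have hηA : η < A / 2 * ρ ^ 2 := by
    calc η < 8 * (q / 2 * κ ^ (q - 2) * ν ^ 2) * K * d ^ 2 := by rw [hη]; gcongr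
      _ = A / 2 * ρ ^ 2 := by rw [hA, hτq, hρ]; ring
  have hηb : η < 3 * (1 / 4) := by
    have h1 : K * d ^ 2 ≤ 8 := by
      calc K * d ^ 2 ≤ K * (2 * R) ^ 2 := by gcongr
        _ = 4 * R ^ q := by rw [← hKR2]; ring
        _ ≤ 4 * 2 := by
          gcongr
          calc R ^ q ≤ (9 / 8) ^ q := Real.rpow_le_rpow hR0.le hR98 (by linarith)
            _ ≤ (9 / 8 : ℝ) ^ (2 : ℝ) :=
              Real.rpow_le_rpow_of_exponent_le (by norm_num) hq2.le
            _ ≤ 2 := by norm_num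
        _ = 8 := by norm_num
    have hS0 : 0 < S := by positivity
    calc η = 8 * S * (K * d ^ 2) := by rw [hη]; ring
      _ ≤ 8 * S * 8 := by gcongr
      _ < _ := by linarith
  have hAγ : 2 * A * ρ ≤ γ / 8 := by
    calc 2 * A * ρ = 16 * q * K * (κ ^ (q - 2) * ν) * d := by rw [hA, hτq, hρ]; ring
      _ ≤ 16 * q * K * (1 / 32) * (2 * R) := by
          gcongr
          linarith
      _ = γ / 8 := by rw [hγ, ← hKR1]; ring
  have hfin : (γ / 8) ^ (p - 2) * (lam * (‖g₁ - g₂‖ / (16 * ρ)) - N * (2 * A)) ≤ 2 * 3 := by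
    rcases le_total ‖e₁‖ ‖e₂‖ with h12 | h12
    · exact kink_bound hp hρ0 (by norm_num) hA0 (by norm_num) hu'.cont hu'.super hL₁ hL₂
        hη₁ hη₂ hδ0 hcc (hgn e₁ hr1) (hgeq e₂ (by rw [hR, max_eq_right h12])) hηA hηb hAγ
    · rw [norm_sub_rev] at hδ0 hcc ⊢
      rw [abs_sub_comm] at hcc
      exact kink_bound hp hρ0 (by norm_num) hA0 (by norm_num) hu'.cont hu'.super hL₂ hL₁
        hη₂ hη₁ hδ0 hcc (hgn e₂ hr2) (hgeq e₁ (by rw [hR, max_eq_left h12])) hηA hηb hAγ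
  have hγp : (γ / 8) ^ (p - 2) = q ^ (p - 2) * K⁻¹ := by
    rw [hγ, show 8 * q * R ^ (q - 1) / 8 = q * R ^ (q - 1) by ring,
      Real.mul_rpow (by linarith) (by positivity), ← Real.rpow_mul hR0.le, hK,
      ← Real.rpow_neg hR0.le]
    congr 2
    linarith
  have hlast : 8 * q * K * (lam * (q - 1) / (16 * ν) - 2 * N * κ ^ (q - 2)) ≤
      lam * (‖g₁ - g₂‖ / (16 * ρ)) - N * (2 * A) := by
    have h1 : lam * (8 * q * ((q - 1) * K * d) / (16 * ρ)) ≤ lam * (‖g₁ - g₂‖ / (16 * ρ)) := by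
      gcongr
    have h2 : lam * (8 * q * ((q - 1) * K * d) / (16 * ρ))
        = 8 * q * K * (lam * (q - 1) / (16 * ν)) := by
      rw [hρ]
      field_simp
    have h3 : N * (2 * A) = 8 * q * K * (2 * N * κ ^ (q - 2)) := by
      rw [hA, hτq]
      ring
    rw [h2] at h1
    rw [h3]
    linarith
  have h1 := mul_le_mul_of_nonneg_left hlast (by positivity : 0 ≤ (γ / 8) ^ (p - 2))
  have h2 : (γ / 8) ^ (p - 2) * (8 * q * K * (lam * (q - 1) / (16 * ν) - 2 * N * κ ^ (q - 2)))
      = q ^ (p - 2) * (8 * q) * (lam * (q - 1) / (16 * ν) - 2 * N * κ ^ (q - 2)) := by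
    rw [hγp]
    field_simp
  linarith

end Contact

end DegenerateParabolic

end

noncomputable section

namespace DegenerateParabolic

open Filter Topology MeasureTheory
open scoped RealInnerProductSpace ENNReal NNReal

/-! ### The contact set has positive measure. -/

section MeasureEstimate

variable {n : ℕ} {p lam N : ℝ}

/-- Volume is a multiple of `n`-dimensional Hausdorff measure, for which Lipschitz images are
controlled directly. -/
lemma volume_image_le_of_lipschitzOn {f : Space n → Space n} {s : Set (Space n)} {K : ℝ≥0}
    (h : LipschitzOnWith K f s) : volume (f '' s) ≤ (K : ℝ≥0∞) ^ n * volume s := by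
  have h1 := h.hausdorffMeasure_image_le (d := n) (by positivity)
  rw [← EuclideanSpace.euclideanHausdorffMeasure_eq_volume,
    Measure.euclideanHausdorffMeasure_def, Measure.smul_apply, Measure.smul_apply]
  rw [ENNReal.rpow_natCast] at h1
  simp only [ENNReal.smul_def, smul_eq_mul]
  rw [mul_left_comm]
  gcongr

/-- The inverse of `f` on the image is Lipschitz. Neither `s` nor `f` has to be measurable, so
contact points may be chosen arbitrarily. -/
lemma volume_le_of_expandingOn {f : Space n → Space n} {s : Set (Space n)} {K : ℝ}
    (hK : 0 ≤ K) (h : ∀ a ∈ s, ∀ b ∈ s, ‖a - b‖ ≤ K * ‖f a - f b‖) :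
    volume s ≤ ENNReal.ofReal K ^ n * volume (f '' s) := by
  have hinj : InjOn f s := by
    intro a ha b hb hab
    have := h a ha b hb
    rw [hab, sub_self, norm_zero, mul_zero] at this
    exact sub_eq_zero.1 (norm_le_zero_iff.1 this)
  have hl : LipschitzOnWith K.toNNReal (Function.invFunOn f s) (f '' s) := by
    refine LipschitzOnWith.of_dist_le_mul ?_
    rintro _ ⟨a, ha, rfl⟩ _ ⟨b, hb, rfl⟩
    rw [hinj.leftInvOn_invFunOn ha, hinj.leftInvOn_invFunOn hb, dist_eq_norm, dist_eq_norm,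
      Real.coe_toNNReal K hK]
    exact h a ha b hb
  have := volume_image_le_of_lipschitzOn hl
  rwa [hinj.leftInvOn_invFunOn.image_image] at this

lemma volume_Icc_le_of_lipschitz {w : ℝ → ℝ} {s : Set ℝ} {K a b : ℝ} (hK : 0 < K)
    (h : ∀ t₁ ∈ s, ∀ t₂ ∈ s, t₁ ≤ t₂ → |w t₁ - w t₂| ≤ K * (t₂ - t₁))
    (hs : Icc a b ⊆ w '' s) : ENNReal.ofReal ((b - a) / K) ≤ volume s := by
  have hl : LipschitzOnWith K.toNNReal w s := by
    refine LipschitzOnWith.of_dist_le_mul ?_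
    intro x hx y hy
    rw [Real.coe_toNNReal K hK.le, Real.dist_eq, Real.dist_eq]
    rcases le_total x y with hxy | hxy
    · have := h x hx y hy hxy
      rwa [abs_sub_comm x y, abs_of_nonneg (sub_nonneg.2 hxy)]
    · have := h y hy x hx hxy
      rwa [abs_sub_comm, abs_of_nonneg (sub_nonneg.2 hxy)]
  have h1 := hl.hausdorffMeasure_image_le (d := 1) (by positivity)
  rw [hausdorffMeasure_real, ENNReal.rpow_one] at h1
  have h2 : ENNReal.ofReal (b - a) ≤ ENNReal.ofReal K * volume s := by
    calc ENNReal.ofReal (b - a) = volume (Icc a b) := Real.volume_Icc.symm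
      _ ≤ _ := (measure_mono hs).trans h1
  rw [ENNReal.ofReal_div_of_pos hK]
  exact ENNReal.div_le_of_le_mul' h2

/-- The set of points of `K × [0, 2]` at which `w` takes a value in `[-2, -1]` for the first time
along the vertical line is measurable. -/
lemma measurableSet_firstTimes {w : Space n × ℝ → ℝ} (hw : Continuous w) {K : Set (Space n)}
    (hK : IsCompact K) :
    MeasurableSet {z : Space n × ℝ | z.1 ∈ K ∧ z.2 ∈ Icc (0 : ℝ) 2 ∧ w z ∈ Icc (-2 : ℝ) (-1) ∧
      ∀ t' ∈ Ico 0 z.2, w z < w (z.1, t')} := by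
  -- The complementary condition, that some time earlier by at least `1/(k+1)` has a value no
  -- larger, describes a projection of a compact set.
  set B : ℕ → Set (Space n × ℝ) := fun k => Prod.fst ''
    ((K ×ˢ Icc (0 : ℝ) 2) ×ˢ Icc (0 : ℝ) 2 ∩
      {y : (Space n × ℝ) × ℝ | y.2 ≤ y.1.2 - 1 / (k + 1) ∧ w (y.1.1, y.2) ≤ w y.1}) with hB
  have hBm : ∀ k, MeasurableSet (B k) := by
    intro k
    have h1 : IsClosed {y : (Space n × ℝ) × ℝ | y.2 ≤ y.1.2 - 1 / ((k : ℝ) + 1) ∧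
        w (y.1.1, y.2) ≤ w y.1} :=
      (isClosed_le continuous_snd
        ((continuous_snd.comp continuous_fst).sub continuous_const)).and
        (isClosed_le (hw.comp (by fun_prop)) (hw.comp continuous_fst))
    exact ((((hK.prod isCompact_Icc).prod isCompact_Icc).inter_right h1).image
      continuous_fst).isClosed.measurableSet
  have hA : MeasurableSet ((K ×ˢ Icc (0 : ℝ) 2) ∩ w ⁻¹' Icc (-2) (-1)) :=
    (hK.isClosed.measurableSet.prod measurableSet_Icc).inter (hw.measurable measurableSet_Icc)
  convert hA.diff (MeasurableSet.iUnion hBm) using 1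
  ext ⟨y, t⟩
  simp only [mem_ofPred_eq, Set.mem_sdiff, mem_inter_iff, mem_prod, mem_preimage, mem_iUnion, hB,
    mem_image, not_exists]
  constructor
  · rintro ⟨h1, h2, h3, h4⟩
    refine ⟨⟨⟨h1, h2⟩, h3⟩, ?_⟩
    rintro k ⟨⟨y', t'⟩, t''⟩ ⟨⟨⟨h5, h6⟩, h8, h9⟩, h10⟩
    simp only [Prod.mk.injEq] at h10
    obtain ⟨rfl, rfl⟩ := h10
    have h11 : (0 : ℝ) < 1 / (k + 1) := by positivity
    exact absurd h9 (not_le.2 (h4 t'' ⟨h6.1, by simp only at h8; linarith⟩))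
  · rintro ⟨⟨⟨h1, h2⟩, h3⟩, h4⟩
    refine ⟨h1, h2, h3, fun t' ht' => ?_⟩
    by_contra hcon
    obtain ⟨k, hk⟩ := exists_nat_one_div_lt (sub_pos.2 ht'.2)
    exact h4 k ((y, t), t') ⟨⟨⟨⟨h1, h2⟩, ht'.1, ht'.2.le.trans h2.2⟩,
      by simp only; linarith, not_lt.1 hcon⟩, rfl⟩

/-- Every level between the values at the two ends is attained for a first time. -/
lemma exists_firstTime {w : ℝ → ℝ} (hw : Continuous w) {b s : ℝ} (hb : 0 ≤ b) (h0 : s ≤ w 0)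
    (h2 : w b ≤ s) : ∃ t ∈ Icc 0 b, w t = s ∧ ∀ t' ∈ Ico 0 t, w t < w t' := by
  have hc : IsCompact (Icc 0 b ∩ w ⁻¹' Iic s) :=
    isCompact_Icc.inter_right (isClosed_Iic.preimage hw)
  obtain ⟨t, ⟨ht, hts⟩, hmin⟩ := hc.exists_isLeast ⟨b, ⟨hb, le_rfl⟩, h2⟩
  have heq : w t = s := by
    obtain ⟨t', ht', hw'⟩ := intermediate_value_Icc' ht.1 hw.continuousOn ⟨hts, h0⟩
    have := hmin ⟨⟨ht'.1, ht'.2.trans ht.2⟩, hw'.le⟩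
    rw [le_antisymm this ht'.2, hw']
  refine ⟨t, ht, heq, fun t' ht' => ?_⟩
  by_contra hcon
  have := hmin ⟨⟨ht'.1, ht'.2.le.trans ht.2⟩, (not_lt.1 hcon).trans heq.le⟩
  exact absurd ht'.2 (not_lt.2 this)

lemma contact_point_mem_ball {q s t : ℝ} {x y : Space n} (hq0 : 0 < q) (hq2 : q < 2)
    (hy : ‖y‖ ≤ 1 / 8) (hs : s ≤ -1) (ht : t ≤ 2) (h : 0 ≤ s + 3 * t - 8 * ‖x - y‖ ^ q) :
    x ∈ Metric.ball 0 1 ∧ 0 < t := by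
  have hE0 : 0 ≤ ‖x - y‖ ^ q := by positivity
  refine ⟨?_, by linarith⟩
  have h1 : ‖x - y‖ ^ q ≤ 5 / 8 := by linarith
  have h2 : ‖x - y‖ ≤ 0.8 := by
    by_contra hcon
    rw [not_le] at hcon
    have h3 : (0.8 : ℝ) ^ q ≤ ‖x - y‖ ^ q := Real.rpow_le_rpow (by norm_num) hcon.le hq0.le
    have h4 : (0.8 : ℝ) ^ (2 : ℝ) ≤ 0.8 ^ q :=
      Real.rpow_le_rpow_of_exponent_ge (by norm_num) (by norm_num) hq2.le
    norm_num at h3 h4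
    linarith
  rw [mem_ball_zero_iff]
  have : ‖x‖ ≤ ‖x - y‖ + ‖y‖ := by simpa using norm_add_le (x - y) y
  linarith

/-- Touching cusps are parametrized by vertex `y` and contact time `t`; their height `w (y, t)` is
an infimum over `x`. Let `V` consist of the pairs at which a height in `[-2, -1]` is attained for
the first time. Erosion bounds the speed at which first-attained heights drop, so `V` has length at
least `1/(Ce + 3)` over each vertex. On a time slice the passage from vertices to contact points
shrinks volume at most by the factor `L`. At contact `u ≤ s + 3t ≤ 6`, and integrating over vertical
lines and then over time slices gives the bound. -/
lemma exists_measure_bound_unit (hp : 2 < p) (hlam : 0 < lam) (hN : 0 ≤ N) :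
    ∃ b : ℝ≥0∞, b ≠ 0 ∧ b ≠ ⊤ ∧ ∀ u : Space n × ℝ → ℝ,
      PosSuper p lam N (Metric.closedBall 0 1 ×ˢ Icc 0 2) u →
      (∃ x : Space n, ‖x‖ ≤ 1 / 8 ∧ u (x, 2) ≤ 1) →
      b ≤ volume {z ∈ Metric.ball (0 : Space n) 1 ×ˢ Ioo (0 : ℝ) 2 | u z ≤ 6} := by
  obtain ⟨Ce, hCe, herode⟩ := exists_erosion (n := n) (lam := lam) hp hN
  obtain ⟨Cl, hCl, hlip⟩ := exists_contact_lipschitz (n := n) hp hlam hN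
  set q := p / (p - 1) with hqdef
  have hp1 : 0 < p - 1 := by linarith
  have hq1 : 1 < q := by rw [hqdef, lt_div_iff₀ hp1]; linarith
  have hq2 : q < 2 := by rw [hqdef, div_lt_iff₀ hp1]; linarith
  set V₀ := volume (Metric.closedBall (0 : Space n) (1 / 8)) with hV₀
  have hV₀0 : V₀ ≠ 0 := (Metric.measure_closedBall_pos volume _ (by norm_num)).ne'
  have hV₀t : V₀ ≠ ⊤ := measure_closedBall_lt_top.ne
  set T₀ := ENNReal.ofReal ((-1 - -2) / (Ce + 3)) with hT₀
  have hT₀0 : T₀ ≠ 0 := by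
    rw [hT₀, Ne, ENNReal.ofReal_eq_zero, not_le]
    exact div_pos (by norm_num) (by positivity)
  set L := ENNReal.ofReal Cl ^ n with hL
  have hL0 : L ≠ 0 := pow_ne_zero _ (by rw [Ne, ENNReal.ofReal_eq_zero, not_le]; exact hCl)
  have hLt : L ≠ ⊤ := ENNReal.pow_ne_top ENNReal.ofReal_ne_top
  refine ⟨V₀ * T₀ / L, ?_, ?_, ?_⟩
  · exact (ENNReal.div_pos (mul_ne_zero hV₀0 hT₀0) hLt).ne'
  · exact ENNReal.div_ne_top (ENNReal.mul_ne_top hV₀t ENNReal.ofReal_ne_top) hL0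
  rintro u hu ⟨xs, hxs, hxsu⟩
  -- A global continuous extension of `u` makes `w` continuous everywhere, as needed for the
  -- measurability of `V`.
  obtain ⟨g, hg⟩ := ContinuousMap.exists_restrict_eq
    (s := Metric.closedBall (0 : Space n) 1 ×ˢ Icc (0 : ℝ) 2)
    (Metric.isClosed_closedBall.prod isClosed_Icc)
    ⟨_, continuousOn_iff_continuous_domRestrict.1 hu.cont⟩
  have hgu : ∀ z ∈ Metric.closedBall (0 : Space n) 1 ×ˢ Icc (0 : ℝ) 2, g z = u z := by
    intro z hz
    exact congrArg (fun f : C(_, ℝ) => f ⟨z, hz⟩) hg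
  set f : Space n × ℝ → Space n → ℝ := fun z x => g (x, z.2) + 8 * ‖x - z.1‖ ^ q - 3 * z.2 with hf
  have hfc : Continuous ↿f := by
    change Continuous fun y : (Space n × ℝ) × Space n =>
      g (y.2, y.1.2) + 8 * ‖y.2 - y.1.1‖ ^ q - 3 * y.1.2
    have : Continuous fun y : (Space n × ℝ) × Space n => ‖y.2 - y.1.1‖ ^ q :=
      Continuous.rpow_const (by fun_prop) (fun _ => Or.inr (by linarith))
    fun_prop
  have hcb : IsCompact (Metric.closedBall (0 : Space n) 1) := isCompact_closedBall _ _
  have hcbn : (Metric.closedBall (0 : Space n) 1).Nonempty := ⟨0, by simp⟩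
  set w : Space n × ℝ → ℝ := fun z => sInf (f z '' Metric.closedBall 0 1) with hw
  have hwc : Continuous w := hcb.continuous_sInf hfc
  have hfz : ∀ z, Continuous (f z) := fun z => hfc.comp (by fun_prop : Continuous fun x => (z, x))
  have hwle : ∀ z, ∀ x ∈ Metric.closedBall (0 : Space n) 1, w z ≤ f z x := fun z x hx =>
    csInf_le (hcb.image (hfz z)).bddBelow ⟨x, hx, rfl⟩
  have hwex : ∀ z, ∃ x ∈ Metric.closedBall (0 : Space n) 1, f z x = w z := fun z =>
    (hcb.image (hfz z)).sInf_mem (hcbn.image _)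
  have hlow : ∀ y t, t ∈ Icc (0 : ℝ) 2 → ∀ x ∈ Metric.closedBall (0 : Space n) 1,
      w (y, t) + 3 * t - 8 * ‖x - y‖ ^ q ≤ u (x, t) := by
    intro y t ht x hx
    have := hwle (y, t) x hx
    simp only [hf, hgu (x, t) ⟨hx, ht⟩] at this
    linarith
  set V := {z : Space n × ℝ | z.1 ∈ Metric.closedBall (0 : Space n) (1 / 8) ∧
    z.2 ∈ Icc (0 : ℝ) 2 ∧ w z ∈ Icc (-2 : ℝ) (-1) ∧ ∀ t' ∈ Ico 0 z.2, w z < w (z.1, t')} with hV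
  have hVm : MeasurableSet V := measurableSet_firstTimes hwc (isCompact_closedBall _ _)
  have hvert : ∀ y ∈ Metric.closedBall (0 : Space n) (1 / 8), T₀ ≤ volume (Prod.mk y ⁻¹' V) := by
    intro y hy
    have hy8 : ‖y‖ ≤ 1 / 8 := by simpa using hy
    refine volume_Icc_le_of_lipschitz (w := fun t => w (y, t)) (by positivity) ?_ ?_
    · rintro t₁ ⟨-, ht₁, hw₁, hf₁⟩ t₂ ⟨-, ht₂, hw₂, hf₂⟩ h12
      simp only at ht₁ hw₁ ht₂ hw₂ hf₂
      rcases h12.eq_or_lt with rfl | h12'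
      · simp
      have h1 := hf₂ t₁ ⟨ht₁.1, h12'⟩
      rw [abs_of_pos (by linarith)]
      obtain ⟨x, hx, hxw⟩ := hwex (y, t₂)
      have h2 := herode u hu y (w (y, t₁)) t₁ t₂ hy8 hw₁.2 ht₁.1 h12 ht₂.2
        (hlow y t₁ ht₁) x hx
      simp only [hf, hgu (x, t₂) ⟨hx, ht₂⟩] at hxw
      linarith
    · intro s hs
      have h0 : s ≤ w (y, 0) := by
        obtain ⟨x, hx, hxw⟩ := hwex (y, 0)
        have h1 := hu.nonneg (x, 0) ⟨hx, by simp⟩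
        have h2 : 0 ≤ ‖x - y‖ ^ q := by positivity
        simp only [hf, hgu (x, 0) ⟨hx, by simp⟩] at hxw
        linarith [hs.2]
      have h2 : w (y, 2) ≤ s := by
        have hxs1 : xs ∈ Metric.closedBall (0 : Space n) 1 := by
          rw [mem_closedBall_zero_iff]; linarith
        have h1 := hwle (y, 2) xs hxs1
        simp only [hf, hgu (xs, 2) ⟨hxs1, by norm_num, le_rfl⟩] at h1
        have h3 : ‖xs - y‖ ≤ 1 / 4 := (norm_sub_le _ _).trans (by linarith)
        have h4 : ‖xs - y‖ ^ q ≤ 1 / 4 := by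
          calc ‖xs - y‖ ^ q ≤ (1 / 4 : ℝ) ^ q :=
                Real.rpow_le_rpow (norm_nonneg _) h3 (by linarith)
            _ ≤ (1 / 4 : ℝ) ^ (1 : ℝ) :=
                Real.rpow_le_rpow_of_exponent_ge (by norm_num) (by norm_num) hq1.le
            _ = 1 / 4 := Real.rpow_one _
        linarith [hs.1]
      obtain ⟨t, ht, hts, htf⟩ := exists_firstTime (w := fun t => w (y, t))
        (hwc.comp (by fun_prop)) zero_le_two h0 h2
      exact ⟨t, ⟨hy, ht, by simpa only [hts] using hs, htf⟩, hts⟩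
  set G := {z ∈ Metric.ball (0 : Space n) 1 ×ˢ Ioo (0 : ℝ) 2 | u z ≤ 6} with hG
  have hGm : MeasurableSet G := by
    have : G = (Metric.ball (0 : Space n) 1 ×ˢ Ioo (0 : ℝ) 2) ∩ g ⁻¹' Iic 6 := by
      ext z
      refine and_congr_right fun hz => ?_
      rw [mem_preimage, mem_Iic, hgu z ⟨Metric.ball_subset_closedBall hz.1,
        Ioo_subset_Icc_self hz.2⟩]
    rw [this]
    exact (measurableSet_ball.prod measurableSet_Ioo).inter (g.continuous.measurable measurableSet_Iic)
  -- The set `G` lives over an open time interval; the excluded time is negligible in the integral.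
  have hhor : ∀ t : ℝ, t ≠ 2 → volume ((fun y => (y, t)) ⁻¹' V) ≤
      L * volume ((fun y => (y, t)) ⁻¹' G) := by
    intro t ht2
    choose c hc hcw using fun y => hwex (y, t)
    have hcontact : ∀ y ∈ (fun y => (y, t)) ⁻¹' V, t ∈ Icc (0 : ℝ) 2 ∧ ‖y‖ ≤ 1 / 8 ∧
        w (y, t) ≤ -1 ∧ u (c y, t) = w (y, t) + 3 * t - 8 * ‖c y - y‖ ^ q := by
      rintro y ⟨hy, ht, hwy, -⟩
      have := hcw y
      simp only [hf, hgu (c y, t) ⟨hc y, ht⟩] at this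
      exact ⟨ht, by simpa using hy, hwy.2, by linarith⟩
    have hbelow : ∀ y ∈ (fun y => (y, t)) ⁻¹' V, ∀ x ∈ Metric.closedBall (0 : Space n) 1,
        ∀ t' ∈ Icc 0 t, w (y, t) + 3 * t' - 8 * ‖x - y‖ ^ q ≤ u (x, t') := by
      rintro y ⟨hy, ht, hwy, hfirst⟩ x hx t' ht'
      have h1 : w (y, t) ≤ w (y, t') := by
        rcases ht'.2.eq_or_lt with rfl | h
        · exact le_rfl
        · exact (hfirst t' ⟨ht'.1, h⟩).le
      have := hlow y t' ⟨ht'.1, ht'.2.trans ht.2⟩ x hx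
      linarith
    refine (volume_le_of_expandingOn (f := c) hCl.le ?_).trans ?_
    · intro a ha b hb
      obtain ⟨ht, ha8, haw, hau⟩ := hcontact a ha
      obtain ⟨-, hb8, hbw, hbu⟩ := hcontact b hb
      exact hlip u hu t (c a) (c b) a b (w (a, t)) (w (b, t)) ht.1 ht.2
        (by simpa using hc a) (by simpa using hc b) ha8 hb8 haw (hbelow a ha) (hbelow b hb) hau hbu
    · gcongr
      rintro _ ⟨y, hy, rfl⟩
      obtain ⟨ht, hy8, hyw, hyu⟩ := hcontact y hy
      have hpos := hu.nonneg (c y, t) ⟨hc y, ht⟩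
      obtain ⟨h1, h2⟩ := contact_point_mem_ball (by linarith) hq2 hy8 hyw ht.2 (hyu ▸ hpos)
      refine ⟨⟨h1, h2, lt_of_le_of_ne ht.2 ht2⟩, ?_⟩
      have h3 : 0 ≤ ‖c y - y‖ ^ q := by positivity
      rw [hyu]
      linarith [ht.2]
  have hlower : V₀ * T₀ ≤ volume V := by
    rw [Measure.volume_eq_prod, Measure.prod_apply hVm, mul_comm, hV₀,
      ← setLIntegral_const]
    exact (setLIntegral_mono' measurableSet_closedBall hvert).trans (setLIntegral_le_lintegral _ _)
  have hupper : volume V ≤ L * volume G := by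
    rw [Measure.volume_eq_prod, Measure.prod_apply_symm hVm, Measure.prod_apply_symm hGm,
      ← lintegral_const_mul' _ _ hLt]
    refine lintegral_mono_ae ?_
    filter_upwards [compl_mem_ae_iff.2 (Real.volume_singleton (a := 2))] with t ht
    exact hhor t ht
  exact ENNReal.div_le_of_le_mul' (hlower.trans hupper)

/-- The cylinder `B_r(x) × (t - θ r^p, t + θ r^p)`. -/
def cyl (p θ r : ℝ) (z : Space n × ℝ) : Set (Space n × ℝ) :=
  Metric.ball z.1 r ×ˢ Ioo (z.2 - θ * r ^ p) (z.2 + θ * r ^ p)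

lemma volume_preimage_scaleMap (x₀ : Space n) (t₀ : ℝ) {r θ : ℝ} (hr : 0 < r) (hθ : 0 < θ)
    {S : Set (Space n × ℝ)} (hS : MeasurableSet S) :
    volume (scaleMap x₀ t₀ r θ ⁻¹' S) =
      ENNReal.ofReal (r ^ n)⁻¹ * (ENNReal.ofReal θ⁻¹ * volume S) := by
  have h1 : Measure.map (fun x : Space n => x₀ + r • x) volume
      = ENNReal.ofReal (r ^ n)⁻¹ • volume := by
    have : (fun x : Space n => x₀ + r • x) = (fun x => x₀ + x) ∘ fun x => r • x := rfl
    rw [this, ← Measure.map_map (by fun_prop) (by fun_prop), Measure.map_addHaar_smul _ hr.ne',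
      Measure.map_smul, map_add_left_eq_self, finrank_euclideanSpace_fin,
      abs_of_pos (by positivity)]
  have h2 : Measure.map (fun t : ℝ => t₀ + θ * t) volume = ENNReal.ofReal θ⁻¹ • volume := by
    have : (fun t : ℝ => t₀ + θ * t) = (fun t => t₀ + t) ∘ fun t => θ • t := rfl
    rw [this, ← Measure.map_map (by fun_prop) (by fun_prop), Measure.map_addHaar_smul _ hθ.ne',
      Measure.map_smul, map_add_left_eq_self, Module.finrank_self, pow_one,
      abs_of_pos (by positivity)]
  have h3 : scaleMap x₀ t₀ r θ = Prod.map (fun x => x₀ + r • x) (fun t => t₀ + θ * t) := rfl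
  rw [← Measure.map_apply (continuous_scaleMap x₀ t₀ r θ).measurable hS, Measure.volume_eq_prod,
    h3, ← Measure.map_prod_map _ _ (by fun_prop) (by fun_prop), h1, h2,
    Measure.prod_smul_left, Measure.prod_smul_right]
  simp [Measure.smul_apply]

lemma measurableSet_sublevel {Q : Set (Space n × ℝ)} (hQ : IsOpen Q) {u : Space n × ℝ → ℝ}
    (hu : ContinuousOn u Q) (k : ℝ) : MeasurableSet {z ∈ Q | u z ≤ k} := by
  have h1 : IsOpen (Q ∩ u ⁻¹' Ioi k) := hu.isOpen_inter_preimage hQ isOpen_Ioi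
  have : {z ∈ Q | u z ≤ k} = Q \ (Q ∩ u ⁻¹' Ioi k) := by
    ext z
    simp only [mem_ofPred_eq, Set.mem_sdiff, mem_inter_iff, mem_preimage, mem_Ioi]
    constructor
    · rintro ⟨h, h'⟩
      exact ⟨h, fun h'' => absurd h' (not_le.2 h''.2)⟩
    · rintro ⟨h, h'⟩
      exact ⟨h, not_lt.1 fun h'' => h' ⟨h, h''⟩⟩
  rw [this]
  exact hQ.measurableSet.diff h1.measurableSet

/-- A nonnegative supersolution which is small at one point is bounded on a fixed fraction of the
preceding cylinder. -/
lemma exists_measure_estimate (hp : 2 < p) (hlam : 0 < lam) (hN : 0 ≤ N) :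
    ∃ μ : ℝ, 0 < μ ∧ μ ≤ 1 / 2 ∧ ∀ (u : Space n × ℝ → ℝ) (x : Space n) (t r k : ℝ), 0 < r → 0 < k →
      PosSuper p lam N (Metric.closedBall x r ×ˢ
        Icc (t - k ^ (2 - p) * r ^ p) (t + k ^ (2 - p) * r ^ p)) u →
      (∃ y : Space n, ‖y - x‖ ≤ r / 8 ∧ u (y, t + k ^ (2 - p) * r ^ p) ≤ k) →
      ENNReal.ofReal μ * volume (cyl p (k ^ (2 - p)) r (x, t)) ≤
        volume {z ∈ cyl p (k ^ (2 - p)) r (x, t) | u z ≤ 6 * k} := by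
  obtain ⟨b, hb0, hbt, hb⟩ := exists_measure_bound_unit (n := n) hp hlam hN
  set D := volume (Metric.ball (0 : Space n) 1 ×ˢ Ioo (0 : ℝ) 2) with hD
  have hDt : D ≠ ⊤ := by
    rw [hD, Measure.volume_eq_prod, Measure.prod_prod]
    exact ENNReal.mul_ne_top measure_ball_lt_top.ne (by simp)
  have hDp : D ≠ 0 := by
    rw [hD, Measure.volume_eq_prod, Measure.prod_prod]
    exact mul_ne_zero (Metric.measure_ball_pos volume _ one_pos).ne' (by simp)
  have hbD : 0 < (b / D).toReal :=
    ENNReal.toReal_pos (ENNReal.div_pos hb0 hDt).ne' (ENNReal.div_ne_top hbt hDp)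
  obtain ⟨m, hm0, hm1, hmb⟩ : ∃ m : ℝ, 0 < m ∧ m ≤ 1 / 2 ∧ ENNReal.ofReal m * D ≤ b := by
    refine ⟨min (1 / 2) (b / D).toReal, by positivity, min_le_left _ _, ?_⟩
    calc ENNReal.ofReal (min (1 / 2) (b / D).toReal) * D ≤ ENNReal.ofReal (b / D).toReal * D := by
          gcongr
          exact min_le_right _ _
      _ = b := by
          rw [ENNReal.ofReal_toReal (ENNReal.div_ne_top hbt hDp), ENNReal.div_mul_cancel hDp hDt]
  refine ⟨m, hm0, hm1, ?_⟩
  rintro u x t r k hr hk hu ⟨y, hy, hyk⟩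
  set θ := k ^ (2 - p) * r ^ p with hθ
  have hθ0 : 0 < θ := by positivity
  have hmap : ∀ z, scaleMap x (t - θ) r θ z ∈ cyl p (k ^ (2 - p)) r (x, t) ↔
      z ∈ Metric.ball (0 : Space n) 1 ×ˢ Ioo (0 : ℝ) 2 := by
    rintro ⟨x', t'⟩
    simp only [cyl, scaleMap, mem_prod, mem_ball_iff_norm, mem_Ioo, add_sub_cancel_left, norm_smul,
      Real.norm_of_nonneg hr.le, sub_zero, ← hθ]
    refine and_congr ?_ (and_congr ?_ ?_)
    · rw [mul_lt_iff_lt_one_right hr]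
    · rw [lt_add_iff_pos_right, mul_pos_iff_of_pos_left hθ0]
    · constructor <;> intro h
      · by_contra hc
        have := mul_le_mul_of_nonneg_left (not_lt.1 hc) hθ0.le
        linarith
      · have := mul_lt_mul_of_pos_left h hθ0
        linarith
  have h1 := hb _ (hu.rescale (x₀ := x) (t₀ := t - θ) (Q' := Metric.closedBall 0 1 ×ˢ Icc 0 2)
      hr hk hθ ?_) ⟨r⁻¹ • (y - x), ?_, ?_⟩
  · have hK : volume (scaleMap x (t - θ) r θ ⁻¹' cyl p (k ^ (2 - p)) r (x, t)) = D := by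
      rw [hD]
      congr 1
      ext z
      exact hmap z
    have hS : scaleMap x (t - θ) r θ ⁻¹' {z ∈ cyl p (k ^ (2 - p)) r (x, t) | u z ≤ 6 * k} =
        {z ∈ Metric.ball (0 : Space n) 1 ×ˢ Ioo (0 : ℝ) 2 | u (scaleMap x (t - θ) r θ z) / k ≤ 6} := by
      ext z
      refine and_congr (hmap z) ?_
      rw [div_le_iff₀ hk]
    have hcylo : IsOpen (cyl p (k ^ (2 - p)) r (x, t)) := Metric.isOpen_ball.prod isOpen_Ioo
    have hcyls : cyl p (k ^ (2 - p)) r (x, t) ⊆ Metric.closedBall x r ×ˢ Icc (t - θ) (t + θ) :=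
      prod_mono Metric.ball_subset_closedBall Ioo_subset_Icc_self
    rw [← hS, volume_preimage_scaleMap _ _ hr hθ0
      (measurableSet_sublevel hcylo (hu.cont.mono hcyls) _)] at h1
    rw [volume_preimage_scaleMap _ _ hr hθ0 hcylo.measurableSet] at hK
    have h3 := hmb.trans h1
    have hr' : ENNReal.ofReal (r ^ n)⁻¹ ≠ 0 := (ENNReal.ofReal_pos.2 (by positivity)).ne'
    have hθ' : ENNReal.ofReal θ⁻¹ ≠ 0 := (ENNReal.ofReal_pos.2 (by positivity)).ne'
    rw [← hK, mul_left_comm, ENNReal.mul_le_mul_iff_right hr' ENNReal.ofReal_ne_top, mul_left_comm,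
      ENNReal.mul_le_mul_iff_right hθ' ENNReal.ofReal_ne_top] at h3
    exact h3
  · rintro ⟨x', t'⟩ ⟨hx', ht'⟩
    rw [mem_closedBall_zero_iff] at hx'
    simp only [scaleMap, mem_prod, mem_closedBall_iff_norm, add_sub_cancel_left, norm_smul,
      Real.norm_of_nonneg hr.le, mem_Icc]
    have h3 := mul_nonneg hθ0.le ht'.1
    have h4 := mul_le_mul_of_nonneg_left ht'.2 hθ0.le
    exact ⟨mul_le_of_le_one_right hr.le hx', by linarith, by linarith⟩
  · rw [norm_smul, Real.norm_of_nonneg (by positivity), inv_mul_le_iff₀ hr]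
    linarith
  · simp only [scaleMap, smul_inv_smul₀ hr.ne', add_sub_cancel]
    rw [div_le_one hk, show t - θ + θ * 2 = t + θ by ring]
    exact hyk

end MeasureEstimate

end DegenerateParabolic

end

noncomputable section

namespace DegenerateParabolic

open Filter Topology MeasureTheory
open scoped ENNReal NNReal

/-! ### Growing ink spots with a time delay. -/

section Covering

/-- If every interval `(α, β)` of a family is followed by an interval of `N` times its length
contained in the open set `V`, then the part of the union of the family outside `V` has at most
`1 / N` times the measure of `V`. -/
lemma volume_iUnion_Ioo_diff_le {ι : Type*} {α β : ι → ℝ} {V : Set ℝ} {N : ℝ} (hN : 0 < N)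
    (hV : IsOpen V) (hVb : Bornology.IsBounded V)
    (hF : ∀ i, Ioo (β i) (β i + N * (β i - α i)) ⊆ V) :
    volume ((⋃ i, Ioo (α i) (β i)) \ V) ≤ ENNReal.ofReal N⁻¹ * volume V := by
  -- The interval following `(α i, β i)` lies in one component `C` of `V`, so `β i - α i ≤ |C| / N`.
  -- The part of `(α i, β i)` outside `V` is then within this distance to the left of `inf C`.
  set 𝒞 : Set (Set ℝ) := connectedComponentIn V '' V with h𝒞
  have hsub : ∀ C ∈ 𝒞, C ⊆ V := by
    rintro _ ⟨x, -, rfl⟩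
    exact connectedComponentIn_subset _ _
  have hopen : ∀ C ∈ 𝒞, IsOpen C := by
    rintro _ ⟨x, -, rfl⟩
    exact hV.connectedComponentIn
  have hne : ∀ C ∈ 𝒞, C.Nonempty := by
    rintro _ ⟨x, hx, rfl⟩
    exact ⟨x, mem_connectedComponentIn hx⟩
  have hord : ∀ C ∈ 𝒞, OrdConnected C := by
    rintro _ ⟨x, -, rfl⟩
    exact isPreconnected_connectedComponentIn.ordConnected
  have hdisj : 𝒞.PairwiseDisjoint id := by
    rintro _ ⟨x, -, rfl⟩ _ ⟨y, -, rfl⟩ hxy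
    rw [Function.onFun, id, id, Set.disjoint_left]
    intro z hzx hzy
    exact hxy ((connectedComponentIn_eq hzx).trans (connectedComponentIn_eq hzy).symm)
  have hcount : 𝒞.Countable := hdisj.countable_of_isOpen hopen hne
  have hU : ⋃₀ 𝒞 = V := by
    refine subset_antisymm (sUnion_subset hsub) fun x hx => ?_
    exact ⟨_, ⟨x, hx, rfl⟩, mem_connectedComponentIn hx⟩
  have hfin : ∀ C ∈ 𝒞, volume C ≠ ⊤ := fun C hC =>
    ((hVb.subset (hsub C hC)).measure_lt_top).ne
  have hcov : (⋃ i, Ioo (α i) (β i)) \ V ⊆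
      ⋃ C ∈ 𝒞, Icc (sInf C - N⁻¹ * (volume C).toReal) (sInf C) := by
    rintro s ⟨hs, hsV⟩
    obtain ⟨i, hi⟩ := mem_iUnion.1 hs
    have hlen : 0 < β i - α i := by linarith [hi.1, hi.2]
    have hNl : 0 < N * (β i - α i) := by positivity
    set x := β i + N * (β i - α i) / 2 with hx
    have hxF : x ∈ Ioo (β i) (β i + N * (β i - α i)) := ⟨by linarith, by linarith⟩
    have hFC : Ioo (β i) (β i + N * (β i - α i)) ⊆ connectedComponentIn V x :=
      isPreconnected_Ioo.subset_connectedComponentIn hxF (hF i)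
    set C := connectedComponentIn V x with hC
    have hCm : C ∈ 𝒞 := ⟨x, hF i hxF, rfl⟩
    have hbdd : BddBelow C := (hVb.subset (hsub C hCm)).bddBelow
    have h1 : sInf C ≤ β i := by
      refine le_of_forall_gt fun y hy => ?_
      obtain ⟨w, hw1, hw2⟩ := exists_between (lt_min hy (show β i < x from hxF.1))
      exact (csInf_le hbdd (hFC ⟨hw1, (lt_min_iff.1 hw2).2.trans hxF.2⟩)).trans_lt
        (lt_min_iff.1 hw2).1
    have h2 : s ≤ sInf C := by
      by_contra hcon
      obtain ⟨y, hyC, hys⟩ := exists_lt_of_csInf_lt (hne C hCm) (not_le.1 hcon)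
      exact hsV (hsub C hCm ((hord C hCm).out hyC (hFC hxF) ⟨hys.le, (hi.2.trans hxF.1).le⟩))
    have h3 : N * (β i - α i) ≤ (volume C).toReal := by
      have := ENNReal.toReal_mono (hfin C hCm) (measure_mono hFC)
      rwa [Real.volume_Ioo, ENNReal.toReal_ofReal (by linarith), add_sub_cancel_left] at this
    have h4 : β i - α i ≤ N⁻¹ * (volume C).toReal := by
      rw [le_inv_mul_iff₀ hN]
      exact h3
    exact mem_biUnion hCm ⟨by linarith [hi.1], h2⟩
  calc volume ((⋃ i, Ioo (α i) (β i)) \ V)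
      ≤ volume (⋃ C ∈ 𝒞, Icc (sInf C - N⁻¹ * (volume C).toReal) (sInf C)) := measure_mono hcov
    _ ≤ ∑' C : 𝒞, volume (Icc (sInf C.1 - N⁻¹ * (volume C.1).toReal) (sInf C.1)) :=
        measure_biUnion_le _ hcount _
    _ = ∑' C : 𝒞, ENNReal.ofReal N⁻¹ * volume C.1 := by
        refine tsum_congr fun C => ?_
        rw [Real.volume_Icc, sub_sub_cancel, ENNReal.ofReal_mul (by positivity),
          ENNReal.ofReal_toReal (hfin C.1 C.2)]
    _ = ENNReal.ofReal N⁻¹ * volume V := by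
        rw [ENNReal.tsum_mul_left, ← measure_sUnion hcount hdisj
          (fun C hC => (hopen C hC).measurableSet), hU]

variable {n : ℕ} {p θ : ℝ}

lemma isOpen_cyl (r : ℝ) (z : Space n × ℝ) : IsOpen (cyl p θ r z) :=
  Metric.isOpen_ball.prod isOpen_Ioo

lemma mem_cyl_self (hθ : 0 < θ) {r : ℝ} (hr : 0 < r) (z : Space n × ℝ) : z ∈ cyl p θ r z := by
  have : 0 < θ * r ^ p := by positivity
  exact ⟨Metric.mem_ball_self hr, by linarith, by linarith⟩

lemma volume_cyl {r : ℝ} (hr : 0 < r) (z : Space n × ℝ) :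
    volume (cyl p θ r z) =
      ENNReal.ofReal (r ^ n) * volume (Metric.ball (0 : Space n) 1) *
        ENNReal.ofReal (2 * θ * r ^ p) := by
  have h := Measure.addHaar_ball_mul_of_pos (volume : Measure (Space n)) z.1 hr 1
  rw [mul_one, finrank_euclideanSpace_fin] at h
  rw [cyl, Measure.volume_eq_prod, Measure.prod_prod, Real.volume_Ioo, h]
  congr 2
  ring

lemma volume_cyl_ne_top {r : ℝ} (hr : 0 < r) (z : Space n × ℝ) : volume (cyl p θ r z) ≠ ⊤ := by
  rw [volume_cyl hr]
  exact ENNReal.mul_ne_top (ENNReal.mul_ne_top ENNReal.ofReal_ne_top measure_ball_lt_top.ne)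
    ENNReal.ofReal_ne_top

lemma volume_cyl_five_mul {r : ℝ} (hr : 0 < r) (z : Space n × ℝ) :
    volume (cyl p θ (5 * r) z) = ENNReal.ofReal (5 ^ (n + p)) * volume (cyl p θ r z) := by
  rw [volume_cyl hr, volume_cyl (by positivity), mul_pow, Real.mul_rpow (by norm_num) hr.le,
    Real.rpow_add (by norm_num), Real.rpow_natCast, ENNReal.ofReal_mul (by positivity),
    show 2 * θ * (5 ^ p * r ^ p) = 5 ^ p * (2 * θ * r ^ p) by ring,
    ENNReal.ofReal_mul (p := 5 ^ p) (by positivity),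
    ENNReal.ofReal_mul (p := 5 ^ n) (by positivity)]
  ring

/-- A cylinder of at most twice the size which meets another one lies in its fivefold
enlargement. -/
lemma cyl_subset_enlargement (hp : 2 < p) (hθ : 0 < θ) {r s : ℝ} (hr : 0 < r) (hs : 0 < s)
    (hrs : r ≤ 2 * s) {a b : Space n × ℝ} (h : (cyl p θ r a ∩ cyl p θ s b).Nonempty) :
    cyl p θ r a ⊆ cyl p θ (5 * s) b := by
  obtain ⟨y, ⟨hya, hya'⟩, hyb, hyb'⟩ := h
  rintro z ⟨hza, hza'⟩
  have h5 : θ * s ^ p + 2 * (θ * r ^ p) ≤ θ * (5 * s) ^ p := by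
    have h1 : r ^ p ≤ 2 ^ p * s ^ p := by
      rw [← Real.mul_rpow (by norm_num) hs.le]
      exact Real.rpow_le_rpow hr.le hrs (by linarith)
    have h2 : (5 : ℝ) ^ p = 2.5 ^ p * 2 ^ p := by
      rw [← Real.mul_rpow (by norm_num) (by norm_num)]
      norm_num
    have h3 : (2.5 : ℝ) ^ (2 : ℝ) ≤ 2.5 ^ p :=
      Real.rpow_le_rpow_of_exponent_le (by norm_num) hp.le
    have h4 : (1 : ℝ) ≤ 2 ^ p := Real.one_le_rpow (by norm_num) (by linarith)
    norm_num at h3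
    have h6 : 1 + 2 * (2 : ℝ) ^ p ≤ 5 ^ p := by
      rw [h2]
      nlinarith
    have h7 := mul_le_mul_of_nonneg_right h6 (by positivity : 0 ≤ θ * s ^ p)
    have h8 := mul_le_mul_of_nonneg_left h1 hθ.le
    rw [Real.mul_rpow (by norm_num) hs.le]
    linarith
  refine ⟨?_, ?_, ?_⟩
  · rw [Metric.mem_ball] at *
    have h1 := dist_triangle z.1 a.1 b.1
    have h2 := dist_triangle_left a.1 b.1 y.1
    linarith
  · linarith [hya'.1, hya'.2, hyb'.1, hyb'.2, hza'.1, hza'.2]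
  · linarith [hya'.1, hya'.2, hyb'.1, hyb'.2, hza'.1, hza'.2]

/-- For an open set `E` there is at each of its points a critical dyadic scale for the density
of `E`. -/
lemma exists_critical_scale (hp : 2 < p) (hθ : 0 < θ) {μ r₀ : ℝ} (hμ : 0 < μ) (hr₀ : 0 < r₀)
    {E : Set (Space n × ℝ)} (hE : IsOpen E) {z : Space n × ℝ} (hz : z ∈ E)
    (h0 : volume (E ∩ cyl p θ r₀ z) ≤ ENNReal.ofReal (1 - μ) * volume (cyl p θ r₀ z)) :
    ∃ r, 0 < r ∧ r ≤ r₀ / 2 ∧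
      ENNReal.ofReal (1 - μ) * volume (cyl p θ r z) < volume (E ∩ cyl p θ r z) ∧
      volume (E ∩ cyl p θ (2 * r) z) ≤ ENNReal.ofReal (1 - μ) * volume (cyl p θ (2 * r) z) := by
  have hex : ∃ i : ℕ, ENNReal.ofReal (1 - μ) * volume (cyl p θ (r₀ * (1 / 2) ^ i) z) <
      volume (E ∩ cyl p θ (r₀ * (1 / 2) ^ i) z) := by
    have hlim : Tendsto (fun i : ℕ => r₀ * (1 / 2 : ℝ) ^ i) atTop (𝓝 0) := by
      simpa using (tendsto_pow_atTop_nhds_zero_of_lt_one (r := (1 / 2 : ℝ)) (by norm_num)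
        (by norm_num)).const_mul r₀
    obtain ⟨ε, hε, hεE⟩ := Metric.isOpen_iff.1 hE z hz
    have hlim2 : Tendsto (fun i : ℕ => θ * (r₀ * (1 / 2 : ℝ) ^ i) ^ p) atTop (𝓝 0) := by
      have := (hlim.rpow_const (p := p) (Or.inr (by linarith))).const_mul θ
      rwa [Real.zero_rpow (by linarith), mul_zero] at this
    obtain ⟨i, hi1, hi2⟩ := ((hlim.eventually_lt_const hε).and
      (hlim2.eventually_lt_const hε)).exists
    refine ⟨i, ?_⟩
    set r := r₀ * (1 / 2 : ℝ) ^ i with hr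
    have hr0 : 0 < r := by positivity
    have hsub : cyl p θ r z ⊆ E := by
      rintro y ⟨hy1, hy2⟩
      refine hεE ?_
      rw [Metric.mem_ball, Prod.dist_eq, max_lt_iff]
      refine ⟨(Metric.mem_ball.1 hy1).trans hi1, ?_⟩
      rw [Real.dist_eq, abs_lt]
      constructor <;> linarith [hy2.1, hy2.2]
    rw [inter_eq_self_of_subset_right hsub]
    have hpos : volume (cyl p θ r z) ≠ 0 :=
      ((isOpen_cyl r z).measure_pos volume ⟨z, mem_cyl_self hθ hr0 z⟩).ne'
    conv_rhs => rw [← one_mul (volume (cyl p θ r z))]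
    refine (ENNReal.mul_lt_mul_iff_left hpos (volume_cyl_ne_top hr0 z)).2 ?_
    rw [← ENNReal.ofReal_one]
    exact (ENNReal.ofReal_lt_ofReal_iff one_pos).2 (by linarith)
  classical
  -- The largest dyadic scale at which `E` is dense. By `h0` it is not the initial one, so it has a
  -- predecessor at which `E` is not dense.
  set i := Nat.find hex with hi
  have hi1 := Nat.find_spec hex
  rw [← hi] at hi1
  obtain ⟨j, hj⟩ : ∃ j, i = j + 1 := by
    refine Nat.exists_eq_succ_of_ne_zero fun h => ?_
    rw [h, pow_zero, mul_one] at hi1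
    exact absurd h0 (not_le.2 hi1)
  have hi2 := Nat.find_min hex (m := j) (by omega)
  rw [hj] at hi1
  refine ⟨r₀ * (1 / 2) ^ (j + 1), by positivity, ?_, hi1, ?_⟩
  · rw [pow_succ]
    have : (1 / 2 : ℝ) ^ j ≤ 1 := pow_le_one₀ (by norm_num) (by norm_num)
    have := mul_le_mul_of_nonneg_left this hr₀.le
    linarith
  · rw [show 2 * (r₀ * (1 / 2 : ℝ) ^ (j + 1)) = r₀ * (1 / 2) ^ j by ring]
    exact not_lt.1 hi2

/-- The critical cylinders of `E` cover a set of which `E` fills at most a fixed fraction. -/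
lemma volume_le_of_critical_cover (hp : 2 < p) (hθ : 0 < θ) {μ R : ℝ} (hμ : 0 < μ) (hμ1 : μ ≤ 1)
    {E : Set (Space n × ℝ)} (hE : IsOpen E) {ρ : Space n × ℝ → ℝ} (hρ : ∀ z ∈ E, 0 < ρ z)
    (hρR : ∀ z ∈ E, ρ z ≤ R)
    (hcrit : ∀ z ∈ E, volume (E ∩ cyl p θ (ρ z) z) ≤
      ENNReal.ofReal (1 - μ) * volume (cyl p θ (ρ z) z)) :
    ENNReal.ofReal (μ / 5 ^ (n + p)) * volume (⋃ z ∈ E, cyl p θ (ρ z) z) ≤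
      volume ((⋃ z ∈ E, cyl p θ (ρ z) z) \ E) := by
  obtain ⟨v, hvE, hvd, hvc⟩ := Vitali.exists_disjoint_subfamily_covering_enlargement
    (fun z => cyl p θ (ρ z) z) E ρ 2 (by norm_num) (fun z hz => (hρ z hz).le) R hρR
    (fun z hz => ⟨z, mem_cyl_self hθ (hρ z hz) z⟩)
  have hvcount : v.Countable := hvd.countable_of_isOpen (fun z _ => isOpen_cyl _ _)
    (fun z hz => ⟨z, mem_cyl_self hθ (hρ z (hvE hz)) z⟩)
  have hsub : (⋃ z ∈ E, cyl p θ (ρ z) z) ⊆ ⋃ z ∈ v, cyl p θ (5 * ρ z) z := by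
    refine iUnion₂_subset fun a ha => ?_
    obtain ⟨b, hb, hab, hr⟩ := hvc a ha
    exact (cyl_subset_enlargement hp hθ (hρ a ha) (hρ b (hvE hb)) hr hab).trans
      (subset_biUnion_of_mem (u := fun z => cyl p θ (5 * ρ z) z) hb)
  have hpt : ∀ z ∈ E, ENNReal.ofReal μ * volume (cyl p θ (ρ z) z) ≤
      volume (cyl p θ (ρ z) z \ E) := by
    intro z hz
    have h1 := measure_inter_add_sdiff (μ := volume) (cyl p θ (ρ z) z) hE.measurableSet
    have h2 := hcrit z hz
    have hfin := volume_cyl_ne_top (p := p) (θ := θ) (hρ z hz) z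
    have h3 : volume (cyl p θ (ρ z) z) = ENNReal.ofReal (1 - μ) * volume (cyl p θ (ρ z) z)
        + ENNReal.ofReal μ * volume (cyl p θ (ρ z) z) := by
      rw [← add_mul, ← ENNReal.ofReal_add (by linarith) hμ.le, sub_add_cancel, ENNReal.ofReal_one,
        one_mul]
    rw [inter_comm] at h1
    have h4 : ENNReal.ofReal (1 - μ) * volume (cyl p θ (ρ z) z)
        + ENNReal.ofReal μ * volume (cyl p θ (ρ z) z) ≤
        ENNReal.ofReal (1 - μ) * volume (cyl p θ (ρ z) z) + volume (cyl p θ (ρ z) z \ E) := by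
      rw [← h3]
      calc volume (cyl p θ (ρ z) z)
          = volume (E ∩ cyl p θ (ρ z) z) + volume (cyl p θ (ρ z) z \ E) := h1.symm
        _ ≤ _ := by gcongr
    exact (ENNReal.add_le_add_iff_left (ENNReal.mul_ne_top ENNReal.ofReal_ne_top hfin)).1 h4
  have h5 : (0 : ℝ) < 5 ^ (n + p) := by positivity
  calc ENNReal.ofReal (μ / 5 ^ (n + p)) * volume (⋃ z ∈ E, cyl p θ (ρ z) z)
      ≤ ENNReal.ofReal (μ / 5 ^ (n + p)) * ∑' z : v, volume (cyl p θ (5 * ρ z) z.1) := by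
        gcongr
        exact (measure_mono hsub).trans (measure_biUnion_le _ hvcount _)
    _ = ∑' z : v, ENNReal.ofReal μ * volume (cyl p θ (ρ z) z.1) := by
        rw [← ENNReal.tsum_mul_left]
        refine tsum_congr fun z => ?_
        rw [volume_cyl_five_mul (hρ z (hvE z.2)), ← mul_assoc, ← ENNReal.ofReal_mul (by positivity),
          div_mul_cancel₀ _ h5.ne']
    _ ≤ ∑' z : v, volume (cyl p θ (ρ z) z.1 \ E) := by
        exact ENNReal.tsum_le_tsum fun z => hpt z (hvE z.2)
    _ = volume (⋃ z ∈ v, cyl p θ (ρ z) z \ E) := by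
        rw [measure_biUnion hvcount]
        · exact fun a ha b hb hab => (hvd ha hb hab).mono sdiff_subset sdiff_subset
        · exact fun z _ => (isOpen_cyl _ _).measurableSet.diff hE.measurableSet
    _ ≤ volume ((⋃ z ∈ E, cyl p θ (ρ z) z) \ E) := by
        refine measure_mono (iUnion₂_subset fun z hz => ?_)
        exact sdiff_subset_sdiff_left
          (subset_biUnion_of_mem (u := fun z => cyl p θ (ρ z) z) (hvE hz))

/-- The space-time version of the interval lemma. -/
lemma volume_cover_diff_le {E G : Set (Space n × ℝ)} {ρ ℓ : Space n × ℝ → ℝ} {N : ℝ} (hN : 0 < N)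
    (hG : IsOpen G) (hGb : Bornology.IsBounded G)
    (h : ∀ z ∈ E, Metric.ball z.1 (ρ z) ×ˢ Ioo (z.2 + ℓ z) (z.2 + ℓ z + N * (2 * ℓ z)) ⊆ G) :
    volume ((⋃ z ∈ E, Metric.ball z.1 (ρ z) ×ˢ Ioo (z.2 - ℓ z) (z.2 + ℓ z)) \ G) ≤
      ENNReal.ofReal N⁻¹ * volume G := by
  have hWo : IsOpen (⋃ z ∈ E, Metric.ball z.1 (ρ z) ×ˢ Ioo (z.2 - ℓ z) (z.2 + ℓ z)) :=
    isOpen_biUnion fun z _ => Metric.isOpen_ball.prod isOpen_Ioo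
  rw [Measure.volume_eq_prod, Measure.prod_apply (hWo.measurableSet.diff hG.measurableSet),
    Measure.prod_apply hG.measurableSet, ← lintegral_const_mul' _ _ ENNReal.ofReal_ne_top]
  refine lintegral_mono fun x => ?_
  have hslice : Prod.mk x ⁻¹' ((⋃ z ∈ E, Metric.ball z.1 (ρ z) ×ˢ Ioo (z.2 - ℓ z) (z.2 + ℓ z)) \ G) =
      (⋃ z : {z : Space n × ℝ // z ∈ E ∧ x ∈ Metric.ball z.1 (ρ z)},
        Ioo (z.1.2 - ℓ z) (z.1.2 + ℓ z)) \ (Prod.mk x ⁻¹' G) := by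
    ext t
    simp only [mem_preimage, Set.mem_sdiff, mem_iUnion, mem_prod, Subtype.exists, exists_prop]
    refine and_congr_left fun _ => exists_congr fun z => ?_
    tauto
  rw [hslice]
  refine volume_iUnion_Ioo_diff_le hN (hG.preimage (by fun_prop)) ?_ ?_
  · refine (hGb.image_snd).subset ?_
    intro t ht
    exact ⟨(x, t), ht, rfl⟩
  · rintro ⟨z, hz, hx⟩ t ht
    refine h z hz ⟨hx, ht.1, ?_⟩
    have := ht.2
    simp only at this
    linarith

/-- The growing ink spots lemma, with a time delay. -/
lemma volume_le_of_ink_spots (hp : 2 < p) (hθ : 0 < θ) {μ r₀ H c : ℝ} (hμ : 0 < μ) (hμ1 : μ ≤ 1)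
    (hr₀ : 0 < r₀) (hH : 2 ^ p ≤ H) (hc : c = μ / 5 ^ (n + p)) {E G : Set (Space n × ℝ)}
    (hE : IsOpen E) (hG : IsOpen G) (hGb : Bornology.IsBounded G)
    (h0 : ∀ z ∈ E, volume (E ∩ cyl p θ r₀ z) ≤ ENNReal.ofReal (1 - μ) * volume (cyl p θ r₀ z))
    (h : ∀ z ∈ E, ∀ r, 0 < r → r ≤ r₀ / 2 →
      ENNReal.ofReal (1 - μ) * volume (cyl p θ r z) < volume (E ∩ cyl p θ r z) →
      Metric.ball z.1 (2 * r) ×ˢ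
        Ioo (z.2 + H * (θ * r ^ p)) (z.2 + (1 + 2 / c) * (H * (θ * r ^ p))) ⊆ G) :
    volume E ≤ ENNReal.ofReal (1 - c ^ 2) * volume G := by
  have hex : ∀ z : Space n × ℝ, ∃ r : ℝ, z ∈ E → 0 < r ∧ r ≤ r₀ / 2 ∧
      ENNReal.ofReal (1 - μ) * volume (cyl p θ r z) < volume (E ∩ cyl p θ r z) ∧
      volume (E ∩ cyl p θ (2 * r) z) ≤ ENNReal.ofReal (1 - μ) * volume (cyl p θ (2 * r) z) := by
    intro z
    by_cases hz : z ∈ E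
    · obtain ⟨r, hr⟩ := exists_critical_scale hp hθ hμ hr₀ hE hz (h0 z hz)
      exact ⟨r, fun _ => hr⟩
    · exact ⟨0, fun h => absurd h hz⟩
  choose r hr using hex
  have h51 : (1 : ℝ) ≤ 5 ^ (n + p) := Real.one_le_rpow (by norm_num) (by positivity)
  have hc0 : 0 < c := by rw [hc]; positivity
  have hc1 : c ≤ 1 := by
    rw [hc]
    exact div_le_one_of_le₀ (hμ1.trans h51) (by positivity)
  -- `E` fills at most the fraction `1 - c` of `W`, and `W` exceeds `G` by at most `c |G|`. The loss
  -- through the time delay is thus beaten: `(1 - c)(1 + c) = 1 - c²`.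
  set W := ⋃ z ∈ E, cyl p θ (2 * r z) z with hW
  have hWm : MeasurableSet W := (isOpen_biUnion fun z _ => isOpen_cyl _ _).measurableSet
  have hEW : E ⊆ W := fun z hz =>
    mem_biUnion hz (mem_cyl_self hθ (by linarith [(hr z hz).1]) z)
  have h1 : ENNReal.ofReal c * volume W ≤ volume (W \ E) := by
    rw [hc]
    exact volume_le_of_critical_cover hp hθ (R := r₀) hμ hμ1 hE
      (fun z hz => by linarith [(hr z hz).1]) (fun z hz => by linarith [(hr z hz).2.1])
      (fun z hz => (hr z hz).2.2.2)
  have h2 : volume (W \ G) ≤ ENNReal.ofReal c * volume G := by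
    -- Each cylinder is first widened in time to half-length `H θ r^p`; the stack following it, of
    -- length `(2/c) H θ r^p`, is then `1/c` times as long.
    have := volume_cover_diff_le (E := E) (ρ := fun z => 2 * r z)
      (ℓ := fun z => H * (θ * r z ^ p)) (N := 1 / c) (by positivity) hG hGb ?_
    · rw [one_div, inv_inv] at this
      refine (measure_mono (sdiff_subset_sdiff_left ?_)).trans this
      refine iUnion₂_mono fun z hz => prod_mono le_rfl (Ioo_subset_Ioo ?_ ?_)
      all_goals
        have hr0 := (hr z hz).1
        have h3 : θ * (2 * r z) ^ p ≤ H * (θ * r z ^ p) := by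
          rw [Real.mul_rpow (by norm_num) hr0.le, mul_left_comm]
          gcongr
        linarith
    · intro z hz
      obtain ⟨hr0, hr1, hr2, -⟩ := hr z hz
      refine subset_trans (prod_mono le_rfl (Ioo_subset_Ioo le_rfl (le_of_eq ?_)))
        (h z hz (r z) hr0 hr1 hr2)
      ring
  have hGf : volume G ≠ ⊤ := hGb.measure_lt_top.ne
  have h3 : volume W ≤ ENNReal.ofReal (1 + c) * volume G := by
    calc volume W ≤ volume (W \ G) + volume G := by
          rw [add_comm]
          exact (measure_mono (by rw [union_sdiff_self]; exact subset_union_right)).trans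
            (measure_union_le G (W \ G))
      _ ≤ ENNReal.ofReal c * volume G + volume G := by gcongr
      _ = _ := by
          rw [add_comm 1 c, ENNReal.ofReal_add hc0.le zero_le_one, ENNReal.ofReal_one, add_mul,
            one_mul]
  have hWf : volume W ≠ ⊤ := (h3.trans_lt (ENNReal.mul_lt_top ENNReal.ofReal_lt_top
    hGf.lt_top)).ne
  have hEf : volume E ≠ ⊤ := ne_top_of_le_ne_top hWf (measure_mono hEW)
  have h4 : volume E ≤ ENNReal.ofReal (1 - c) * volume W := by
    have h5 : volume E + volume (W \ E) = volume W := by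
      rw [measure_add_sdiff hE.measurableSet.nullMeasurableSet, union_eq_self_of_subset_left hEW]
    have h6 : volume W = ENNReal.ofReal (1 - c) * volume W + ENNReal.ofReal c * volume W := by
      rw [← add_mul, ← ENNReal.ofReal_add (by linarith) hc0.le, sub_add_cancel, ENNReal.ofReal_one,
        one_mul]
    have h7 : volume E + ENNReal.ofReal c * volume W ≤
        ENNReal.ofReal (1 - c) * volume W + ENNReal.ofReal c * volume W := by
      rw [← h6]
      calc _ ≤ volume E + volume (W \ E) := by gcongr
        _ = _ := h5
    exact (ENNReal.add_le_add_iff_right (ENNReal.mul_ne_top ENNReal.ofReal_ne_top hWf)).1 h7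
  calc volume E ≤ ENNReal.ofReal (1 - c) * (ENNReal.ofReal (1 + c) * volume G) :=
        h4.trans (by gcongr)
    _ = ENNReal.ofReal (1 - c ^ 2) * volume G := by
        rw [← mul_assoc, ← ENNReal.ofReal_mul (by linarith)]
        congr 2
        ring

end Covering

end DegenerateParabolic

end

noncomputable section

namespace DegenerateParabolic

open Filter Topology MeasureTheory
open scoped ENNReal NNReal

/-! ### From positive measure to a ball. -/

section MeasureToPoint

variable {n : ℕ} {p lam N : ℝ}

/-- The contrapositive form of `exists_measure_estimate`: a value at most `k` at the final time
would give `{u ≤ 6k}` density at least `μ`, leaving no room for `E`. -/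
lemma exists_dense_imp_pos (hp : 2 < p) (hlam : 0 < lam) (hN : 0 ≤ N) :
    ∃ μ : ℝ, 0 < μ ∧ μ ≤ 1 / 2 ∧ ∀ (u : Space n × ℝ → ℝ) (x : Space n) (t r k : ℝ)
      (E : Set (Space n × ℝ)), 0 < r → 0 < k →
      PosSuper p lam N (Metric.closedBall x r ×ˢ
        Icc (t - k ^ (2 - p) * r ^ p) (t + k ^ (2 - p) * r ^ p)) u →
      (∀ z ∈ E, 6 * k < u z) →
      ENNReal.ofReal (1 - μ) * volume (cyl p (k ^ (2 - p)) r (x, t)) <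
        volume (E ∩ cyl p (k ^ (2 - p)) r (x, t)) →
      ∀ y ∈ Metric.closedBall x (r / 8), k < u (y, t + k ^ (2 - p) * r ^ p) := by
  obtain ⟨μ, hμ, hμ2, hest⟩ := exists_measure_estimate (n := n) hp hlam hN
  refine ⟨μ, hμ, hμ2, fun u x t r k E hr hk hu hE hdense y hy => ?_⟩
  by_contra hcon
  have h1 := hest u x t r k hr hk hu ⟨y, mem_closedBall_iff_norm.1 hy, not_lt.1 hcon⟩
  set K := cyl p (k ^ (2 - p)) r (x, t) with hK
  have hKs : K ⊆ Metric.closedBall x r ×ˢ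
      Icc (t - k ^ (2 - p) * r ^ p) (t + k ^ (2 - p) * r ^ p) :=
    prod_mono Metric.ball_subset_closedBall Ioo_subset_Icc_self
  have hm : MeasurableSet {z ∈ K | u z ≤ 6 * k} :=
    measurableSet_sublevel (isOpen_cyl _ _) (hu.cont.mono hKs) _
  have hd : Disjoint (E ∩ K) {z ∈ K | u z ≤ 6 * k} := by
    rw [Set.disjoint_left]
    rintro z ⟨hz, -⟩ ⟨-, hz'⟩
    exact absurd (hE z hz) (not_lt.2 hz')
  have hKf : volume K ≠ ⊤ := volume_cyl_ne_top hr _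
  have h2 : volume (E ∩ K) + volume {z ∈ K | u z ≤ 6 * k} ≤ volume K := by
    rw [← measure_union hd hm]
    exact measure_mono (union_subset inter_subset_right (sep_subset _ _))
  have h3 : volume K = ENNReal.ofReal (1 - μ) * volume K + ENNReal.ofReal μ * volume K := by
    rw [← add_mul, ← ENNReal.ofReal_add (by linarith) hμ.le, sub_add_cancel, ENNReal.ofReal_one,
      one_mul]
  refine absurd h2 (not_le.2 ?_)
  calc volume K = ENNReal.ofReal (1 - μ) * volume K + ENNReal.ofReal μ * volume K := h3
    _ < volume (E ∩ K) + volume {z ∈ K | u z ≤ 6 * k} :=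
      ENNReal.add_lt_add_of_lt_of_le (ENNReal.mul_ne_top ENNReal.ofReal_ne_top hKf) hdense h1

/-- Positivity on a small ball spreads to the stacked cylinders which follow it. -/
lemma exists_spreading_stack (hp : 2 < p) (hlam : 0 < lam) (hN : 0 ≤ N) {m : ℝ} (hm : 1 < m) :
    ∃ H Γ η : ℝ, 2 ^ p ≤ H ∧ 0 < Γ ∧ 0 < η ∧ η < 1 ∧
      ∀ (u : Space n × ℝ → ℝ) (x : Space n) (t r k : ℝ), 0 < r → 0 < k → Γ * r ≤ 1 →
      PosSuper p lam N (Metric.closedBall x 1 ×ˢ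
        Icc (t + k ^ (2 - p) * r ^ p) (t + m * (H * (k ^ (2 - p) * r ^ p)))) u →
      (∀ y ∈ Metric.closedBall x (r / 8), k ≤ u (y, t + k ^ (2 - p) * r ^ p)) →
      ∀ z ∈ Metric.ball x (2 * r) ×ˢ Ioo (t + H * (k ^ (2 - p) * r ^ p))
        (t + m * (H * (k ^ (2 - p) * r ^ p))), 6 * (η * k) < u z := by
  obtain ⟨a, β, κ₀, ha, hβ, -, hκ₀, hκ₀1, -, hspread⟩ := exists_spreading (n := n) hp hlam hN
  -- The delay with `32^(1/β)` gives `X^β ≥ 32`, so spreading from radius `r/8` covers radius `2r`;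
  -- the term `2^p` is required by `volume_le_of_ink_spots`.
  set H : ℝ := 2 ^ p + 32 ^ (1 / β) with hH
  have h2p : (1 : ℝ) ≤ 2 ^ p := Real.one_le_rpow (by norm_num) (by linarith)
  have h32 : (0 : ℝ) < 32 ^ (1 / β) := by positivity
  have hH0 : 0 < H := by positivity
  set X₁ : ℝ := 1 + 8 ^ p * (m * H) with hX₁
  have hX₁0 : 1 < X₁ := by
    have : 0 < 8 ^ p * (m * H) := by positivity
    linarith
  have hX₁a : X₁ ^ (-a) ≤ 1 := Real.rpow_le_one_of_one_le_of_nonpos hX₁0.le (by linarith)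
  refine ⟨H, X₁ ^ β / 8, κ₀ * X₁ ^ (-a) / 12, by linarith, by positivity, by positivity, ?_, ?_⟩
  · have : κ₀ * X₁ ^ (-a) ≤ 1 * 1 := by gcongr
    linarith
  rintro u x t r k hr hk hΓ hu hk' ⟨y, t'⟩ ⟨hy, ht'⟩
  set θ := k ^ (2 - p) * r ^ p with hθ
  have hθ0 : 0 < θ := by positivity
  simp only at hy ht'
  have hHθ : θ ≤ H * θ := le_mul_of_one_le_left hθ0.le (by linarith)
  set X := 1 + (t' - (t + θ)) / (k ^ (2 - p) * (r / 8) ^ p) with hX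
  have hXeq : X = 1 + 8 ^ p * ((t' - (t + θ)) / θ) := by
    rw [hX, Real.div_rpow hr.le (by norm_num), hθ]
    field_simp
  have hq0 : 0 ≤ (t' - (t + θ)) / θ := div_nonneg (by linarith [ht'.1]) hθ0.le
  have hXX₁ : X ≤ X₁ := by
    rw [hXeq, hX₁]
    gcongr
    rw [div_le_iff₀ hθ0]
    linarith [ht'.2]
  have h8 : (1 : ℝ) ≤ 8 ^ p := Real.one_le_rpow (by norm_num) (by linarith)
  have hXl : 32 ^ (1 / β) ≤ X := by
    have h1 : 32 ^ (1 / β) ≤ (t' - (t + θ)) / θ := by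
      rw [le_div_iff₀ hθ0]
      have h2 : H * θ = 2 ^ p * θ + 32 ^ (1 / β) * θ := by rw [hH]; ring
      have h3 := mul_le_mul_of_nonneg_right h2p hθ0.le
      linarith [ht'.1]
    rw [hXeq]
    nlinarith
  have hX1 : 1 ≤ X := by
    rw [hXeq]
    have : 0 ≤ 8 ^ p * ((t' - (t + θ)) / θ) := by positivity
    linarith
  have hXβ : 32 ≤ X ^ β := by
    calc (32 : ℝ) = (32 ^ (1 / β)) ^ β := by
          rw [← Real.rpow_mul (by norm_num), one_div_mul_cancel hβ.ne', Real.rpow_one]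
      _ ≤ X ^ β := Real.rpow_le_rpow (by positivity) hXl hβ.le
  have h1 := hspread u x (t + θ) t' (r / 8) k 1 (by positivity) hk (by linarith [ht'.1])
    (hu.mono (prod_mono le_rfl (Icc_subset_Icc le_rfl ht'.2.le))) hk' ?_ y ?_
  · refine lt_of_lt_of_le ?_ h1
    have h2 : X₁ ^ (-a) ≤ X ^ (-a) :=
      Real.rpow_le_rpow_of_nonpos (by linarith) hXX₁ (by linarith)
    calc 6 * (κ₀ * X₁ ^ (-a) / 12 * k) < κ₀ * k * X₁ ^ (-a) := by
          have : 0 < κ₀ * k * X₁ ^ (-a) := by positivity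
          linarith
      _ ≤ _ := by gcongr
  · refine le_trans ?_ hΓ
    have : X ^ β ≤ X₁ ^ β := Real.rpow_le_rpow (by linarith) hXX₁ hβ.le
    calc r / 8 * X ^ β ≤ r / 8 * X₁ ^ β := by gcongr
      _ = _ := by ring
  · rw [mem_ball_iff_norm] at hy
    have : r / 8 * 32 ≤ r / 8 * X ^ β := by gcongr
    linarith

/-- A supersolution which is large on a set of positive measure is bounded below on a small ball at
some later time. -/
lemma exists_measure_to_point (hp : 2 < p) (hlam : 0 < lam) (hN : 0 ≤ N) {τ₀ μ₀ : ℝ}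
    (hμ₀ : 0 < μ₀) :
    ∃ r₁ η₁ : ℝ, 0 < r₁ ∧ r₁ ≤ 1 ∧ 0 < η₁ ∧ ∀ u : Space n × ℝ → ℝ,
      PosSuper p lam N (Metric.closedBall 0 4 ×ˢ Icc (-1) (τ₀ + 2)) u →
      ENNReal.ofReal μ₀ ≤ volume {z ∈ Metric.ball (0 : Space n) 1 ×ˢ Ioo 0 τ₀ | 1 < u z} →
      ∃ (y : Space n) (s : ℝ), ‖y‖ ≤ 2 ∧ 0 ≤ s ∧ s ≤ τ₀ + 2 ∧
        ∀ x ∈ Metric.closedBall y r₁, η₁ ≤ u (x, s) := by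
  obtain ⟨μ, hμ, hμ2, hdense⟩ := exists_dense_imp_pos (n := n) hp hlam hN
  set c := μ / 5 ^ (n + p) with hc
  have hc0 : 0 < c := by positivity
  have hc1 : c < 1 := by
    rw [hc, div_lt_one (by positivity)]
    have : (1 : ℝ) ≤ 5 ^ (n + p) := Real.one_le_rpow (by norm_num) (by positivity)
    linarith
  set m := 1 + 2 / c with hm
  have hm1 : 1 < m := by
    have : 0 < 2 / c := by positivity
    linarith
  obtain ⟨H, Γ, η, hH, hΓ, hη, hη1, hstack⟩ := exists_spreading_stack (n := n) hp hlam hN hm1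
  have hH1 : 1 ≤ H := (Real.one_le_rpow (by norm_num) (by linarith)).trans hH
  set Q := Metric.ball (0 : Space n) 2 ×ˢ Ioo 0 (τ₀ + 1) with hQ
  have hQb : Bornology.IsBounded Q := Metric.isBounded_ball.prod (Metric.isBounded_Ioo _ _)
  have hQf : volume Q ≠ ⊤ := hQb.measure_lt_top.ne
  have hc2 : 0 ≤ 1 - c ^ 2 := by nlinarith
  obtain ⟨J, hJ⟩ : ∃ J : ℕ, (1 - c ^ 2) ^ J * (volume Q).toReal < μ₀ := by
    have h1 := (tendsto_pow_atTop_nhds_zero_of_lt_one hc2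
      (by nlinarith : 1 - c ^ 2 < 1)).mul_const (volume Q).toReal
    rw [zero_mul] at h1
    exact (h1.eventually_lt_const hμ₀).exists
  -- Normalized so that `6 * k 0 = 1`, the level in the hypothesis.
  set k : ℕ → ℝ := fun j => η ^ j / 6 with hk
  have hk0 : ∀ j, 0 < k j := fun j => by positivity
  have hkJ : ∀ j ≤ J, k J ≤ k j := by
    intro j hj
    simp only [hk]
    gcongr ?_ / 6
    exact pow_le_pow_of_le_one hη.le hη1.le hj
  set θ : ℕ → ℝ := fun j => k j ^ (2 - p) with hθ
  have hθ0 : ∀ j, 0 < θ j := fun j => by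
    simp only [hθ]
    exact Real.rpow_pos_of_pos (hk0 j) _
  have hθJ : ∀ j ≤ J, θ j ≤ θ J := fun j hj =>
    Real.rpow_le_rpow_of_nonpos (hk0 J) (hkJ j hj) (by linarith)
  -- The domain grows by `2r₀` in radius and by `δ` in time at each step; `r₀` is so small that `J`
  -- steps stay inside `Q`.
  obtain ⟨r₀, hr₀, hr₀J, hr₀δ, hr₀Γ⟩ : ∃ r₀ : ℝ, 0 < r₀ ∧ 2 * (J + 1) * r₀ ≤ 1 ∧
      (J + 1) * (m * (H * (θ J * r₀ ^ p))) ≤ 1 ∧ Γ * r₀ ≤ 1 := by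
    have hev : ∀ f : ℝ → ℝ, Continuous f → f 0 = 0 → ∀ᶠ r in 𝓝[>] (0 : ℝ), f r ≤ 1 := by
      intro f hf hf0
      refine Eventually.filter_mono nhdsWithin_le_nhds ?_
      have : f 0 < 1 := by rw [hf0]; norm_num
      exact (hf.continuousAt.eventually_lt_const this).mono fun _ h => h.le
    have hcp : Continuous fun r : ℝ => r ^ p := Real.continuous_rpow_const (by linarith)
    obtain ⟨r, h1, h2, h3, h4⟩ := ((hev (fun r => 2 * (J + 1) * r) (by fun_prop) (by simp)).and
      ((hev (fun r => (J + 1) * (m * (H * (θ J * r ^ p)))) (by fun_prop)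
        (by simp [Real.zero_rpow (by linarith : p ≠ 0)])).and
      ((hev (fun r => Γ * r) (by fun_prop) (by simp)).and self_mem_nhdsWithin))).exists
    exact ⟨r, h4, h1, h2, h3⟩
  set δ := m * (H * (θ J * r₀ ^ p)) with hδ
  have hr₀p : 0 < r₀ ^ p := by positivity
  have hδ0 : 0 < δ := mul_pos (by linarith) (mul_pos (by linarith) (mul_pos (hθ0 J) hr₀p))
  have hJ0 : (0 : ℝ) ≤ J := Nat.cast_nonneg J
  have hr₀1 : r₀ ≤ 1 / 2 := by nlinarith
  have hδ1 : δ ≤ 1 := by nlinarith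
  have hstep : ∀ j ≤ J, ∀ r, 0 < r → r ≤ r₀ → θ j * r ^ p ≤ θ J * r₀ ^ p := by
    intro j hj r hr hrr
    have h1 : r ^ p ≤ r₀ ^ p := Real.rpow_le_rpow hr.le hrr (by linarith)
    have h2 := hθJ j hj
    have h3 := hθ0 J
    gcongr
  have hstepδ : ∀ j ≤ J, ∀ r, 0 < r → r ≤ r₀ → m * (H * (θ j * r ^ p)) ≤ δ := by
    intro j hj r hr hrr
    have := hstep j hj r hr hrr
    rw [hδ]
    gcongr
  have hmH : ∀ y, 0 ≤ y → y ≤ m * (H * y) := by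
    intro y hy
    have h1 := le_mul_of_one_le_left hy hH1
    exact h1.trans (le_mul_of_one_le_left (hy.trans h1) hm1.le)
  have hstep1 : ∀ j ≤ J, ∀ r, 0 < r → r ≤ r₀ → θ j * r ^ p ≤ 1 := by
    intro j hj r hr hrr
    have h1 : 0 ≤ θ j * r ^ p := mul_nonneg (hθ0 j).le (by positivity)
    linarith [hmH _ h1, hstepδ j hj r hr hrr]
  refine ⟨r₀ / 8, k J, by positivity, by linarith, hk0 J, fun u hu hvol => ?_⟩
  set E : ℕ → Set (Space n × ℝ) := fun j =>
    {z ∈ Metric.ball (0 : Space n) (1 + 2 * j * r₀) ×ˢ Ioo 0 (τ₀ + j * δ) | 6 * k j < u z} with hE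
  have hEsub : ∀ j ≤ J, E j ⊆ Q := by
    rintro j hj z ⟨⟨hz1, hz2, hz3⟩, -⟩
    have hj' : (j : ℝ) ≤ J := by exact_mod_cast hj
    refine ⟨Metric.ball_subset_ball ?_ hz1, hz2, hz3.trans_le ?_⟩
    · nlinarith
    · nlinarith
  have hEo : ∀ j ≤ J, IsOpen (E j) := by
    intro j hj
    have hj' : (j : ℝ) ≤ J := by exact_mod_cast hj
    refine ContinuousOn.isOpen_inter_preimage (t := Ioi (6 * k j)) (hu.cont.mono ?_)
      (Metric.isOpen_ball.prod isOpen_Ioo) isOpen_Ioi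
    refine prod_mono ((Metric.ball_subset_ball ?_).trans Metric.ball_subset_closedBall)
      (Ioo_subset_Icc_self.trans (Icc_subset_Icc (by norm_num) ?_))
    · nlinarith
    · nlinarith
  have hbounds : ∀ j ≤ J, ∀ z ∈ E j, ‖z.1‖ < 2 ∧ 0 < z.2 ∧ z.2 < τ₀ + 1 := by
    intro j hj z hz
    obtain ⟨h1, h2, h3⟩ := hEsub j hj hz
    exact ⟨mem_ball_zero_iff.1 h1, h2, h3⟩
  have hball : ∀ x : Space n, ‖x‖ < 2 → Metric.closedBall x 1 ⊆ Metric.closedBall 0 4 := by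
    intro x hx
    refine Metric.closedBall_subset_closedBall' ?_
    rw [dist_zero_right]
    linarith
  have hpos : ∀ j ≤ J, ∀ z ∈ E j, ∀ r, 0 < r → r ≤ r₀ →
      ENNReal.ofReal (1 - μ) * volume (cyl p (θ j) r z) < volume (E j ∩ cyl p (θ j) r z) →
      ∀ y ∈ Metric.closedBall z.1 (r / 8), k j < u (y, z.2 + θ j * r ^ p) := by
    intro j hj z hz r hr hrr hd
    obtain ⟨hz1, hz2, hz3⟩ := hbounds j hj z hz
    have h1 := hstep1 j hj r hr hrr
    refine hdense u z.1 z.2 r (k j) (E j) hr (hk0 j) (hu.mono ?_) (fun y hy => hy.2) hd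
    exact prod_mono ((Metric.closedBall_subset_closedBall (by linarith)).trans (hball _ hz1))
      (Icc_subset_Icc (by linarith) (by linarith))
  -- If some level set is dense at scale `r₀`, the desired ball is found. Otherwise each of `J` ink
  -- spots steps multiplies the measure by at least `1/(1 - c²)`, and it would exceed that of `Q`.
  by_cases hcase : ∃ j ≤ J, ∃ z ∈ E j,
      ENNReal.ofReal (1 - μ) * volume (cyl p (θ j) r₀ z) < volume (E j ∩ cyl p (θ j) r₀ z)
  · obtain ⟨j, hj, z, hz, hd⟩ := hcase
    obtain ⟨hz1, hz2, hz3⟩ := hbounds j hj z hz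
    have h1 := hstep1 j hj r₀ hr₀ le_rfl
    have h2 : 0 < θ j * r₀ ^ p := mul_pos (hθ0 j) hr₀p
    refine ⟨z.1, z.2 + θ j * r₀ ^ p, hz1.le, by linarith, by linarith, fun x hx => ?_⟩
    exact (hkJ j hj).trans (hpos j hj z hz r₀ hr₀ le_rfl hd x hx).le
  · exfalso
    push Not at hcase
    have hgrow : ∀ j < J, volume (E j) ≤ ENNReal.ofReal (1 - c ^ 2) * volume (E (j + 1)) := by
      intro j hj
      refine volume_le_of_ink_spots hp (hθ0 j) hμ (by linarith) hr₀ hH hc (hEo j hj.le)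
        (hEo (j + 1) hj) (hQb.subset (hEsub (j + 1) hj)) (hcase j hj.le) ?_
      intro z hz r hr hrr hd
      obtain ⟨hz1, hz2, hz3⟩ := hbounds j hj.le z hz
      have hrr₀ : r ≤ r₀ := by linarith
      have h1 := hpos j hj.le z hz r hr hrr₀ hd
      have h2 := hstepδ j hj.le r hr hrr₀
      have h3 : 0 < θ j * r ^ p := mul_pos (hθ0 j) (by positivity)
      have h4 := hstack u z.1 z.2 r (k j) hr (hk0 j) ?_ (hu.mono ?_) (fun y hy => (h1 y hy).le)
      · intro y hy
        have h5 := h4 y hy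
        refine ⟨⟨?_, ?_, ?_⟩, ?_⟩
        · have h6 := hy.1
          have h7 := hz.1.1
          rw [Metric.mem_ball] at h6
          rw [mem_ball_zero_iff] at h7 ⊢
          rw [dist_eq_norm] at h6
          have h8 : ‖y.1‖ ≤ ‖y.1 - z.1‖ + ‖z.1‖ := by simpa using norm_add_le (y.1 - z.1) z.1
          push_cast
          linarith
        · have h6 : 0 < H * (θ j * r ^ p) := by positivity
          linarith [hy.2.1]
        · push_cast
          linarith [hy.2.2, hz.1.2.2]
        · have : 6 * k (j + 1) = 6 * (η * k j) := by
            simp only [hk, pow_succ]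
            ring
          rw [this]
          exact h5
      · exact (mul_le_mul_of_nonneg_left hrr₀ hΓ.le).trans hr₀Γ
      · exact prod_mono (hball _ hz1) (Icc_subset_Icc (by linarith) (by linarith))
    have hiter : ∀ j ≤ J, volume (E 0) ≤ ENNReal.ofReal ((1 - c ^ 2) ^ j) * volume (E j) := by
      intro j
      induction j with
      | zero => intro _; simp
      | succ j ih =>
        intro hj
        calc volume (E 0) ≤ ENNReal.ofReal ((1 - c ^ 2) ^ j) * volume (E j) := ih (by omega)
          _ ≤ ENNReal.ofReal ((1 - c ^ 2) ^ j)
              * (ENNReal.ofReal (1 - c ^ 2) * volume (E (j + 1))) := by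
            gcongr
            exact hgrow j (by omega)
          _ = _ := by rw [← mul_assoc, ← ENNReal.ofReal_mul (by positivity), ← pow_succ]
    have h0 : {z ∈ Metric.ball (0 : Space n) 1 ×ˢ Ioo 0 τ₀ | 1 < u z} = E 0 := by
      simp [hE, hk]
    rw [h0] at hvol
    have h1 := hvol.trans ((hiter J le_rfl).trans
      (mul_le_mul_right (measure_mono (hEsub J le_rfl)) _))
    rw [← ENNReal.ofReal_toReal hQf, ← ENNReal.ofReal_mul (by positivity),
      ENNReal.ofReal_le_ofReal_iff (by positivity)] at h1
    linarith

end MeasureToPoint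

end DegenerateParabolic

end

noncomputable section

namespace DegenerateParabolic

open Filter Topology MeasureTheory
open scoped ENNReal NNReal

/-! ### The normalized forward Harnack inequality. -/

section Forward

variable {n : ℕ} {p lam N : ℝ}

/-- Spreading from a small ball of radius `r` on which the solution is at least of order
`r ^ (-γ)`. -/
lemma exists_spreading_large (hp : 2 < p) (hlam : 0 < lam) (hN : 0 ≤ N) :
    ∃ γ B κ : ℝ, 0 < γ ∧ 0 < B ∧ 0 < κ ∧ ∀ (v : Space n × ℝ → ℝ) (y : Space n) (s t r k : ℝ),
      0 < r → r ≤ 1 → 1 / 2 ≤ t - s → t - s ≤ 4 →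
      PosSuper p lam N (Metric.closedBall y (5 / 2) ×ˢ Icc s t) v →
      (∀ x ∈ Metric.closedBall y r, k ≤ v (x, s)) → B * r ^ (-γ) ≤ k →
      ∀ x, ‖x - y‖ ≤ 5 / 4 → κ ≤ v (x, t) := by
  obtain ⟨a, β, κ₀, ha, hβ, hβ10, hκ₀, -, hrel, hspread⟩ := exists_spreading (n := n) hp hlam hN
  -- Reaching unit size from radius `r` requires `X` comparable to `r^(-1/β)` and costs the factor
  -- `X^(-a)`, of order `r^γ`.
  set γ := a / β with hγ
  set A : ℝ := (5 / 2) ^ p with hA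
  have hA0 : 0 < A := by positivity
  have hp2 : 0 < p - 2 := by linarith
  refine ⟨γ, (2 * A) ^ (1 / (p - 2)) * (5 / 2) ^ γ, κ₀ * (A / 8) ^ (1 / (p - 2)), by positivity,
    by positivity, by positivity, ?_⟩
  intro v y s t r k hr hr1 hst1 hst4 hv hk hkB x hx
  set L := 5 / 2 / r with hL
  have hL0 : 0 < L := by positivity
  have hL52 : 5 / 2 ≤ L := by
    rw [hL, le_div_iff₀ hr]
    linarith
  set X := L ^ (1 / β) with hX
  have hX0 : 0 < X := by positivity
  have hX2 : 2 ≤ X := by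
    have h1 : 1 ≤ 1 / β := by
      rw [le_div_iff₀ hβ]
      linarith
    calc 2 ≤ L := by linarith
      _ = L ^ (1 : ℝ) := (Real.rpow_one _).symm
      _ ≤ _ := Real.rpow_le_rpow_of_exponent_le (by linarith) h1
  have hrL : r = 5 / 2 / L := by rw [hL]; field_simp
  have hXr : X * r ^ p = A * (L ^ γ) ^ (p - 2) := by
    rw [hrL, Real.div_rpow (by norm_num) hL0.le, ← Real.rpow_mul hL0.le, hX, ← hA]
    have : 1 / β = γ * (p - 2) + p := by
      rw [hγ]
      field_simp
      linarith
    rw [this, Real.rpow_add hL0]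
    field_simp
  -- The height for which the spreading radius is exactly `5/2` at time `t`. A larger height may be
  -- lowered to it.
  set k' := ((X - 1) * r ^ p / (t - s)) ^ (1 / (p - 2)) with hk'
  have hts : 0 < t - s := by linarith
  have hk'0 : 0 < k' := by
    have : 0 < X - 1 := by linarith
    positivity
  have hrp : 0 < r ^ p := by positivity
  have hroot : ∀ D : ℝ, 0 < D →
      (D * (A * (L ^ γ) ^ (p - 2))) ^ (1 / (p - 2)) = (D * A) ^ (1 / (p - 2)) * L ^ γ := by
    intro D hD
    rw [← mul_assoc, Real.mul_rpow (by positivity) (by positivity), ← Real.rpow_mul (by positivity),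
      mul_one_div_cancel hp2.ne', Real.rpow_one]
  have hk'le : k' ≤ (2 * A) ^ (1 / (p - 2)) * L ^ γ := by
    rw [← hroot 2 (by norm_num), ← hXr, hk']
    refine Real.rpow_le_rpow ?_ ?_ (by positivity)
    · exact div_nonneg (mul_nonneg (by linarith) hrp.le) hts.le
    · rw [div_le_iff₀ hts]
      have h1 : 0 < X * r ^ p := by positivity
      nlinarith
  have hk'ge : (A / 8) ^ (1 / (p - 2)) * L ^ γ ≤ k' := by
    rw [show A / 8 = 1 / 8 * A by ring, ← hroot (1 / 8) (by norm_num), ← hXr, hk']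
    refine Real.rpow_le_rpow (by positivity) ?_ (by positivity)
    rw [le_div_iff₀ hts]
    have h1 : 0 < X * r ^ p := by positivity
    have h2 : X / 2 * r ^ p ≤ (X - 1) * r ^ p := by
      gcongr
      linarith
    nlinarith
  have hk'k : k' ≤ k := by
    refine hk'le.trans (le_trans (le_of_eq ?_) hkB)
    rw [hL, Real.div_rpow (by norm_num) hr.le, Real.rpow_neg hr.le]
    ring
  have hXeq : 1 + (t - s) / (k' ^ (2 - p) * r ^ p) = X := by
    have h1 : k' ^ (2 - p) = (t - s) / ((X - 1) * r ^ p) := by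
      have h2 : 0 ≤ (X - 1) * r ^ p / (t - s) :=
        div_nonneg (mul_nonneg (by linarith) hrp.le) hts.le
      rw [hk', ← Real.rpow_mul h2, show 1 / (p - 2) * (2 - p) = -1 by field_simp; ring,
        Real.rpow_neg_one, inv_div]
    have hX1 : X - 1 ≠ 0 := by linarith
    rw [h1]
    field_simp
    ring
  have hXβ : X ^ β = L := by
    rw [hX, ← Real.rpow_mul hL0.le, one_div_mul_cancel hβ.ne', Real.rpow_one]
  have hrLe : r * L = 5 / 2 := by rw [hL]; field_simp
  have h1 := hspread v y s t r k' (5 / 2) hr hk'0 (by linarith) hv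
    (fun x hx => hk'k.trans (hk x hx)) (by rw [hXeq, hXβ, hrLe]) x
    (by rw [hXeq, hXβ, hrLe]; linarith)
  rw [hXeq] at h1
  refine le_trans ?_ h1
  have h2 : X ^ (-a) = (L ^ γ)⁻¹ := by
    rw [hX, ← Real.rpow_mul hL0.le, ← Real.rpow_neg hL0.le, hγ]
    congr 1
    ring
  rw [h2]
  have hLγ : 0 < L ^ γ := by positivity
  calc κ₀ * (A / 8) ^ (1 / (p - 2)) = κ₀ * ((A / 8) ^ (1 / (p - 2)) * L ^ γ) * (L ^ γ)⁻¹ := by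
        field_simp
    _ ≤ κ₀ * k' * (L ^ γ)⁻¹ := by gcongr

lemma scaleMap_mem_prod_iff (x₀ : Space n) (t₀ : ℝ) {r θ τ : ℝ} (hr : 0 < r) (hθ : 0 < θ)
    (z : Space n × ℝ) :
    scaleMap x₀ t₀ r θ z ∈ Metric.ball x₀ r ×ˢ Ioo t₀ (t₀ + θ * τ) ↔
      z ∈ Metric.ball (0 : Space n) 1 ×ˢ Ioo 0 τ := by
  simp only [scaleMap, mem_prod, mem_ball_iff_norm, mem_Ioo, add_sub_cancel_left, norm_smul,
    Real.norm_of_nonneg hr.le, sub_zero]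
  refine and_congr ?_ (and_congr ?_ ?_)
  · rw [mul_lt_iff_lt_one_right hr]
  · rw [lt_add_iff_pos_right, mul_pos_iff_of_pos_left hθ]
  · rw [add_lt_add_iff_left, mul_lt_mul_iff_right₀ hθ]

/-- A point where `v` is nearly maximal at its scale. -/
lemma exists_scaled_max {γ : ℝ} (hγ : 0 < γ) {b ε : ℝ} (hb : 0 < b) (hε1 : ε < 1)
    {v : Space n × ℝ → ℝ} (hv : ContinuousOn v (Metric.closedBall 0 b ×ˢ Icc (-b) 0))
    (hv0 : ∀ z ∈ Metric.closedBall (0 : Space n) b ×ˢ Icc (-b) 0, 0 ≤ v z)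
    {M : ℝ} (hM : 0 < M) (hMv : M ≤ v (0, 0)) :
    ∃ (x : Space n) (t r : ℝ), ‖x‖ ≤ b ∧ -b ≤ t ∧ t ≤ 0 ∧ 0 < r ∧ r ≤ b ∧ M ≤ v (x, t) ∧
      M * b ^ γ * r ^ (-γ) ≤ v (x, t) ∧
      ∀ z : Space n × ℝ, ‖z.1 - x‖ ≤ ε * r → t - ε * r ≤ z.2 → z.2 ≤ t →
        z ∈ Metric.closedBall (0 : Space n) b ×ˢ Icc (-b) 0 ∧ v z * (1 - ε) ^ γ ≤ v (x, t) := by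
  set S := Metric.closedBall (0 : Space n) b ×ˢ Icc (-b) (0 : ℝ) with hS
  -- The distance to the lateral and initial boundary. At a maximum of `v ω^γ`, comparison with the
  -- origin gives the size `r^(-γ)`, and comparison with neighbours gives near-maximality at scale
  -- `r = ω`.
  set ω : Space n × ℝ → ℝ := fun z => b - max ‖z.1‖ (-z.2) with hω
  have hωc : Continuous ω := by fun_prop
  have hfc : ContinuousOn (fun z => v z * ω z ^ γ) S :=
    hv.mul (hωc.continuousOn.rpow_const fun _ _ => Or.inr hγ.le)
  have h0S : ((0 : Space n), (0 : ℝ)) ∈ S := ⟨by simp [hb.le], by simp [hb.le]⟩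
  obtain ⟨⟨x, t⟩, hz, hmax⟩ := ((isCompact_closedBall (0 : Space n) b).prod
    (isCompact_Icc (a := -b) (b := (0 : ℝ)))).exists_isMaxOn ⟨_, h0S⟩ hfc
  have h0 := hmax h0S
  simp only [mem_ofPred_eq] at h0
  have hω0 : ω (0, 0) = b := by simp [hω]
  rw [hω0] at h0
  set r := ω (x, t) with hr
  have hx : ‖x‖ ≤ b := by simpa using hz.1
  have ht1 : -b ≤ t := hz.2.1
  have ht2 : t ≤ 0 := hz.2.2
  have hr0' : 0 ≤ r := by
    simp only [hr, hω, sub_nonneg, max_le_iff]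
    exact ⟨hx, by linarith⟩
  have hMb : 0 < M * b ^ γ := by positivity
  have h1 : M * b ^ γ ≤ v (x, t) * r ^ γ := le_trans (by gcongr) h0
  have hr0 : 0 < r := by
    refine lt_of_le_of_ne hr0' fun h => ?_
    rw [← h, Real.zero_rpow hγ.ne', mul_zero] at h1
    linarith
  have hrb : r ≤ b := by
    simp only [hr, hω, sub_le_self_iff]
    exact (norm_nonneg _).trans (le_max_left _ _)
  have hvz := hv0 _ hz
  have hrγ : 0 < r ^ γ := by positivity
  have hbγ : 0 < b ^ γ := by positivity
  refine ⟨x, t, r, hx, ht1, ht2, hr0, hrb, ?_, ?_, ?_⟩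
  · have h2 : r ^ γ ≤ b ^ γ := Real.rpow_le_rpow hr0' hrb hγ.le
    have h3 : M * b ^ γ ≤ v (x, t) * b ^ γ := h1.trans (by gcongr)
    exact le_of_mul_le_mul_right h3 hbγ
  · rw [Real.rpow_neg hr0', ← div_eq_mul_inv, div_le_iff₀ hrγ]
    exact h1
  · rintro ⟨x', t'⟩ hx' ht1' ht2'
    simp only at hx' ht1' ht2'
    have hle : max ‖x'‖ (-t') ≤ max ‖x‖ (-t) + ε * r := by
      refine max_le ?_ ?_
      · have h2 : ‖x'‖ ≤ ‖x' - x‖ + ‖x‖ := by simpa using norm_add_le (x' - x) x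
        linarith [le_max_left ‖x‖ (-t)]
      · linarith [le_max_right ‖x‖ (-t)]
    have hω' : (1 - ε) * r ≤ ω (x', t') := by
      have h2 : r = b - max ‖x‖ (-t) := rfl
      simp only [hω]
      linarith
    have hpos : 0 < (1 - ε) * r := mul_pos (by linarith) hr0
    have hmem : (x', t') ∈ S := by
      have h2 : max ‖x'‖ (-t') ≤ b := by
        simp only [hω] at hω'
        linarith
      rw [max_le_iff] at h2
      exact ⟨by simpa using h2.1, by linarith [h2.2], by linarith⟩
    refine ⟨hmem, ?_⟩
    have h2 := hmax hmem
    simp only [mem_ofPred_eq] at h2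
    have h3 : ((1 - ε) * r) ^ γ ≤ ω (x', t') ^ γ := Real.rpow_le_rpow hpos.le hω' hγ.le
    rw [Real.mul_rpow (by linarith) hr0'] at h3
    have h4 : v (x', t') * (1 - ε) ^ γ * r ^ γ ≤ v (x, t) * r ^ γ := by
      rw [mul_assoc]
      exact (mul_le_mul_of_nonneg_left h3 (hv0 _ hmem)).trans h2
    exact le_of_mul_le_mul_right h4 hrγ

/-- A solution which is large at one point is large on a small ball nearby, of order `r ^ (-γ)`
where `r` is comparable with the radius of the ball. -/
lemma exists_large_ball (hp : 2 < p) (hlam : 0 < lam) (hN : 0 ≤ N) {γ : ℝ} (hγ : 0 < γ) :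
    ∃ ν η : ℝ, 0 < ν ∧ ν ≤ 1 ∧ 0 < η ∧ ∀ (v : Space n × ℝ → ℝ) (M : ℝ),
      PosSuper p lam N (Metric.closedBall 0 1 ×ˢ Icc (-(1 / 2)) (1 / 2)) v →
      (∀ c, ∀ z ∈ Metric.closedBall (0 : Space n) 1 ×ˢ Icc (-(1 / 2) : ℝ) (1 / 2),
        SuperAt p lam N (fun y => c - v y) z) →
      10 ≤ M → M ≤ v (0, 0) →
      ∃ (y : Space n) (s r : ℝ), ‖y‖ ≤ 1 / 8 ∧ -(1 / 2) ≤ s ∧ s ≤ 1 / 2 ∧ 0 < r ∧ r ≤ 1 ∧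
        ∀ x ∈ Metric.closedBall y (ν * r), η * M * r ^ (-γ) ≤ v (x, s) := by
  obtain ⟨μ, hμ, -, hest⟩ := exists_measure_estimate (n := n) hp hlam hN
  -- The duration `2θ` of the cylinder belonging to the height `m/10`, in units of the intrinsic
  -- time `T` of the height `m/4`; it does not depend on `m`.
  set τ₀ : ℝ := 2 * 0.4 ^ (2 - p) with hτ₀
  have hτ₀0 : 0 < τ₀ := by positivity
  set D := volume (Metric.ball (0 : Space n) 1 ×ˢ Ioo (0 : ℝ) τ₀) with hD
  have hDf : D ≠ ⊤ := (Metric.isBounded_ball.prod (Metric.isBounded_Ioo _ _)).measure_lt_top.ne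
  have hD0 : 0 < D.toReal := ENNReal.toReal_pos ((Metric.isOpen_ball.prod isOpen_Ioo).measure_pos
    volume ⟨(0, τ₀ / 2), by simp, by constructor <;> simp only <;> linarith⟩).ne' hDf
  obtain ⟨r₁, η₁, hr₁, hr₁1, hη₁, hpoint⟩ := exists_measure_to_point (n := n) hp hlam hN
    (τ₀ := τ₀) (mul_pos hμ hD0)
  obtain ⟨ε, hε, hε2, hεγ⟩ : ∃ ε : ℝ, 0 < ε ∧ ε ≤ 1 / 2 ∧ 1 / 1.1 ≤ (1 - ε) ^ γ := by
    have h1 : Tendsto (fun ε : ℝ => (1 - ε) ^ γ) (𝓝[>] 0) (𝓝 1) := by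
      have h2 : Continuous fun ε : ℝ => (1 - ε) ^ γ :=
        Continuous.rpow_const (by fun_prop) fun _ => Or.inr hγ.le
      have h3 := h2.tendsto 0
      simp only [sub_zero, Real.one_rpow] at h3
      exact h3.mono_left nhdsWithin_le_nhds
    obtain ⟨ε, h2, h3, h4⟩ := ((h1.eventually_const_le (by norm_num : (1 / 1.1 : ℝ) < 1)).and
      ((Ioo_mem_nhdsGT (by norm_num : (0 : ℝ) < 1 / 2)))).exists
    exact ⟨ε, h3, h4.le, h2⟩
  set b : ℝ := 1 / 32 with hb
  refine ⟨r₁ * ε, η₁ * b ^ γ / 4, by positivity, by nlinarith, by positivity, ?_⟩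
  intro v M hv hsub hM10 hMv
  have hSD : Metric.closedBall (0 : Space n) b ×ˢ Icc (-b) (0 : ℝ) ⊆
      Metric.closedBall (0 : Space n) 1 ×ˢ Icc (-(1 / 2)) (1 / 2) :=
    prod_mono (Metric.closedBall_subset_closedBall (by norm_num [hb]))
      (Icc_subset_Icc (by norm_num [hb]) (by norm_num))
  obtain ⟨x, t, r, hx, ht1, ht2, hr, hrb, hMm, hmr, hup⟩ := exists_scaled_max hγ
    (by norm_num [hb] : 0 < b) (ε := ε) (by linarith) (hv.cont.mono hSD)
    (fun z hz => hv.nonneg z (hSD hz)) (by linarith) hMv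
  set m := v (x, t) with hm
  have hm10 : 10 ≤ m := hM10.trans hMm
  set R := ε * r with hR
  have hR0 : 0 < R := by positivity
  have hRr : R ≤ r / 2 := by rw [hR]; nlinarith
  have hR64 : R ≤ 1 / 64 := by rw [hb] at hrb; linarith
  have hRp : R ^ p ≤ R / 64 := by
    calc R ^ p ≤ R ^ (2 : ℝ) := Real.rpow_le_rpow_of_exponent_ge hR0 (by linarith) hp.le
      _ = R * R := by rw [Real.rpow_two]; ring
      _ ≤ R * (1 / 64) := by gcongr
      _ = R / 64 := by ring
  have hRp0 : 0 < R ^ p := by positivity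
  set θ := (m / 10) ^ (2 - p) * R ^ p with hθ
  set T := (m / 4) ^ (2 - p) * R ^ p with hT
  have hθ0 : 0 < θ := by positivity
  have hT0 : 0 < T := by positivity
  have hsmall : ∀ k : ℝ, 1 ≤ k → k ^ (2 - p) * R ^ p ≤ R / 64 := by
    intro k hk
    have h1 : k ^ (2 - p) ≤ 1 := Real.rpow_le_one_of_one_le_of_nonpos hk (by linarith)
    exact (mul_le_of_le_one_left hRp0.le h1).trans hRp
  have hθR : θ ≤ R / 64 := hsmall _ (by linarith)
  have hTR : T ≤ R / 64 := hsmall _ (by linarith)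
  have hθT : T * τ₀ = 2 * θ := by
    rw [hθ, hT, hτ₀, show m / 10 = m / 4 * 0.4 by ring,
      Real.mul_rpow (x := m / 4) (y := 0.4) (by positivity) (by norm_num)]
    ring
  -- the solution is large on a fraction of a cylinder
  have hw : PosSuper p lam N (Metric.closedBall x R ×ˢ Icc (t - θ - θ) (t - θ + θ))
      (fun y => 1.1 * m - v y) := by
    have hmem : ∀ z ∈ Metric.closedBall x R ×ˢ Icc (t - θ - θ) (t - θ + θ),
        z ∈ Metric.closedBall (0 : Space n) b ×ˢ Icc (-b) (0 : ℝ) ∧ v z * (1 - ε) ^ γ ≤ m := by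
      intro z hz
      exact hup z (mem_closedBall_iff_norm.1 hz.1) (by linarith [hz.2.1]) (by linarith [hz.2.2])
    refine ⟨?_, ?_, ?_⟩
    · exact continuousOn_const.sub (hv.cont.mono fun z hz => hSD (hmem z hz).1)
    · intro z hz
      obtain ⟨h1, h2⟩ := hmem z hz
      have h3 := mul_le_mul_of_nonneg_left hεγ (hv.nonneg z (hSD h1))
      have h4 := h3.trans h2
      rw [mul_one_div, div_le_iff₀ (by norm_num)] at h4
      linarith
    · exact fun z hz => hsub _ z (hSD (hmem z hz).1)
  -- The supersolution `1.1 m - v` equals `m/10` at `(x, t)`. On a fixed fraction it is at most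
  -- `6m/10`, and there `v ≥ m/2 > m/4`.
  have hmeas := hest _ x (t - θ) R (m / 10) hR0 (by positivity) hw
    ⟨x, by rw [sub_self, norm_zero]; positivity, by simp only [← hθ, sub_add_cancel, ← hm]; linarith⟩
  have hcyl : cyl p ((m / 10) ^ (2 - p)) R (x, t - θ) =
      Metric.ball x R ×ˢ Ioo (t - 2 * θ) (t - 2 * θ + T * τ₀) := by
    rw [hθT, cyl, ← hθ]
    congr 2 <;> ring
  have hxR : ‖x‖ + 4 * R ≤ 1 / 8 := by rw [hb] at hx hrb; linarith
  have hu' : PosSuper p lam N (Metric.closedBall 0 4 ×ˢ Icc (-1) (τ₀ + 2))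
      (fun z => v (scaleMap x (t - 2 * θ) R T z) / (m / 4)) := by
    refine hv.rescale hR0 (by positivity) hT ?_
    rintro ⟨x', t'⟩ ⟨hx', ht'⟩
    rw [mem_closedBall_zero_iff] at hx'
    simp only at hx' ht'
    refine ⟨?_, ?_, ?_⟩
    · rw [mem_closedBall_zero_iff]
      simp only [scaleMap]
      calc ‖x + R • x'‖ ≤ ‖x‖ + R * ‖x'‖ := by
            refine (norm_add_le _ _).trans ?_
            rw [norm_smul, Real.norm_of_nonneg hR0.le]
        _ ≤ ‖x‖ + R * 4 := by gcongr
        _ ≤ 1 := by linarith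
    · simp only [scaleMap]
      have := mul_le_mul_of_nonneg_left ht'.1 hT0.le
      rw [hb] at ht1
      linarith
    · simp only [scaleMap]
      have := mul_le_mul_of_nonneg_left ht'.2 hT0.le
      linarith
  have hvol : ENNReal.ofReal (μ * D.toReal) ≤ volume {z ∈ Metric.ball (0 : Space n) 1 ×ˢ Ioo 0 τ₀ |
      1 < v (scaleMap x (t - 2 * θ) R T z) / (m / 4)} := by
    have hopen := isOpen_cyl (p := p) (θ := (m / 10) ^ (2 - p)) R (x, t - θ)
    have hS := measurableSet_sublevel hopen (hw.cont.mono
      (prod_mono Metric.ball_subset_closedBall Ioo_subset_Icc_self)) (6 * (m / 10))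
    have hpre : scaleMap x (t - 2 * θ) R T ⁻¹' cyl p ((m / 10) ^ (2 - p)) R (x, t - θ) =
        Metric.ball (0 : Space n) 1 ×ˢ Ioo 0 τ₀ := by
      rw [hcyl]
      ext z
      exact scaleMap_mem_prod_iff x _ hR0 hT0 z
    have h1 := volume_preimage_scaleMap x (t - 2 * θ) hR0 hT0 hopen.measurableSet
    rw [hpre, ← hD] at h1
    rw [ENNReal.ofReal_mul hμ.le, ENNReal.ofReal_toReal hDf, h1, mul_left_comm,
      mul_left_comm (ENNReal.ofReal μ)]
    calc _ ≤ ENNReal.ofReal (R ^ n)⁻¹ * (ENNReal.ofReal T⁻¹ *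
          volume {z ∈ cyl p ((m / 10) ^ (2 - p)) R (x, t - θ) | 1.1 * m - v z ≤ 6 * (m / 10)}) := by
          gcongr
      _ = volume (scaleMap x (t - 2 * θ) R T ⁻¹'
          {z ∈ cyl p ((m / 10) ^ (2 - p)) R (x, t - θ) | 1.1 * m - v z ≤ 6 * (m / 10)}) :=
          (volume_preimage_scaleMap x (t - 2 * θ) hR0 hT0 hS).symm
      _ ≤ _ := by
          refine measure_mono ?_
          rintro z ⟨hz1, hz2⟩
          refine ⟨hpre ▸ hz1, ?_⟩
          rw [lt_div_iff₀ (by positivity)]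
          linarith
  obtain ⟨y', s', hy', hs'0, hs', hlow⟩ := hpoint _ hu' hvol
  refine ⟨x + R • y', t - 2 * θ + T * s', r, ?_, ?_, ?_, hr, ?_, ?_⟩
  · calc ‖x + R • y'‖ ≤ ‖x‖ + R * ‖y'‖ := by
          refine (norm_add_le _ _).trans ?_
          rw [norm_smul, Real.norm_of_nonneg hR0.le]
      _ ≤ ‖x‖ + R * 2 := by gcongr
      _ ≤ 1 / 8 := by linarith
  · have := mul_nonneg hT0.le hs'0
    rw [hb] at ht1
    linarith
  · have := mul_le_mul_of_nonneg_left hs' hT0.le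
    linarith
  · rw [hb] at hrb
    linarith
  · intro z hz
    have h1 := hlow (R⁻¹ • (z - x)) ?_
    · have h2 : scaleMap x (t - 2 * θ) R T (R⁻¹ • (z - x), s') = (z, t - 2 * θ + T * s') := by
        simp only [scaleMap, smul_inv_smul₀ hR0.ne', add_sub_cancel]
      simp only [h2] at h1
      rw [le_div_iff₀ (by positivity)] at h1
      refine le_trans ?_ h1
      calc η₁ * b ^ γ / 4 * M * r ^ (-γ) = η₁ / 4 * (M * b ^ γ * r ^ (-γ)) := by ring
        _ ≤ η₁ / 4 * m := by gcongr
        _ = η₁ * (m / 4) := by ring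
    · rw [mem_closedBall_iff_norm] at hz ⊢
      have h2 : R⁻¹ • (z - x) - y' = R⁻¹ • (z - (x + R • y')) := by
        rw [← sub_sub, smul_sub R⁻¹ (z - x), inv_smul_smul₀ hR0.ne']
      rw [h2, norm_smul, Real.norm_of_nonneg (by positivity), inv_mul_le_iff₀ hR0]
      refine hz.trans (le_of_eq ?_)
      rw [hR]
      ring

/-- The forward Harnack inequality in normalized form. -/
lemma exists_forward_harnack_unit (hp : 2 < p) (hlam : 0 < lam) (hN : 0 ≤ N) :
    ∃ M κ : ℝ, 0 < M ∧ 0 < κ ∧ ∀ (v : Space n × ℝ → ℝ) (t : ℝ), 1 ≤ t → t ≤ 2 →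
      PosSuper p lam N (Metric.closedBall 0 3 ×ˢ Icc (-1) t) v →
      (∀ c, ∀ z ∈ Metric.closedBall (0 : Space n) 3 ×ˢ Icc (-1) t,
        SuperAt p lam N (fun y => c - v y) z) →
      M ≤ v (0, 0) → ∀ x : Space n, ‖x‖ ≤ 1 → κ ≤ v (x, t) := by
  obtain ⟨γ, B, κ, hγ, hB, hκ, hspread⟩ := exists_spreading_large (n := n) hp hlam hN
  obtain ⟨ν, η, hν, hν1, hη, hlarge⟩ := exists_large_ball (n := n) hp hlam hN hγ
  -- The second term gives the ball of radius `νr` the height `B (νr)^(-γ)` required for spreading.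
  refine ⟨max 10 (B * ν ^ (-γ) / η), κ, by positivity, hκ, ?_⟩
  intro v t ht1 ht2 hv hsub hM x hx
  have hD : Metric.closedBall (0 : Space n) 1 ×ˢ Icc (-(1 / 2)) (1 / 2) ⊆
      Metric.closedBall (0 : Space n) 3 ×ˢ Icc (-1) t :=
    prod_mono (Metric.closedBall_subset_closedBall (by norm_num))
      (Icc_subset_Icc (by norm_num) (by linarith))
  obtain ⟨y, s, r, hy, hs1, hs2, hr, hr1, hlow⟩ := hlarge v _ (hv.mono hD)
    (fun c z hz => hsub c z (hD hz)) (le_max_left _ _) hM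
  refine hspread v y s t (ν * r) _ (by positivity) (mul_le_one₀ hν1 hr.le hr1) (by linarith)
    (by linarith) (hv.mono ?_) hlow ?_ x ?_
  · refine prod_mono (Metric.closedBall_subset_closedBall' ?_) (Icc_subset_Icc (by linarith) le_rfl)
    rw [dist_zero_right]
    linarith
  · rw [Real.mul_rpow hν.le hr.le, ← mul_assoc]
    have h1 := le_max_right 10 (B * ν ^ (-γ) / η)
    rw [div_le_iff₀ hη] at h1
    exact mul_le_mul_of_nonneg_right (by linarith) (by positivity)
  · exact (norm_sub_le _ _).trans (by linarith)

end Forward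

end DegenerateParabolic

end

noncomputable section

namespace DegenerateParabolic

open Filter Topology

/-! ### The forward inequality in intrinsic scaling, and intermediate values. -/

section Harnack

variable {n : ℕ} {p lam N : ℝ}

/-- The forward Harnack inequality. -/
lemma exists_forward_harnack (hp : 2 < p) (hlam : 0 < lam) (hN : 0 ≤ N) :
    ∃ M κ : ℝ, 0 < M ∧ 0 < κ ∧ ∀ (u : Space n × ℝ → ℝ) (x y : Space n) (t t₁ ρ θ : ℝ),
      0 < ρ → 0 < u (x, t) → θ = (M / u (x, t)) ^ (p - 2) * ρ ^ p → t + θ ≤ t₁ → t₁ ≤ t + 2 * θ →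
      PosSuper p lam N (Metric.closedBall x (3 * ρ) ×ˢ Icc (t - θ) t₁) u →
      (∀ c, ∀ z ∈ Metric.closedBall x (3 * ρ) ×ˢ Icc (t - θ) t₁,
        SuperAt p lam N (fun y => c - u y) z) →
      ‖y - x‖ ≤ ρ → κ * u (x, t) ≤ u (y, t₁) := by
  obtain ⟨M, κ, hM, hκ, hunit⟩ := exists_forward_harnack_unit (n := n) hp hlam hN
  refine ⟨M, κ / M, hM, by positivity, ?_⟩
  intro u x y t t₁ ρ θ hρ hm hθ ht1 ht2 hu hsub hy
  set m := u (x, t) with hmdef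
  set k := m / M with hk
  have hk0 : 0 < k := by positivity
  have hθk : θ = k ^ (2 - p) * ρ ^ p := by
    rw [hθ, ← inv_div m M, Real.inv_rpow (by positivity), ← Real.rpow_neg (by positivity), neg_sub]
  have hθ0 : 0 < θ := by rw [hθk]; positivity
  have hmap : ∀ z ∈ Metric.closedBall (0 : Space n) 3 ×ˢ Icc (-1) ((t₁ - t) / θ),
      scaleMap x t ρ θ z ∈ Metric.closedBall x (3 * ρ) ×ˢ Icc (t - θ) t₁ := by
    rintro ⟨x', t'⟩ ⟨hx', ht'⟩
    rw [mem_closedBall_zero_iff] at hx'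
    simp only at hx' ht'
    refine ⟨?_, ?_, ?_⟩
    · rw [mem_closedBall_iff_norm]
      simp only [scaleMap, add_sub_cancel_left, norm_smul, Real.norm_of_nonneg hρ.le]
      rw [mul_comm 3]
      gcongr
    · have := mul_le_mul_of_nonneg_left ht'.1 hθ0.le
      simp only [scaleMap]
      linarith
    · have := ht'.2
      rw [le_div_iff₀ hθ0] at this
      simp only [scaleMap]
      linarith
  have hscale : ∀ x' : Space n,
      scaleMap x t ρ θ (ρ⁻¹ • (x' - x), (t₁ - t) / θ) = (x', t₁) := by
    intro x'
    simp only [scaleMap, smul_inv_smul₀ hρ.ne', add_sub_cancel, mul_div_cancel₀ _ hθ0.ne']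
  have h1 := hunit (fun z => u (scaleMap x t ρ θ z) / k) ((t₁ - t) / θ)
    (by rw [le_div_iff₀ hθ0]; linarith) (by rw [div_le_iff₀ hθ0]; linarith)
    (hu.rescale hρ hk0 hθk hmap) ?_ ?_ (ρ⁻¹ • (y - x)) ?_
  · simp only [hscale, le_div_iff₀ hk0] at h1
    refine le_trans (le_of_eq ?_) h1
    rw [hk]
    ring
  · intro c z hz
    have h2 := SuperAt.rescale hρ hk0 hθk (hsub (c * k) _ (hmap z hz))
    convert h2 using 2 with y
    field_simp
  · have h2 : scaleMap x t ρ θ ((0 : Space n), (0 : ℝ)) = (x, t) := by simp [scaleMap]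
    simp only [h2, ← hmdef, hk]
    rw [div_div_cancel₀ hm.ne']
  · rw [norm_smul, Real.norm_of_nonneg (by positivity), inv_mul_le_iff₀ hρ, mul_one]
    exact hy

/-- Along a parabolic path to a point where `u` is large there is a point where `u` takes a
given intermediate value. -/
lemma exists_eq_on_path (hp : 2 < p) {u : Space n × ℝ → ℝ} {Q : Set (Space n × ℝ)}
    (hu : ContinuousOn u Q) {x₀ y : Space n} {t₀ t m : ℝ}
    (hQ : ∀ σ ∈ Icc (0 : ℝ) 1, (x₀ + σ • (y - x₀), t₀ - σ ^ p * (t₀ - t)) ∈ Q)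
    (h0 : u (x₀, t₀) < m) (h1 : m ≤ u (y, t)) :
    ∃ σ, 0 < σ ∧ σ ≤ 1 ∧ u (x₀ + σ • (y - x₀), t₀ - σ ^ p * (t₀ - t)) = m := by
  have hpath : Continuous fun σ : ℝ => (x₀ + σ • (y - x₀), t₀ - σ ^ p * (t₀ - t)) := by
    have : Continuous fun σ : ℝ => σ ^ p := Real.continuous_rpow_const (by linarith)
    fun_prop
  have hc := hu.comp hpath.continuousOn hQ
  have e0 : (x₀ + (0 : ℝ) • (y - x₀), t₀ - (0 : ℝ) ^ p * (t₀ - t)) = (x₀, t₀) := by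
    simp [Real.zero_rpow (by linarith : p ≠ 0)]
  have e1 : (x₀ + (1 : ℝ) • (y - x₀), t₀ - (1 : ℝ) ^ p * (t₀ - t)) = (y, t) := by
    simp
  obtain ⟨σ, hσ, hσm⟩ := intermediate_value_Icc zero_le_one hc
    (show m ∈ Icc _ _ from ⟨by simp only [Function.comp_apply, e0]; exact h0.le,
      by simp only [Function.comp_apply, e1]; exact h1⟩)
  simp only [Function.comp_apply] at hσm
  refine ⟨σ, lt_of_le_of_ne hσ.1 fun h => ?_, hσ.2, hσm⟩
  rw [← h, e0] at hσm
  linarith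

end Harnack

end DegenerateParabolic

end

/-! ### The Harnack inequality. -/

open DegenerateParabolic

theorem theorem1p2 (n : ℕ) (hn : 1 ≤ n) (p lam Lam : ℝ) (hp : 2 < p) (hlam : 0 < lam)
    (hLam : lam ≤ Lam) :
    ∃ c₁ C c₂ : ℝ, 0 < c₁ ∧ 1 < C ∧ c₁ ≤ c₂ ∧
      ∀ (U : Set (DegenerateParabolic.Space n)) (T : ℝ) (F : DegenerateParabolic.Operator n)
        (u : DegenerateParabolic.Space n × ℝ → ℝ),
        IsOpen U →
        DegenerateParabolic.IsDegenerateElliptic p lam Lam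
          (DegenerateParabolic.cylDomain U 0 T) F →
        DegenerateParabolic.IsViscositySolution F U 0 T u →
        (∀ z ∈ DegenerateParabolic.cylDomain U 0 T, 0 ≤ u z) →
        ∀ (x₀ : DegenerateParabolic.Space n) (t₀ : ℝ),
          (x₀, t₀) ∈ DegenerateParabolic.cylDomain U 0 T → 0 < u (x₀, t₀) →
          ∀ ρ : ℝ, 0 < ρ →
            (∀ θ₁ : ℝ, θ₁ = (c₁ / u (x₀, t₀)) ^ (p - 2) →
              DegenerateParabolic.cylMinus p x₀ t₀ (4 * ρ) θ₁ ⊆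
                DegenerateParabolic.cylDomain U 0 T →
              ∀ z ∈ DegenerateParabolic.cylMinus p x₀ (t₀ - θ₁ * ρ ^ p) ρ θ₁,
                u z ≤ C * u (x₀, t₀)) ∧
            (∀ θ₂ : ℝ, θ₂ = (c₂ / u (x₀, t₀)) ^ (p - 2) →
              DegenerateParabolic.cylMinus p x₀ (t₀ + 2 * θ₂ * ρ ^ p) (4 * ρ) θ₂ ⊆
                DegenerateParabolic.cylDomain U 0 T →
              ∀ z ∈ DegenerateParabolic.cylPlus p x₀ (t₀ + θ₂ * ρ ^ p) ρ θ₂,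
                1 / C * u (x₀, t₀) ≤ u z) := by
  have hN : 0 ≤ Lam * n := mul_nonneg (hlam.le.trans hLam) (Nat.cast_nonneg n)
  obtain ⟨M, κ, hM, hκ, hforward⟩ := exists_forward_harnack (n := n) hp hlam hN
  obtain ⟨C, hC1, hCκ⟩ : ∃ C : ℝ, 1 < C ∧ 1 < κ * C := by
    refine ⟨1 + 2 / κ, ?_, ?_⟩
    · have : 0 < 2 / κ := by positivity
      linarith
    · rw [mul_add, mul_div_cancel₀ _ hκ.ne']
      linarith
  have hC0 : 0 < C := by linarith
  -- With `c₁ = M / C`, the time `θ₁ ρ^p` is the forward waiting time for the value `C u(x₀, t₀)` at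
  -- scale `ρ`.
  refine ⟨M / C, C, M, by positivity, hC1, div_le_self hM.le hC1.le, ?_⟩
  intro U T F u hU hF hsol hpos x₀ t₀ hz₀ hu₀ ρ hρ
  have hsuper : PosSuper p lam (Lam * n) (cylDomain U 0 T) u :=
    ⟨hsol.1, hpos, fun z hz => hsol.2.1.superAt hU hF hpos hz⟩
  have hsub : ∀ c, ∀ z ∈ cylDomain U 0 T, SuperAt p lam (Lam * n) (fun y => c - u y) z :=
    fun c z hz => hsol.2.2.superAt_const_sub hU hF hsol.1 c hz
  have h4p : (16 : ℝ) ≤ 4 ^ p := by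
    calc (16 : ℝ) = 4 ^ (2 : ℝ) := by norm_num
      _ ≤ 4 ^ p := Real.rpow_le_rpow_of_exponent_le (by norm_num) hp.le
  have hρp : 0 < ρ ^ p := by positivity
  constructor
  · rintro θ₁ hθ₁ hQ ⟨y, t⟩ ⟨hy, ht⟩
    have hθ0 : 0 < θ₁ := by rw [hθ₁]; positivity
    have hθρ : 0 < θ₁ * ρ ^ p := by positivity
    rw [mem_ball_iff_norm] at hy
    simp only at hy ht
    have h16 : 16 * (θ₁ * ρ ^ p) ≤ θ₁ * (4 * ρ) ^ p := by
      rw [Real.mul_rpow (by norm_num) hρ.le, mul_left_comm]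
      gcongr
    by_contra hcon
    rw [not_le] at hcon
    have hpath : ∀ σ ∈ Icc (0 : ℝ) 1, ∀ x : Space n, ‖x - (x₀ + σ • (y - x₀))‖ ≤ 3 * (σ * ρ) →
        ‖x - x₀‖ < 4 * ρ := by
      intro σ hσ x hx
      have h1 : ‖x - x₀‖ ≤ ‖x - (x₀ + σ • (y - x₀))‖ + ‖σ • (y - x₀)‖ := by
        have : x - x₀ = (x - (x₀ + σ • (y - x₀))) + σ • (y - x₀) := by abel
        conv_lhs => rw [this]
        exact norm_add_le _ _
      rw [norm_smul, Real.norm_of_nonneg hσ.1] at h1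
      have h2 : σ * ‖y - x₀‖ ≤ 1 * ‖y - x₀‖ := by gcongr; exact hσ.2
      have h3 : σ * ρ ≤ 1 * ρ := by gcongr; exact hσ.2
      linarith
    have hQ' : ∀ σ ∈ Icc (0 : ℝ) 1,
        (x₀ + σ • (y - x₀), t₀ - σ ^ p * (t₀ - t)) ∈ cylDomain U 0 T := by
      intro σ hσ
      refine hQ ⟨?_, ?_, ?_⟩
      · rw [mem_ball_iff_norm]
        exact hpath σ hσ _ (by
          rw [sub_self, norm_zero]
          exact mul_nonneg (by norm_num) (mul_nonneg hσ.1 hρ.le))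
      · have h1 : σ ^ p ≤ 1 := Real.rpow_le_one hσ.1 hσ.2 (by linarith)
        have h2 : σ ^ p * (t₀ - t) ≤ 1 * (t₀ - t) := by
          gcongr
          linarith [ht.2]
        simp only
        linarith [ht.1]
      · have h1 : 0 ≤ σ ^ p * (t₀ - t) :=
          mul_nonneg (Real.rpow_nonneg hσ.1 _) (by linarith [ht.2])
        simp only
        linarith
    -- The path is parabolic, so at parameter `σ` the distance to `x₀` is at most `σρ` and the time
    -- lag lies between one and two waiting times at scale `σρ`. The forward inequality from this
    -- point back to `(x₀, t₀)` gives `κ C u(x₀, t₀) ≤ u(x₀, t₀)`, contradicting `κ C > 1`.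
    obtain ⟨σ, hσ0, hσ1, hσ⟩ := exists_eq_on_path hp hsol.1 hQ'
      (show u (x₀, t₀) < C * u (x₀, t₀) from lt_mul_of_one_lt_left hu₀ hC1) hcon.le
    set x := x₀ + σ • (y - x₀) with hx
    set s := t₀ - σ ^ p * (t₀ - t) with hs
    have hσp : 0 < σ ^ p := by positivity
    have hσp1 : σ ^ p ≤ 1 := Real.rpow_le_one hσ0.le hσ1 (by linarith)
    set θ := σ ^ p * (θ₁ * ρ ^ p) with hθ
    have hθ1 : θ ≤ θ₁ * ρ ^ p := mul_le_of_le_one_left hθρ.le hσp1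
    have hst1 : θ ≤ σ ^ p * (t₀ - t) := by
      rw [hθ]
      gcongr
      linarith [ht.2]
    have hst2 : σ ^ p * (t₀ - t) ≤ 2 * θ := by
      rw [hθ, mul_left_comm]
      gcongr
      linarith [ht.1]
    have hmem : Metric.closedBall x (3 * (σ * ρ)) ×ˢ Icc (s - θ) t₀ ⊆ cylDomain U 0 T := by
      rintro ⟨x', t'⟩ ⟨hx', ht'⟩
      rw [mem_closedBall_iff_norm] at hx'
      simp only at hx' ht'
      refine hQ ⟨?_, ?_, ht'.2⟩
      · rw [mem_ball_iff_norm]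
        exact hpath σ ⟨hσ0.le, hσ1⟩ x' hx'
      · simp only
        linarith [ht'.1]
    have h1 := hforward u x x₀ s t₀ (σ * ρ) θ (by positivity) (by rw [hσ]; positivity) ?_
      (by linarith) (by linarith) (hsuper.mono hmem) (fun c z hz => hsub c z (hmem hz)) ?_
    · rw [hσ, ← mul_assoc] at h1
      exact absurd h1 (not_le.2 (lt_mul_of_one_lt_left hu₀ hCκ))
    · rw [hσ, hθ, hθ₁, Real.mul_rpow hσ0.le hρ.le, div_div]
      ring
    · have : x₀ - x = -(σ • (y - x₀)) := by rw [hx]; abel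
      rw [this, norm_neg, norm_smul, Real.norm_of_nonneg hσ0.le]
      gcongr
  · rintro θ₂ hθ₂ hQ ⟨y, t⟩ ⟨hy, ht⟩
    have hθ0 : 0 < θ₂ := by rw [hθ₂]; positivity
    have hθρ : 0 < θ₂ * ρ ^ p := by positivity
    rw [mem_ball_iff_norm] at hy
    simp only at hy ht
    have h16 : 16 * (θ₂ * ρ ^ p) ≤ θ₂ * (4 * ρ) ^ p := by
      rw [Real.mul_rpow (by norm_num) hρ.le, mul_left_comm]
      gcongr
    have hmem : Metric.closedBall x₀ (3 * ρ) ×ˢ Icc (t₀ - θ₂ * ρ ^ p) t ⊆ cylDomain U 0 T := by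
      rintro ⟨x', t'⟩ ⟨hx', ht'⟩
      simp only at hx' ht'
      refine hQ ⟨Metric.closedBall_subset_ball (by linarith) hx', ?_, ?_⟩
      · simp only
        linarith [ht'.1]
      · simp only
        linarith [ht'.2, ht.2]
    have h1 := hforward u x₀ y t₀ t ρ (θ₂ * ρ ^ p) hρ hu₀ (by rw [hθ₂]) ht.1
      (by linarith [ht.2]) (hsuper.mono hmem) (fun c z hz => hsub c z (hmem hz)) hy.le
    refine le_trans ?_ h1
    gcongr
    rw [div_le_iff₀ hC0]
    exact hCκ.le
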